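/- **Definitions.** $G_{3,1}$ is the Thompson-Higman group over the alphabet $\{0,1,\#\}$: its elements are the maximal isomorphisms between finitely generated essential right ideals of $\{0,1,\#\}^*$ (partial bijections $\varphi$ with $\varphi(ux)=\varphi(u)x$), and the product $\varphi\psi$ is the maximum extension of $\varphi\circ\psi$. The domain code of $\varphi$ is the prefix code that generates its domain as a right ideal; the image code of $\varphi$ is the domain code of $\varphi^{-1}$. For $i\ge 0$, $\tau_{i,i+1}\in G_{3,1}$ is given by exchanging the bits in positions $i$ and $i+1$ (counted from $0$) of words in $\{0,1\}^{i+2}$, and on the words $z\#$ with $z\in\{0,1\}^{\ell}$, $\ell\le i+1$ (which are too short), by a permutation of the positions of the bits of $z$ that depends only on $i$ and $\ell$ and fixes position $0$ when $i>0$. The choice of these permutations is an arbitrary fixed convention. Let $\Delta$ be any finite generating set of $G_{3,1}$. A word over $\Delta^{\pm1}\cup\{\tau_{i,i+1}: i\ge 0\}$ represents the product of its letters. For $n\ge 0$ let $i(n)\in\{0,1,2\}$ be such that $n+i(n)$ is a multiple of $3$. An element $\Phi\in G_{3,1}$ *simulates* $f:\{0,1\}^m\to\{0,1\}^n$ if: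 - $|\Phi(x)|\equiv|x| \pmod 3$ for all $x\in\{0,1\}^*$ for which $\Phi(x)$ is defined; - the domain code and the image code of $\Phi$ are contained in $\{0,1\}\{0,1\}^*\cup\{0,1\}^*\#$; - $\Phi(0x_1\ldots x_m)$ is defined and equals $0^{1+i(n)}\,f(x_1,\ldots,x_m)\,x_1\ldots x_m$ for all $x_1,\ldots,x_m\in\{0,1\}$; - where they are defined, $\Phi$ and $\Phi^{-1}$ map $\{0,1\}^*$ into itself and $\{0,1\}^*\#$ into itself, $\Phi$ maps $0\{0,1\}^*$ into itself, and $\Phi^{-1}$ maps $1\{0,1\}^*$ into itself. It *strongly simulates* $f$ if moreover $\Phi(0x_1\ldots x_k\#)$ is defined for all $0\le k<m$ and $x_1,\ldots,x_k\in\{0,1\}$. A word (strongly) simulates $f$ if the element that it represents does. Acyclic boolean circuits $C$ are built from AND, OR (fan-in 2), NOT and FORK gates; any number of wires may leave an input variable or an output port of a gate (in particular circuits that duplicate values only through FORK gates are included), and every input variable is connected by a wire to a gate or to an output variable; $f_C:\{0,1\}^m\to\{0,1\}^n$ is the input-output function. The size $|C|$ is the number of wires: $|C|=k_1+2k_2+n$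 for $k_1$ gates of type NOT or FORK, $k_2$ gates of type AND or OR, and $n$ output variables. For a word $w$, $J_w$ is the largest subscript $j=i+1$ of any letter $\tau_{i,i+1}$ in $w$. **Theorem.** For every finite generating set $\Delta$ of $G_{3,1}$ there is an injective function $C\mapsto w_C$ from the set of acyclic boolean circuits to the set of words over $\Delta^{\pm1}\cup\{\tau_{i,i+1}: i\ge 0\}$ such that: 1. $w_C$ strongly simulates $f_C$; moreover, for $k<m$, the value at $0x_1\ldots x_k\#$ of the element represented by $w_C$ depends only on the function $f_C$, on $k$ and on $x_1,\ldots,x_k$, and not on the circuit $C$ that computes $f_C$; 2. for some positive constant $c$ and all $C$, $|w_C|<c\,|C|^4+c$ and $J_{w_C}\le c\,|C|^2+c$ (the second bound holds trivially if no $\tau_{i,i+1}$ occurs in $w_C$); 3. $w_C$, with the subscripts of the transpositions written in unary, is computable from $C$ by a deterministic Turing machine in time polynomial in $|C|$. -/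

import Mathlib

/-! ## Right ideals of the free monoid and the Thompson-Higman group -/

namespace ThompsonHigman

/-- A right ideal of the free monoid `A^*`. -/
def IsRightIdeal {A : Type} (R : Set (List A)) : Prop :=
  ∀ u ∈ R, ∀ x : List A, u ++ x ∈ R

/-- A right ideal is finitely generated if it is `Γ A^*` for a finite set `Γ`. -/
def IsFinGen {A : Type} (R : Set (List A)) : Prop :=
  ∃ Γ : Set (List A), Γ.Finite ∧ R = {w | ∃ γ ∈ Γ, ∃ x : List A, w = γ ++ x}

/-- A right ideal is essential if it meets every (nonempty) right ideal. -/
def IsEssential {A : Type} (R : Set (List A)) : Prop :=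
  ∀ J : Set (List A), IsRightIdeal J → J.Nonempty → (R ∩ J).Nonempty

/-- The domain of a partial injective map of `A^*`; the image is the domain of the inverse. -/
def dom {A : Type} (f : List A ≃. List A) : Set (List A) := {u | ∃ v, v ∈ f u}

/-- `f` is a right-ideal isomorphism from `dom f` to `dom f.symm`: whenever `f u = v`,
also `f (u x) = v x` for all words `x`. -/
def IsRightIdealIso {A : Type} (f : List A ≃. List A) : Prop :=
  ∀ u v x : List A, v ∈ f u → v ++ x ∈ f (u ++ x)

/-- `f` is an isomorphism between finitely generated essential right ideals. -/
structure IsFinEssIso {A : Type} (f : List A ≃. List A) : Prop where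
  iso : IsRightIdealIso f
  dom_fg : IsFinGen (dom f)
  dom_ess : IsEssential (dom f)
  im_fg : IsFinGen (dom f.symm)
  im_ess : IsEssential (dom f.symm)

/-- `f` has no strict extension to a right-ideal isomorphism. -/
def IsMaximalIso {A : Type} (f : List A ≃. List A) : Prop :=
  ∀ g : List A ≃. List A, IsRightIdealIso g → f ≤ g → g = f

theorem IsRightIdealIso.symm {A : Type} {f : List A ≃. List A} (hf : IsRightIdealIso f) :
    IsRightIdealIso f.symm := fun u v x h =>
  (PEquiv.mem_iff_mem f).2 (hf v u x ((PEquiv.mem_iff_mem f).1 h))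

theorem IsRightIdealIso.trans {A : Type} {f g : List A ≃. List A} (hf : IsRightIdealIso f)
    (hg : IsRightIdealIso g) : IsRightIdealIso (f.trans g) := by
  intro u v x h
  rw [PEquiv.mem_trans] at h ⊢
  obtain ⟨b, hb, hv⟩ := h
  exact ⟨b ++ x, hf _ _ x hb, hg _ _ x hv⟩

theorem IsRightIdealIso.isRightIdeal_dom {A : Type} {f : List A ≃. List A}
    (hf : IsRightIdealIso f) : IsRightIdeal (dom f) := by
  rintro u ⟨v, hv⟩ x
  exact ⟨_, hf u v x hv⟩

/-- Over a finite nonempty alphabet, a right ideal is finitely generated and essential if and only if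
it contains all sufficiently long words. -/
theorem fg_essential_iff {A : Type} [Finite A] [Nonempty A] {R : Set (List A)} (hR : IsRightIdeal R) :
    (IsFinGen R ∧ IsEssential R) ↔ ∃ n : ℕ, ∀ w : List A, n ≤ w.length → w ∈ R := by
  constructor
  · rintro ⟨⟨Γ, hΓ, rfl⟩, hE⟩
    obtain ⟨n, hn⟩ := (hΓ.image List.length).bddAbove
    refine ⟨n, fun w hw => ?_⟩
    obtain ⟨_, ⟨γ, hγ, x, rfl⟩, y, hy⟩ := hE {v | ∃ y, v = w ++ y}
      (by rintro _ ⟨y, rfl⟩ x; exact ⟨y ++ x, by simp⟩) ⟨w, [], by simp⟩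
    have hl : γ.length ≤ w.length := (hn ⟨γ, hγ, rfl⟩).trans hw
    have hp : γ <+: w :=
      List.prefix_of_prefix_length_le ⟨x, rfl⟩ (hy ▸ ⟨y, rfl⟩) hl
    obtain ⟨t, rfl⟩ := hp
    exact ⟨γ, hγ, t, rfl⟩
  · rintro ⟨n, hn⟩
    refine ⟨⟨{w | w ∈ R ∧ w.length ≤ n}, ?_, ?_⟩, ?_⟩
    · exact (List.finite_length_le A n).subset (fun w hw => hw.2)
    · ext w
      constructor
      · intro hw
        by_cases h : w.length ≤ n
        · exact ⟨w, ⟨hw, h⟩, [], by simp⟩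
        · refine ⟨w.take n, ⟨hn _ ?_, ?_⟩, w.drop n, by simp⟩
          · simp; omega
          · simp
      · rintro ⟨γ, ⟨hγ, -⟩, x, rfl⟩
        exact hR γ hγ x
    · intro J hJ ⟨u, hu⟩
      obtain ⟨a⟩ := ‹Nonempty A›
      exact ⟨u ++ List.replicate n a, hn _ (by simp), hJ u hu _⟩

/-- To check that `f` is an isomorphism between finitely generated essential right ideals,
it suffices that `f` and its inverse are defined on all sufficiently long words. -/
theorem isFinEssIso_iff {A : Type} [Finite A] [Nonempty A] {f : List A ≃. List A}
    (hf : IsRightIdealIso f) :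
    IsFinEssIso f ↔ ∃ n : ℕ, ∀ w : List A, n ≤ w.length → w ∈ dom f ∧ w ∈ dom f.symm := by
  constructor
  · intro h
    obtain ⟨a, ha⟩ := (fg_essential_iff hf.isRightIdeal_dom).1 ⟨h.dom_fg, h.dom_ess⟩
    obtain ⟨b, hb⟩ := (fg_essential_iff hf.symm.isRightIdeal_dom).1 ⟨h.im_fg, h.im_ess⟩
    exact ⟨max a b, fun w hw => ⟨ha w (le_trans (le_max_left _ _) hw),
      hb w (le_trans (le_max_right _ _) hw)⟩⟩
  · rintro ⟨n, hn⟩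
    have h1 := (fg_essential_iff hf.isRightIdeal_dom).2 ⟨n, fun w hw => (hn w hw).1⟩
    have h2 := (fg_essential_iff hf.symm.isRightIdeal_dom).2 ⟨n, fun w hw => (hn w hw).2⟩
    exact ⟨hf, h1.1, h1.2, h2.1, h2.2⟩

theorem IsFinEssIso.symm {A : Type} {f : List A ≃. List A} (hf : IsFinEssIso f) :
    IsFinEssIso f.symm :=
  ⟨hf.iso.symm, hf.im_fg, hf.im_ess, hf.dom_fg, hf.dom_ess⟩

theorem isFinEssIso_refl {A : Type} [Finite A] [Nonempty A] :
    IsFinEssIso (PEquiv.refl (List A)) := by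
  have h : IsRightIdealIso (PEquiv.refl (List A)) := by
    intro u v x h
    simp only [PEquiv.refl_apply, Option.mem_def, Option.some.injEq] at h ⊢
    rw [h]
  exact (isFinEssIso_iff h).2 ⟨0, fun w _ => ⟨⟨w, rfl⟩, ⟨w, rfl⟩⟩⟩

theorem IsFinEssIso.trans_dom {A : Type} [Finite A] [Nonempty A] {f g : List A ≃. List A}
    (hf : IsFinEssIso f) (hg : IsFinEssIso g) :
    ∃ n : ℕ, ∀ w : List A, n ≤ w.length → w ∈ dom (f.trans g) := by
  obtain ⟨a, ha⟩ := (isFinEssIso_iff hf.iso).1 hf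
  obtain ⟨b, hb⟩ := (isFinEssIso_iff hg.iso).1 hg
  refine ⟨a + b, fun w hw => ?_⟩
  obtain ⟨v, hv⟩ := (ha (w.take a) (by simp; omega)).1
  have h1 := hf.iso _ _ (w.drop a) hv
  rw [List.take_append_drop] at h1
  obtain ⟨y, hy⟩ := (hb (v ++ w.drop a) (by simp; omega)).1
  exact ⟨y, (PEquiv.mem_trans f g _ _).2 ⟨_, h1, hy⟩⟩

theorem IsFinEssIso.trans {A : Type} [Finite A] [Nonempty A] {f g : List A ≃. List A}
    (hf : IsFinEssIso f) (hg : IsFinEssIso g) : IsFinEssIso (f.trans g) := by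
  obtain ⟨a, ha⟩ := hf.trans_dom hg
  obtain ⟨b, hb⟩ := hg.symm.trans_dom hf.symm
  refine (isFinEssIso_iff (hf.iso.trans hg.iso)).2 ⟨max a b, fun w hw => ⟨ha w ?_, hb w ?_⟩⟩
  · exact le_trans (le_max_left _ _) hw
  · exact le_trans (le_max_right _ _) hw

/-- The maximum extension of `f` sends `u` to `v` when `f (u w) = v w` holds for an essential
set of words `w`. -/
def MaxRel {A : Type} (f : List A ≃. List A) (u v : List A) : Prop :=
  ∀ w : List A, ∃ w' : List A, v ++ (w ++ w') ∈ f (u ++ (w ++ w'))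

theorem MaxRel.symm {A : Type} {f : List A ≃. List A} {u v : List A} (h : MaxRel f u v) :
    MaxRel f.symm v u := fun w =>
  let ⟨w', hw⟩ := h w
  ⟨w', (PEquiv.mem_iff_mem f).2 hw⟩

theorem MaxRel.unique {A : Type} {f : List A ≃. List A} (hf : IsRightIdealIso f)
    {u v v' : List A} (h : MaxRel f u v) (h' : MaxRel f u v') : v = v' := by
  obtain ⟨w, hw⟩ := h []
  obtain ⟨w', hw'⟩ := h' w
  have h1 := hf _ _ w' hw
  simp only [List.nil_append, List.append_assoc] at h1
  have h2 := Option.mem_unique h1 hw'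
  exact List.append_cancel_right h2

open Classical in
/-- The maximum extension `max f` of a right-ideal isomorphism `f`
(see `maxExt_isMaximal`, `le_maxExt` and `eq_maxExt`). -/
noncomputable def maxExt {A : Type} (f : List A ≃. List A) (hf : IsRightIdealIso f) :
    List A ≃. List A where
  toFun u := if h : ∃ v, MaxRel f u v then some h.choose else none
  invFun v := if h : ∃ u, MaxRel f u v then some h.choose else none
  inv u v := by
    constructor
    · intro h
      split_ifs at h with h1
      have h2 := h1.choose_spec
      rw [Option.some.inj h] at h2
      have h3 : ∃ v, MaxRel f u v := ⟨v, h2⟩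
      rw [dif_pos h3]
      exact congrArg some (MaxRel.unique hf h3.choose_spec h2)
    · intro h
      split_ifs at h with h1
      have h2 := h1.choose_spec
      rw [Option.some.inj h] at h2
      have h3 : ∃ u, MaxRel f u v := ⟨u, h2⟩
      rw [dif_pos h3]
      exact congrArg some (MaxRel.unique hf.symm h3.choose_spec.symm h2.symm)

theorem mem_maxExt {A : Type} {f : List A ≃. List A} (hf : IsRightIdealIso f) {u v : List A} :
    v ∈ maxExt f hf u ↔ MaxRel f u v := by
  classical
  change (if h : ∃ v, MaxRel f u v then some h.choose else none) = some v ↔ _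
  constructor
  · intro h
    split_ifs at h with h1
    have h2 := h1.choose_spec
    rwa [Option.some.inj h] at h2
  · intro h
    have h3 : ∃ v, MaxRel f u v := ⟨v, h⟩
    rw [dif_pos h3]
    exact congrArg some (MaxRel.unique hf h3.choose_spec h)

theorem pequiv_ext_mem {A : Type} {f g : List A ≃. List A}
    (h : ∀ u v, v ∈ f u ↔ v ∈ g u) : f = g :=
  PEquiv.ext fun u => Option.ext fun v => h u v

theorem symm_maxExt {A : Type} {f : List A ≃. List A} (hf : IsRightIdealIso f) :
    (maxExt f hf).symm = maxExt f.symm hf.symm := by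
  refine pequiv_ext_mem fun u v => ?_
  rw [PEquiv.mem_iff_mem, mem_maxExt, mem_maxExt]
  exact ⟨fun h => h.symm, fun h => h.symm⟩

theorem maxExt_iso {A : Type} {f : List A ≃. List A} (hf : IsRightIdealIso f) :
    IsRightIdealIso (maxExt f hf) := by
  intro u v x h
  rw [mem_maxExt] at h ⊢
  intro w
  obtain ⟨w', hw⟩ := h (x ++ w)
  exact ⟨w', by simpa using hw⟩

theorem exists_append_mem_dom {A : Type} {f : List A ≃. List A} (hE : IsEssential (dom f))
    (u : List A) : ∃ x y, y ∈ f (u ++ x) := by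
  obtain ⟨_, ⟨y, hy⟩, ⟨x, rfl⟩⟩ := hE {v | ∃ x, v = u ++ x}
    (by rintro _ ⟨y, rfl⟩ x; exact ⟨y ++ x, by simp⟩) ⟨u, [], by simp⟩
  exact ⟨x, y, hy⟩

theorem maxRel_of_le {A : Type} {f g : List A ≃. List A} (hE : IsEssential (dom f))
    (hg : IsRightIdealIso g) (h : f ≤ g) {u v : List A} (hv : MaxRel g u v) : MaxRel f u v := by
  intro w
  obtain ⟨w', hw⟩ := hv w
  obtain ⟨x, y, hy⟩ := exists_append_mem_dom hE (u ++ (w ++ w'))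
  have h1 := hg _ _ x hw
  have h2 := Option.mem_unique h1 (h _ _ hy)
  refine ⟨w' ++ x, ?_⟩
  rw [← h2] at hy
  simpa using hy

theorem le_maxExt {A : Type} {f : List A ≃. List A} (hf : IsRightIdealIso f) :
    f ≤ maxExt f hf := by
  intro u v h
  rw [mem_maxExt]
  intro w
  exact ⟨[], hf _ _ _ h⟩

theorem maxExt_eq_of_le {A : Type} {f g : List A ≃. List A} (hE : IsEssential (dom f))
    (hf : IsRightIdealIso f) (hg : IsRightIdealIso g) (h : f ≤ g) :
    maxExt f hf = maxExt g hg := by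
  refine pequiv_ext_mem fun u v => ?_
  rw [mem_maxExt, mem_maxExt]
  refine ⟨fun hv w => ?_, maxRel_of_le hE hg h⟩
  obtain ⟨w', hw⟩ := hv w
  exact ⟨w', h _ _ hw⟩

theorem maxExt_isMaximal {A : Type} {f : List A ≃. List A} (hE : IsEssential (dom f))
    (hf : IsRightIdealIso f) : IsMaximalIso (maxExt f hf) := by
  intro g hg h
  refine le_antisymm ?_ h
  rw [maxExt_eq_of_le hE hf hg ((le_maxExt hf).trans h)]
  exact le_maxExt hg

/-- The maximum extension is the only maximal extension. -/
theorem eq_maxExt {A : Type} {f g : List A ≃. List A} (hE : IsEssential (dom f))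
    (hf : IsRightIdealIso f) (hg : IsRightIdealIso g) (h : f ≤ g) (hm : IsMaximalIso g) :
    g = maxExt f hf := by
  rw [maxExt_eq_of_le hE hf hg h]
  exact (hm _ (maxExt_iso hg) (le_maxExt hg)).symm

theorem IsFinEssIso.maxExt {A : Type} [Finite A] [Nonempty A] {f : List A ≃. List A}
    (hf : IsFinEssIso f) : IsFinEssIso (maxExt f hf.iso) := by
  obtain ⟨n, hn⟩ := (isFinEssIso_iff hf.iso).1 hf
  refine (isFinEssIso_iff (maxExt_iso hf.iso)).2 ⟨n, fun w hw => ⟨?_, ?_⟩⟩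
  · obtain ⟨v, hv⟩ := (hn w hw).1
    exact ⟨v, le_maxExt hf.iso _ _ hv⟩
  · obtain ⟨v, hv⟩ := (hn w hw).2
    rw [symm_maxExt]
    exact ⟨v, le_maxExt hf.iso.symm _ _ hv⟩

end ThompsonHigman

/-- The Thompson-Higman group over the alphabet `A` (that is, `G_{N,1}` for `N = |A|`): all
maximal isomorphisms between finitely generated essential right ideals of `A^*`. -/
structure ThompsonHigmanGroup (A : Type) where
  map : List A ≃. List A
  isFinEssIso : ThompsonHigman.IsFinEssIso map
  isMaximal : ThompsonHigman.IsMaximalIso map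

namespace ThompsonHigman

theorem ext_map {A : Type} {φ ψ : ThompsonHigmanGroup A} (h : φ.map = ψ.map) : φ = ψ := by
  cases φ; cases ψ; cases h; rfl

/-- The group element given by the maximum extension of `f`. -/
noncomputable def ofIso {A : Type} [Finite A] [Nonempty A] (f : List A ≃. List A)
    (hf : IsFinEssIso f) : ThompsonHigmanGroup A :=
  ⟨maxExt f hf.iso, hf.maxExt, maxExt_isMaximal hf.dom_ess hf.iso⟩

theorem ofIso_map {A : Type} [Finite A] [Nonempty A] (φ : ThompsonHigmanGroup A) :
    ofIso φ.map φ.isFinEssIso = φ :=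
  ext_map (φ.isMaximal _ (maxExt_iso φ.isFinEssIso.iso) (le_maxExt φ.isFinEssIso.iso))

theorem ofIso_eq_of_le {A : Type} [Finite A] [Nonempty A] {f g : List A ≃. List A}
    (hf : IsFinEssIso f) (hg : IsFinEssIso g) (h : f ≤ g) : ofIso f hf = ofIso g hg :=
  ext_map (maxExt_eq_of_le hf.dom_ess hf.iso hg.iso h)

/-- The product `φ * ψ` is `max (φ ∘ ψ)`: the map `ψ` is applied first. -/
noncomputable instance instMul {A : Type} [Finite A] [Nonempty A] :
    Mul (ThompsonHigmanGroup A) :=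
  ⟨fun φ ψ => ofIso (ψ.map.trans φ.map) (ψ.isFinEssIso.trans φ.isFinEssIso)⟩

noncomputable instance instOne {A : Type} [Finite A] [Nonempty A] :
    One (ThompsonHigmanGroup A) :=
  ⟨ofIso (PEquiv.refl (List A)) isFinEssIso_refl⟩

/-- The inverse partial map. -/
noncomputable instance instInv {A : Type} : Inv (ThompsonHigmanGroup A) :=
  ⟨fun φ => ⟨φ.map.symm, φ.isFinEssIso.symm, fun g hg h => by
    have h1 : φ.map ≤ g.symm := fun u v huv =>
      (PEquiv.mem_iff_mem g).2 (h _ _ ((PEquiv.mem_iff_mem φ.map).2 huv))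
    rw [← φ.isMaximal _ hg.symm h1, PEquiv.symm_symm]⟩⟩

theorem ofIso_mul_ofIso {A : Type} [Finite A] [Nonempty A] {f g : List A ≃. List A}
    (hf : IsFinEssIso f) (hg : IsFinEssIso g) :
    ofIso f hf * ofIso g hg = ofIso (g.trans f) (hg.trans hf) := by
  symm
  refine ofIso_eq_of_le _ _ fun u v h => ?_
  rw [PEquiv.mem_trans] at h ⊢
  obtain ⟨b, hb, hv⟩ := h
  exact ⟨b, le_maxExt hg.iso _ _ hb, le_maxExt hf.iso _ _ hv⟩

noncomputable instance instGroup {A : Type} [Finite A] [Nonempty A] :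
    Group (ThompsonHigmanGroup A) :=
  Group.ofLeftAxioms
    (fun φ ψ χ => by
      rw [← ofIso_map φ, ← ofIso_map ψ, ← ofIso_map χ]
      simp only [ofIso_mul_ofIso]
      exact ofIso_eq_of_le _ _ (le_of_eq (PEquiv.trans_assoc _ _ _).symm))
    (fun φ => by
      conv_rhs => rw [← ofIso_map φ]
      conv_lhs => rw [← ofIso_map φ]
      change ofIso _ _ * ofIso _ _ = _
      rw [ofIso_mul_ofIso]
      exact ofIso_eq_of_le _ _ (le_of_eq (PEquiv.trans_refl _)))
    (fun φ => by
      have h : φ⁻¹ * φ = ofIso (φ.map.trans φ⁻¹.map)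
        (φ.isFinEssIso.trans φ⁻¹.isFinEssIso) := rfl
      rw [h]
      refine ofIso_eq_of_le _ _ fun u v huv => ?_
      rw [PEquiv.mem_trans] at huv
      obtain ⟨b, hb, hv⟩ := huv
      have h2 : v ∈ φ.map.symm b := hv
      rw [PEquiv.mem_iff_mem] at h2
      have : u = v := PEquiv.inj _ hb h2
      rw [this]; rfl)

/-- The domain code of `φ`: the prefix code that generates the right ideal `dom φ`, that is, the
words of the domain none of whose strict prefixes is in the domain. -/
def domCode {A : Type} (φ : ThompsonHigmanGroup A) : Set (List A) :=
  {u | u ∈ dom φ.map ∧ ∀ v, v <+: u → v ∈ dom φ.map → v = u}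

/-- The image code of `φ` is the domain code of its inverse. -/
def imCode {A : Type} (φ : ThompsonHigmanGroup A) : Set (List A) := domCode φ⁻¹

/-- The partial map `φ` maps `S` into `T`, where it is defined. -/
def MapsInto {A : Type} (φ : ThompsonHigmanGroup A) (S T : Set (List A)) : Prop :=
  ∀ u ∈ S, ∀ v ∈ φ.map u, v ∈ T

end ThompsonHigman

/-! ## The group `G_{3,1}` over `{0, 1, #}` and the transpositions `τ_{i,i+1}` -/

/-- The alphabet `{0, 1, #}`: `some b` is the bit `b` and `none` is the end marker `#`. -/
abbrev Letter3 : Type := Option Bool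

/-- The group `G_{3,1}`. -/
abbrev G31 : Type := ThompsonHigmanGroup Letter3

namespace G31

/-- A bit string as a word over `{0, 1, #}`. -/
def bits (z : List Bool) : List Letter3 := z.map some

/-- The word `z #` for a bit string `z`. -/
def bitsHash (z : List Bool) : List Letter3 := bits z ++ [none]

/-- The longest prefix of a word that is a bit string. -/
def bitPrefix : List Letter3 → List Bool
  | [] => []
  | none :: _ => []
  | some b :: t => b :: bitPrefix t

/-- What follows the longest bit-string prefix: empty, or a word that starts with `#`. -/
def bitRest : List Letter3 → List Letter3
  | [] => []
  | none :: t => none :: t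
  | some _ :: t => bitRest t

theorem bits_append_bitRest (x : List Letter3) : bits (bitPrefix x) ++ bitRest x = x := by
  induction x with
  | nil => rfl
  | cons a t ih =>
    cases a with
    | none => rfl
    | some b => simpa [bits, bitPrefix, bitRest] using ih

theorem bitRest_cases (x : List Letter3) : bitRest x = [] ∨ ∃ t, bitRest x = none :: t := by
  induction x with
  | nil => exact Or.inl rfl
  | cons a t ih =>
    cases a with
    | none => exact Or.inr ⟨t, rfl⟩
    | some b => simpa [bitRest] using ih

theorem bitPrefix_bits_append (z : List Bool) (x : List Letter3) :
    bitPrefix (bits z ++ x) = z ++ bitPrefix x := by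
  induction z with
  | nil => rfl
  | cons b t ih => simpa [bits, bitPrefix] using ih

theorem bitRest_bits_append (z : List Bool) (x : List Letter3) :
    bitRest (bits z ++ x) = bitRest x := by
  induction z with
  | nil => rfl
  | cons b t ih => simpa [bits, bitRest] using ih

theorem bitPrefix_bitRest (x : List Letter3) : bitPrefix (bitRest x) = [] := by
  rcases bitRest_cases x with h | ⟨t, h⟩ <;> rw [h] <;> rfl

theorem bitRest_bitRest (x : List Letter3) : bitRest (bitRest x) = bitRest x := by
  rcases bitRest_cases x with h | ⟨t, h⟩ <;> rw [h] <;> rfl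

/-- Rearrange a bit string of length `ℓ` by the permutation `σ ℓ` of its positions. -/
def permute (σ : ∀ ℓ : ℕ, Equiv.Perm (Fin ℓ)) (z : List Bool) : List Bool :=
  List.ofFn fun k : Fin z.length => z.get (σ z.length k)

theorem length_permute (σ : ∀ ℓ : ℕ, Equiv.Perm (Fin ℓ)) (z : List Bool) :
    (permute σ z).length = z.length := by
  simp [permute]

theorem permute_ofFn (σ : ∀ ℓ : ℕ, Equiv.Perm (Fin ℓ)) {ℓ : ℕ} (x : Fin ℓ → Bool) :
    permute σ (List.ofFn x) = List.ofFn fun k => x (σ ℓ k) := by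
  have h : ∀ (z : List Bool) (hz : z.length = ℓ),
      permute σ z = List.ofFn fun k => z.get (Fin.cast hz.symm (σ ℓ k)) := by
    rintro z rfl
    rfl
  rw [h _ (List.length_ofFn)]
  simp

theorem permute_inv_permute (σ : ∀ ℓ : ℕ, Equiv.Perm (Fin ℓ)) (z : List Bool) :
    permute (fun ℓ => (σ ℓ)⁻¹) (permute σ z) = z := by
  have h : permute σ z = List.ofFn fun k : Fin z.length => z.get (σ z.length k) := rfl
  rw [h, permute_ofFn]
  simp

/-- The freedom in the definition of the transpositions `τ_{i,i+1}`: a rule for the action of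
`τ_{i,i+1}` on the words `x_0 ... x_{ℓ-1} #` that are too short (`ℓ ≤ i + 1`). There `τ_{i,i+1}`
permutes the bits by a permutation of their positions that may depend on `i` and `ℓ`, and that
fixes the position `0` when `0 < i`. Only the values for `ℓ ≤ i + 1` are used. -/
structure ShortRule where
  perm : ∀ i ℓ : ℕ, Equiv.Perm (Fin ℓ)
  fix_first : ∀ i : ℕ, 0 < i → ∀ (ℓ : ℕ) (h : 0 < ℓ), perm i ℓ ⟨0, h⟩ = ⟨0, h⟩

/-- The permutation of positions by which `τ_{i,i+1}` acts on bit strings of length `ℓ`: the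
transposition of the positions `i` and `i + 1` if the string is long enough, and otherwise the
permutation that is given by the rule `ρ`. -/
def tauPerm (ρ : ShortRule) (i ℓ : ℕ) : Equiv.Perm (Fin ℓ) :=
  if h : i + 1 < ℓ then Equiv.swap ⟨i, by omega⟩ ⟨i + 1, h⟩ else ρ.perm i ℓ

/-- A partial map that rearranges the longest bit-string prefix of a word. It is undefined on
bit strings of length at most `i + 1`. -/
def rearrange (σ : ∀ ℓ : ℕ, Equiv.Perm (Fin ℓ)) (i : ℕ) (x : List Letter3) :
    Option (List Letter3) :=
  if i + 1 < (bitPrefix x).length ∨ bitRest x ≠ [] then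
    some (bits (permute σ (bitPrefix x)) ++ bitRest x)
  else none

theorem rearrange_inv {σ τ : ∀ ℓ : ℕ, Equiv.Perm (Fin ℓ)} {i : ℕ} {x y : List Letter3}
    (hτ : ∀ z, permute τ (permute σ z) = z) (h : rearrange σ i x = some y) :
    rearrange τ i y = some x := by
  unfold rearrange at h
  split_ifs at h with h1
  rw [Option.some.injEq] at h
  have hp : bitPrefix y = permute σ (bitPrefix x) := by
    rw [← h, bitPrefix_bits_append, bitPrefix_bitRest, List.append_nil]
  have hr : bitRest y = bitRest x := by
    rw [← h, bitRest_bits_append, bitRest_bitRest]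
  unfold rearrange
  rw [hp, hr, length_permute, if_pos h1, hτ, bits_append_bitRest]

/-- The action of `τ_{i,i+1}` on words: on a word `z r`, where `z` is the longest prefix that is
a bit string, it permutes the bits of `z` by `tauPerm`. As `r` is empty or starts with `#`, this
is the right-ideal isomorphism with domain code and image code
`{0,1}^{i+2} ∪ {0,1}^{≤ i+1} #`. -/
def tauMap (ρ : ShortRule) (i : ℕ) : List Letter3 ≃. List Letter3 where
  toFun := rearrange (tauPerm ρ i) i
  invFun := rearrange (fun ℓ => (tauPerm ρ i ℓ)⁻¹) i
  inv x y :=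
    ⟨rearrange_inv fun z => by
        simpa using permute_inv_permute (fun ℓ => (tauPerm ρ i ℓ)⁻¹) z,
      rearrange_inv (permute_inv_permute _)⟩

theorem permute_swap_append (ρ : ShortRule) (i : ℕ) (z t : List Bool) (h : i + 1 < z.length) :
    permute (tauPerm ρ i) (z ++ t) = permute (tauPerm ρ i) z ++ t := by
  have hval : ∀ (ℓ : ℕ), i + 1 < ℓ → ∀ k : Fin ℓ, ((tauPerm ρ i ℓ k : Fin ℓ) : ℕ) =
      if (k : ℕ) = i then i + 1 else if (k : ℕ) = i + 1 then i else k := by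
    intro ℓ hℓ k
    rw [tauPerm, dif_pos hℓ, Equiv.swap_apply_def]
    simp only [Fin.ext_iff]
    split_ifs <;> rfl
  refine List.ext_getElem (by simp [length_permute]) fun k h1 h2 => ?_
  have hk : k < z.length + t.length := by simpa [length_permute] using h1
  have e1 : (permute (tauPerm ρ i) (z ++ t))[k] =
      (z ++ t).get (tauPerm ρ i _ ⟨k, by simpa using hk⟩) := by
    simp [permute]
  rw [e1]
  by_cases hkz : k < z.length
  · have e2 : (permute (tauPerm ρ i) z ++ t)[k] = z.get (tauPerm ρ i _ ⟨k, hkz⟩) := by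
      rw [List.getElem_append_left (by simpa [length_permute] using hkz)]
      simp [permute]
    rw [e2, List.get_eq_getElem, List.get_eq_getElem]
    have ha := hval (z ++ t).length (by simp; omega) ⟨k, by simpa using hk⟩
    have hb := hval z.length h ⟨k, hkz⟩
    have hab := ha.trans hb.symm
    simp only [hab]
    rw [List.getElem_append_left]
  · have ha := hval (z ++ t).length (by simp; omega) ⟨k, by simpa using hk⟩
    rw [if_neg (by simp; omega), if_neg (by simp; omega)] at ha
    rw [List.get_eq_getElem]
    simp only [ha]
    rw [List.getElem_append_right (by omega), List.getElem_append_right (by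
      simp [length_permute]; omega)]
    simp [length_permute]

theorem tauMap_iso (ρ : ShortRule) (i : ℕ) : ThompsonHigman.IsRightIdealIso (tauMap ρ i) := by
  intro u v x h
  change rearrange _ i u = some v at h
  change rearrange _ i (u ++ x) = some (v ++ x)
  unfold rearrange at h
  split_ifs at h with h1
  rw [Option.some.injEq] at h
  rcases bitRest_cases u with h2 | ⟨t, h2⟩
  · have h3 : i + 1 < (bitPrefix u).length := by
      rcases h1 with h1 | h1
      · exact h1
      · exact absurd h2 h1
    have hu : u ++ x = bits (bitPrefix u) ++ x := by
      conv_lhs => rw [← bits_append_bitRest u, h2, List.append_nil]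
    have hp : bitPrefix (u ++ x) = bitPrefix u ++ bitPrefix x := by
      rw [hu, bitPrefix_bits_append]
    have hr : bitRest (u ++ x) = bitRest x := by
      rw [hu, bitRest_bits_append]
    unfold rearrange
    rw [hp, hr, if_pos (Or.inl (by simp; omega)), permute_swap_append ρ i _ _ h3, ← h, h2]
    congr 1
    conv_rhs => rw [← bits_append_bitRest x]
    simp [bits]
  · have hu : u ++ x = bits (bitPrefix u) ++ (none :: (t ++ x)) := by
      conv_lhs => rw [← bits_append_bitRest u, h2]
      simp
    have hp : bitPrefix (u ++ x) = bitPrefix u := by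
      rw [hu, bitPrefix_bits_append]
      simp [bitPrefix]
    have hr : bitRest (u ++ x) = bitRest u ++ x := by
      rw [hu, bitRest_bits_append, h2]
      simp [bitRest]
    unfold rearrange
    rw [hp, hr, if_pos (Or.inr (by simp [h2])), ← h]
    simp

theorem rearrange_isSome (σ : ∀ ℓ : ℕ, Equiv.Perm (Fin ℓ)) (i : ℕ) (x : List Letter3)
    (h : i + 2 ≤ x.length) : ∃ y, rearrange σ i x = some y := by
  unfold rearrange
  refine ⟨_, if_pos ?_⟩
  by_cases h2 : bitRest x = []
  · left
    have h3 := congrArg List.length (bits_append_bitRest x)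
    simp [bits, h2] at h3
    omega
  · exact Or.inr h2

theorem tauMap_isFinEssIso (ρ : ShortRule) (i : ℕ) :
    ThompsonHigman.IsFinEssIso (tauMap ρ i) :=
  (ThompsonHigman.isFinEssIso_iff (tauMap_iso ρ i)).2
    ⟨i + 2, fun x hx => ⟨rearrange_isSome _ i x hx, rearrange_isSome _ i x hx⟩⟩

/-- The transposition `τ_{i,i+1}` as an element of `G_{3,1}`. -/
noncomputable def tau (ρ : ShortRule) (i : ℕ) : G31 :=
  ThompsonHigman.ofIso (tauMap ρ i) (tauMap_isFinEssIso ρ i)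

/-! ### Simulation of boolean functions -/

/-- `φ` preserves lengths modulo `3` on bit strings (the condition that defines
`G_{3,1}^{mod 3}` inside `G_{3,1}`). -/
def PreservesLengthMod3 (φ : G31) : Prop :=
  ∀ (x : List Bool), ∀ y ∈ φ.map (bits x), y.length ≡ x.length [MOD 3]

/-- The set `{0,1}{0,1}^* ∪ {0,1}^* #`. -/
def codeWords : Set (List Letter3) :=
  {u | (∃ z : List Bool, z ≠ [] ∧ u = bits z) ∨ ∃ z : List Bool, u = bitsHash z}

/-- The number `i(n) ∈ {0,1,2}` for which `n + i(n)` is a multiple of `3`. -/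
def pad (n : ℕ) : ℕ := (3 - n % 3) % 3

/-- The element `φ` of `G_{3,1}` simulates the boolean function `f`. -/
structure Simulates {m n : ℕ} (φ : G31) (f : (Fin m → Bool) → (Fin n → Bool)) : Prop where
  mod3 : PreservesLengthMod3 φ
  domCode_subset : ThompsonHigman.domCode φ ⊆ codeWords
  imCode_subset : ThompsonHigman.imCode φ ⊆ codeWords
  value : ∀ x : Fin m → Bool,
    φ.map (bits (false :: List.ofFn x)) =
      some (bits (List.replicate (1 + pad n) false ++ List.ofFn (f x) ++ List.ofFn x))
  maps_bits : ThompsonHigman.MapsInto φ (Set.range bits) (Set.range bits)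
  maps_bits_inv : ThompsonHigman.MapsInto φ⁻¹ (Set.range bits) (Set.range bits)
  maps_hash : ThompsonHigman.MapsInto φ (Set.range bitsHash) (Set.range bitsHash)
  maps_hash_inv : ThompsonHigman.MapsInto φ⁻¹ (Set.range bitsHash) (Set.range bitsHash)
  maps_zero : ThompsonHigman.MapsInto φ
    {u | ∃ z, u = bits (false :: z)} {u | ∃ z, u = bits (false :: z)}
  maps_one_inv : ThompsonHigman.MapsInto φ⁻¹
    {u | ∃ z, u = bits (true :: z)} {u | ∃ z, u = bits (true :: z)}

/-- `φ` strongly simulates `f`: in addition, `φ` is defined on `0 x_1 ... x_k #` for `k < m`. -/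
structure StronglySimulates {m n : ℕ} (φ : G31) (f : (Fin m → Bool) → (Fin n → Bool)) : Prop
    extends Simulates φ f where
  defined_short : ∀ k : ℕ, k < m → ∀ x : Fin k → Bool,
    (φ.map (bitsHash (false :: List.ofFn x))).isSome

/-! ### Words over `Δ^{±1} ∪ {τ_{i,i+1} : 0 ≤ i}` -/

/-- The letters: the generators `δ_k` (`k < d`), their formal inverses, and the `τ_{i,i+1}`. -/
inductive Gen (d : ℕ) : Type
  | pos (k : Fin d) : Gen d
  | neg (k : Fin d) : Gen d
  | tau (i : ℕ) : Gen d

/-- The element of `G_{3,1}` that a letter stands for. -/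
noncomputable def Gen.toGroup {d : ℕ} (δ : Fin d → G31) (ρ : ShortRule) : Gen d → G31
  | .pos k => δ k
  | .neg k => (δ k)⁻¹
  | .tau i => G31.tau ρ i

/-- The element of `G_{3,1}` that a word stands for (its last letter acts first). -/
noncomputable def evalWord {d : ℕ} (δ : Fin d → G31) (ρ : ShortRule) (w : List (Gen d)) : G31 :=
  (w.map (Gen.toGroup δ ρ)).prod

/-- The finite alphabet in which words over `Gen d` are written down. -/
inductive GenSymbol (d : ℕ) : Type
  | pos (k : Fin d) : GenSymbol d
  | neg (k : Fin d) : GenSymbol d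
  | tau : GenSymbol d
  | tick : GenSymbol d

/-- A letter as a string; the index of a transposition is written in unary. -/
def Gen.encode {d : ℕ} : Gen d → List (GenSymbol d)
  | .pos k => [.pos k]
  | .neg k => [.neg k]
  | .tau i => .tau :: List.replicate i .tick

/-- A word as a string over a finite alphabet. -/
def encodeWord {d : ℕ} (w : List (Gen d)) : List (GenSymbol d) := w.flatMap Gen.encode

end G31

/-! ## Acyclic boolean circuits -/

namespace BoolCircuit

/-- The ports from which wires start, in a circuit with `m` input variables and `g` gates: the
input variables and the output ports of the gates. The second output port of a gate
(`second = true`) exists only if the gate is a fork. -/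
inductive Port (m g : ℕ) : Type
  | input (k : Fin m) : Port m g
  | gate (j : Fin g) (second : Bool) : Port m g

/-- A gate, with the ports from which its incoming wires start. -/
inductive Gate (P : Type) : Type
  | and (a b : P) : Gate P
  | or (a b : P) : Gate P
  | not (a : P) : Gate P
  | fork (a : P) : Gate P

/-- The ports that feed a gate, one for each incoming wire. -/
def Gate.sources {P : Type} : Gate P → List P
  | .and a b => [a, b]
  | .or a b => [a, b]
  | .not a => [a]
  | .fork a => [a]

/-- The value that a gate puts on its output port or ports, given the values on its wires. -/
def Gate.eval {P : Type} (v : P → Bool) : Gate P → Bool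
  | .and a b => v a && v b
  | .or a b => v a || v b
  | .not a => !v a
  | .fork a => v a

end BoolCircuit

open BoolCircuit in
/-- An acyclic boolean circuit with `m` input variables and `n` output variables. Any number of
wires may start from a port, so circuits that duplicate values only through fork gates (one wire
from every port) are included; every input variable has at least one wire. -/
structure BoolCircuit (m n : ℕ) where
  /-- the number of gates -/
  gates : ℕ
  gate : Fin gates → Gate (Port m gates)
  /-- the port that feeds an output variable -/
  out : Fin n → Port m gates
  /-- only forks have a second output port -/
  second_port : ∀ j : Fin gates,
    ((∃ i, Port.gate j true ∈ (gate i).sources) ∨ ∃ i, out i = Port.gate j true) →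
      ∃ a, gate j = Gate.fork a
  /-- every input variable is connected -/
  input_connected : ∀ k : Fin m,
    (∃ i, Port.input k ∈ (gate i).sources) ∨ ∃ i, out i = Port.input k
  /-- the circuit graph has no directed cycle -/
  acyclic : ∀ j : Fin gates,
    ¬ Relation.TransGen (fun i j => ∃ b, Port.gate i b ∈ (gate j).sources) j j

namespace BoolCircuit

/-- Some wire goes from gate `i` to gate `j`. -/
def Feeds {m n : ℕ} (C : BoolCircuit m n) (i j : Fin C.gates) : Prop :=
  ∃ b, Port.gate i b ∈ (C.gate j).sources

theorem wf_feeds {m n : ℕ} (C : BoolCircuit m n) : WellFounded C.Feeds := by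
  have : Std.Irrefl (Relation.TransGen C.Feeds) := ⟨C.acyclic⟩
  have h : WellFounded (Relation.TransGen C.Feeds) := Finite.wellFounded_of_trans_of_irrefl _
  exact Subrelation.wf Relation.TransGen.single h

/-- The values at all ports, given the values of the input variables and of the gates. -/
def portValue {m g : ℕ} (x : Fin m → Bool) (v : Fin g → Bool) : Port m g → Bool
  | .input k => x k
  | .gate j _ => v j

open Classical in
/-- The value that gate `j` computes on input `x` (characterized by `gateValue_eq`). -/
noncomputable def gateValue {m n : ℕ} (C : BoolCircuit m n) (x : Fin m → Bool) :
    Fin C.gates → Bool :=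
  C.wf_feeds.fix fun j rec =>
    (C.gate j).eval (portValue x fun i => if h : C.Feeds i j then rec i h else false)

theorem Gate.eval_congr {P : Type} {v v' : P → Bool} (G : Gate P)
    (h : ∀ p ∈ G.sources, v p = v' p) : G.eval v = G.eval v' := by
  cases G <;> simp_all [Gate.sources, Gate.eval]

/-- The gates compute their values from the values at the ports that feed them. -/
theorem gateValue_eq {m n : ℕ} (C : BoolCircuit m n) (x : Fin m → Bool) (j : Fin C.gates) :
    C.gateValue x j = (C.gate j).eval (portValue x (C.gateValue x)) := by
  unfold gateValue
  rw [WellFounded.fix_eq]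
  refine Gate.eval_congr _ fun p hp => ?_
  cases p with
  | input k => rfl
  | gate i b => exact dif_pos ⟨b, hp⟩

/-- The input-output function of the circuit. -/
noncomputable def fn {m n : ℕ} (C : BoolCircuit m n) (x : Fin m → Bool) (i : Fin n) : Bool :=
  portValue x (C.gateValue x) (C.out i)

/-- The size of the circuit: the number of its wires. A not or fork gate counts `1`, an and or
or gate counts `2`, and an output variable counts `1`. -/
def size {m n : ℕ} (C : BoolCircuit m n) : ℕ := (∑ j, (C.gate j).sources.length) + n

/-- The finite alphabet in which circuits are written down. -/
inductive Symbol : Type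
  | input : Symbol
  | and : Symbol
  | or : Symbol
  | not : Symbol
  | fork : Symbol
  | out : Symbol
  | fromInput : Symbol
  | fromGate (second : Bool) : Symbol
  | tick : Symbol

/-- A port as a string; the number of the input variable or gate is written in unary. -/
def Port.encode {m g : ℕ} : Port m g → List Symbol
  | .input k => .fromInput :: List.replicate (k : ℕ) .tick
  | .gate j b => .fromGate b :: List.replicate (j : ℕ) .tick

/-- A gate as a string: its type, followed by the ports that feed it. -/
def Gate.encode {m g : ℕ} : Gate (Port m g) → List Symbol
  | .and a b => .and :: (a.encode ++ b.encode)
  | .or a b => .or :: (a.encode ++ b.encode)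
  | .not a => .not :: a.encode
  | .fork a => .fork :: a.encode

/-- A circuit as a string: the number of input variables in unary, the list of the gates, and
the list of the ports that feed the output variables. -/
def encode {m n : ℕ} (C : BoolCircuit m n) : List Symbol :=
  List.replicate m .input ++ (List.ofFn fun j => (C.gate j).encode).flatten ++
    (List.ofFn fun i => .out :: (C.out i).encode).flatten

end BoolCircuit

/-- All acyclic boolean circuits. -/
abbrev AnyBoolCircuit : Type := Σ m n : ℕ, BoolCircuit m n

namespace AnyBoolCircuit

def size (C : AnyBoolCircuit) : ℕ := C.2.2.size

def encode (C : AnyBoolCircuit) : List BoolCircuit.Symbol := C.2.2.encode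

end AnyBoolCircuit

/-- The map `w` from circuits to words is computable by a (deterministic, multi-stack) Turing
machine whose running time on every circuit `C` is bounded by a polynomial in `|C|`. -/
def PolyTimeInSize {d : ℕ} (w : AnyBoolCircuit → List (G31.Gen d)) : Prop :=
  ∃ (M : Turing.TM2ComputableAux BoolCircuit.Symbol (G31.GenSymbol d)) (p : Polynomial ℕ),
    ∀ C : AnyBoolCircuit, Nonempty (Turing.TM2OutputsInTime M.tm
      (C.encode.map M.inputAlphabet.symm)
      (some ((G31.encodeWord (w C)).map M.outputAlphabet.symm)) (p.eval C.size))

/-! ## Permutations of bit strings that act on the tails trivially -/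

namespace G31

open ThompsonHigman

/-! A permutation π of {0,1}^* such that π and its inverse change only a bounded prefix of every
long string gives an element of G_{3,1}: π acts on the maximal bit prefix of a word, and sends z# to
π(z)# even for short z (`ofTail`). Strong simulation then reduces to three properties of π: lengths
are kept modulo 3, the strings 0xy with |x| = m have the prescribed images, and the empty string
goes to 111 (`stronglySimulates_ofTail`). The transpositions are of this type (`tau_eq_ofTail`), so
it remains to write a suitable π as a product of transpositions and of finitely many fixed
permutations, the elements of `Prim`. Each of the latter costs a bounded number of generators.

A string 0abT is treated as a reversible machine with two one-bit slots a, b and a tape T.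
Transpositions bring a remote letter to the front of T, a gate acts on it and on the slots, and the
transpositions bring it back (`run_access`). The gates of the circuit need not be sorted: all of
them are evaluated simultaneously, in as many rounds as there are gates, and acyclicity makes the
last round correct (`layerValue_gates`). Every round adds its values to a fresh layer of zeros in
front of the older layers. The outputs are added to n + i(n) zeros in front of the input variables,
and then the same passes, in reverse order, erase the layers (`run_circuitProg`). There are at most
|C| rounds of at most |C| gates, and the positions are O(|C|^2); this gives the bounds |C|^4 and
|C|^2.

The difficulty is with inputs that are too short, on which the transpositions act by unknown
permutations. These keep the first letter and the parity of the rest. For every k < m a test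
compares two parities, between which a letter 1 is sent behind the summed part of the tape. If there
are more than k input letters, the 1 is outside the sum and the parities agree; if there are exactly
k, the sum covers the whole tape, hence includes the 1, wherever it is (`run_test_long`,
`run_test_short`). The discrepancy turns the word into a flagged word 100...0t. Gates ignore such
words, and transpositions only exchange zeros of the padding (`run_flagged`). The rest of the
program changes the amount of padding by a number that depends on n only, so the value on a short
word does not depend on the circuit (`run_prog_short`).

Injectivity is obtained by a factor equal to the unit element that spells out the circuit by pairs
of mutually inverse generators (`emitCode_injective`). Polynomial time is shown with a small
structured language for stack machines: each program has a cost polynomial in a common bound for its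
loops, and the output is written from its last letter to its first (`putWord_runs`). -/

theorem inv_apply_self (π : Equiv.Perm (List Bool)) (z : List Bool) : π⁻¹ (π z) = z :=
  π.symm_apply_apply z

theorem apply_inv_self (π : Equiv.Perm (List Bool)) (z : List Bool) : π (π⁻¹ z) = z :=
  π.apply_symm_apply z

/-- `π` acts on all sufficiently long bit strings by changing a prefix of bounded length. -/
def IsTail (π : Equiv.Perm (List Bool)) : Prop :=
  ∃ N : ℕ, ∀ z : List Bool, N ≤ z.length → ∀ y, π (z ++ y) = π z ++ y

theorem IsTail.mul {π σ : Equiv.Perm (List Bool)} (hπ : IsTail π) (hσ : IsTail σ) :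
    IsTail (π * σ) := by
  obtain ⟨N, hN⟩ := hπ
  obtain ⟨K, hK⟩ := hσ
  refine ⟨N + K, fun z hz y => ?_⟩
  have h1 : σ z = σ (z.take K) ++ z.drop K := by
    rw [← hK _ (by simp; omega), List.take_append_drop]
  -- σ replaces only the first K letters, so at least N letters of z survive in σ z.
  have h2 : N ≤ (σ z).length := by
    rw [h1]; simp; omega
  rw [Equiv.Perm.mul_apply, Equiv.Perm.mul_apply, hK _ (by omega), hN _ h2]

/-- The group of the permutations `π` of bit strings such that `π` and its inverse act on all
sufficiently long bit strings by changing a prefix of bounded length. -/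
def tailPerm : Subgroup (Equiv.Perm (List Bool)) where
  carrier := {π | IsTail π ∧ IsTail π⁻¹}
  mul_mem' := fun {a b} ha hb => ⟨ha.1.mul hb.1, by rw [mul_inv_rev]; exact hb.2.mul ha.2⟩
  one_mem' := ⟨⟨0, fun _ _ _ => rfl⟩, ⟨0, fun _ _ _ => rfl⟩⟩
  inv_mem' := fun {a} ha => ⟨ha.2, by rw [inv_inv]; exact ha.1⟩

/-- The bit strings on whose extensions `π` acts by a change of the prefix. -/
def Stable (π : Equiv.Perm (List Bool)) (z : List Bool) : Prop :=
  ∀ y, π (z ++ y) = π z ++ y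

theorem Stable.append {π : Equiv.Perm (List Bool)} {z : List Bool} (h : Stable π z)
    (t : List Bool) : Stable π (z ++ t) := fun y => by
  rw [List.append_assoc, h, h, List.append_assoc]

theorem Stable.inv {π : Equiv.Perm (List Bool)} {z : List Bool} (h : Stable π z) :
    Stable π⁻¹ (π z) := fun y => by
  rw [← h, inv_apply_self, inv_apply_self]

/-- Stability of z says that π maps the cone of z onto the cone of π z by a change of prefix, which
is symmetric in π and its inverse. -/
theorem stable_inv_iff {π : Equiv.Perm (List Bool)} {z : List Bool} :
    Stable π⁻¹ (π z) ↔ Stable π z :=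
  ⟨fun h => by simpa using h.inv, Stable.inv⟩

/-! ### From permutations of bit strings to elements of the group -/

theorem bits_injective : Function.Injective bits :=
  List.map_injective_iff.2 (Option.some_injective _)

theorem bits_append (u v : List Bool) : bits (u ++ v) = bits u ++ bits v := List.map_append

theorem bitPrefix_bits (z : List Bool) : bitPrefix (bits z) = z := by
  simpa [bitPrefix] using bitPrefix_bits_append z []

theorem bitRest_bits (z : List Bool) : bitRest (bits z) = [] := by
  simpa [bitRest] using bitRest_bits_append z []

theorem bits_of_bitRest_eq_nil {u : List Letter3} (h : bitRest u = []) :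
    u = bits (bitPrefix u) := by
  conv_lhs => rw [← bits_append_bitRest u, h, List.append_nil]

open Classical in
/-- The action on words over `{0, 1, #}`. -/
noncomputable def tailFun (π : Equiv.Perm (List Bool)) (u : List Letter3) :
    Option (List Letter3) :=
  if Stable π (bitPrefix u) ∨ bitRest u ≠ [] then
    some (bits (π (bitPrefix u)) ++ bitRest u) else none

theorem tailFun_inv {π : Equiv.Perm (List Bool)} {u v : List Letter3}
    (h : tailFun π u = some v) : tailFun π⁻¹ v = some u := by
  unfold tailFun at h
  split_ifs at h with h1
  rw [Option.some.injEq] at h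
  have hp : bitPrefix v = π (bitPrefix u) := by
    rw [← h, bitPrefix_bits_append, bitPrefix_bitRest, List.append_nil]
  have hr : bitRest v = bitRest u := by
    rw [← h, bitRest_bits_append, bitRest_bitRest]
  unfold tailFun
  rw [hp, hr, stable_inv_iff, if_pos h1, inv_apply_self, bits_append_bitRest]

/-- The partial injective map on words over `{0, 1, #}` given by a permutation of bit strings. -/
noncomputable def tailMap (π : Equiv.Perm (List Bool)) : List Letter3 ≃. List Letter3 where
  toFun := tailFun π
  invFun := tailFun π⁻¹
  inv u v := ⟨fun h => by simpa using tailFun_inv h, fun h => tailFun_inv h⟩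

theorem tailMap_symm (π : Equiv.Perm (List Bool)) : (tailMap π).symm = tailMap π⁻¹ := by
  refine PEquiv.ext fun u => ?_
  rfl

theorem tailMap_bits {π : Equiv.Perm (List Bool)} {z : List Bool} (h : Stable π z) :
    tailMap π (bits z) = some (bits (π z)) := by
  change tailFun π _ = _
  unfold tailFun
  rw [bitPrefix_bits, bitRest_bits, if_pos (Or.inl h), List.append_nil]

theorem tailMap_hash (π : Equiv.Perm (List Bool)) (z : List Bool) (t : List Letter3) :
    tailMap π (bits z ++ none :: t) = some (bits (π z) ++ none :: t) := by
  change tailFun π _ = _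
  unfold tailFun
  rw [bitPrefix_bits_append, bitRest_bits_append]
  simp [bitPrefix, bitRest]

theorem mem_tailMap {π : Equiv.Perm (List Bool)} {u v : List Letter3} :
    v ∈ tailMap π u ↔ (∃ z, Stable π z ∧ u = bits z ∧ v = bits (π z)) ∨
      ∃ z t, u = bits z ++ none :: t ∧ v = bits (π z) ++ none :: t := by
  constructor
  · intro h
    rcases bitRest_cases u with h2 | ⟨t, h2⟩
    · left
      have hu := bits_of_bitRest_eq_nil h2
      change tailFun π u = some v at h
      unfold tailFun at h
      rw [h2] at h
      split_ifs at h with h1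
      refine ⟨_, by simpa using h1, hu, ?_⟩
      rw [Option.some.injEq, List.append_nil] at h
      exact h.symm
    · right
      have hu : u = bits (bitPrefix u) ++ none :: t := by
        rw [← h2, bits_append_bitRest]
      refine ⟨bitPrefix u, t, hu, ?_⟩
      rw [hu, tailMap_hash] at h
      exact (Option.some.inj h).symm
  · rintro (⟨z, hz, rfl, rfl⟩ | ⟨z, t, rfl, rfl⟩)
    · exact tailMap_bits hz
    · exact tailMap_hash _ _ _

/-- Only an extension of a pure bit string can enlarge the bit prefix, and there stability is
required; behind the first # nothing is ever changed. -/
theorem tailMap_iso (π : Equiv.Perm (List Bool)) : IsRightIdealIso (tailMap π) := by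
  intro u v x h
  rw [mem_tailMap] at h
  obtain ⟨z, hz, rfl, rfl⟩ | ⟨z, t, rfl, rfl⟩ := h
  · have hx := bits_append_bitRest x
    rw [← hx, ← List.append_assoc, ← List.append_assoc, ← bits_append, ← bits_append, ← hz]
    rcases bitRest_cases x with h2 | ⟨t, h2⟩
    · rw [h2, List.append_nil, List.append_nil]
      exact tailMap_bits (hz.append _)
    · rw [h2]
      exact tailMap_hash _ _ _
  · simp only [List.append_assoc, List.cons_append]
    exact tailMap_hash _ _ _

theorem mem_dom_tailMap {π : Equiv.Perm (List Bool)} (h : IsTail π) :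
    ∃ n : ℕ, ∀ w : List Letter3, n ≤ w.length → w ∈ dom (tailMap π) := by
  obtain ⟨N, hN⟩ := h
  refine ⟨N, fun w hw => ?_⟩
  rcases bitRest_cases w with h2 | ⟨t, h2⟩
  · have hu := bits_of_bitRest_eq_nil h2
    refine ⟨_, mem_tailMap.2 (Or.inl ⟨bitPrefix w, hN _ ?_, hu, rfl⟩)⟩
    rw [hu] at hw
    simpa [bits] using hw
  · exact ⟨_, mem_tailMap.2 (Or.inr ⟨bitPrefix w, t, by rw [← h2, bits_append_bitRest], rfl⟩)⟩

theorem tailMap_isFinEssIso {π : Equiv.Perm (List Bool)} (h : π ∈ tailPerm) :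
    IsFinEssIso (tailMap π) := by
  obtain ⟨a, ha⟩ := mem_dom_tailMap h.1
  obtain ⟨b, hb⟩ := mem_dom_tailMap h.2
  refine (isFinEssIso_iff (tailMap_iso π)).2 ⟨max a b, fun w hw =>
    ⟨ha w (le_trans (le_max_left _ _) hw), ?_⟩⟩
  rw [tailMap_symm]
  exact hb w (le_trans (le_max_right _ _) hw)

/-- The embedding of `tailPerm` into `G_{3,1}`. -/
noncomputable def ofTail : tailPerm →* G31 where
  toFun π := ofIso (tailMap π.1) (tailMap_isFinEssIso π.2)
  map_one' := by
    symm
    refine ofIso_eq_of_le _ _ fun u v h => ?_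
    have h1 : v = u := (Option.some.inj h).symm
    subst h1
    rw [mem_tailMap]
    rcases bitRest_cases v with h2 | ⟨t, h2⟩
    · exact Or.inl ⟨bitPrefix v, fun _ => rfl, bits_of_bitRest_eq_nil h2,
        bits_of_bitRest_eq_nil h2⟩
    · have : v = bits (bitPrefix v) ++ none :: t := by rw [← h2, bits_append_bitRest]
      exact Or.inr ⟨bitPrefix v, t, this, this⟩
  map_mul' π σ := by
    rw [ofIso_mul_ofIso]
    symm
    refine ofIso_eq_of_le _ _ fun u v h => ?_
    rw [PEquiv.mem_trans] at h
    obtain ⟨b, hb, hv⟩ := h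
    rw [mem_tailMap] at hb
    obtain ⟨z, hz, rfl, rfl⟩ | ⟨z, t, rfl, rfl⟩ := hb
    · rw [mem_tailMap] at hv
      obtain ⟨z', hz', h1, rfl⟩ | ⟨z', t, h1, rfl⟩ := hv
      · have h2 := bits_injective h1
        subst h2
        refine tailMap_bits (π := π.1 * σ.1) fun y => ?_
        rw [Equiv.Perm.mul_apply, Equiv.Perm.mul_apply, hz, hz']
      · have := congrArg bitRest h1
        rw [bitRest_bits, bitRest_bits_append] at this
        simp [bitRest] at this
    · rw [tailMap_hash] at hv
      rw [← Option.some.inj hv]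
      exact tailMap_hash (π.1 * σ.1) _ _

theorem map_hash (π : tailPerm) (z : List Bool) :
    (ofTail π).map (bitsHash z) = some (bitsHash (π.1 z)) :=
  le_maxExt (tailMap_iso π.1) _ _ (tailMap_hash _ _ _)

/-- Passing to the maximum extension adds no bit string to the domain. Every word zy# already has a
forced value, so a value at z determines π on the whole cone of z and makes z stable. -/
theorem mem_map_bits {π : tailPerm} {z : List Bool} {v : List Letter3} :
    v ∈ (ofTail π).map (bits z) ↔ Stable π.1 z ∧ v = bits (π.1 z) := by
  constructor
  · intro h
    have h1 : MaxRel (tailMap π.1) (bits z) v := (mem_maxExt (tailMap_iso π.1)).1 h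
    have h2 : ∀ y, v ++ bits y = bits (π.1 (z ++ y)) := by
      intro y
      -- With # appended, the word lies in the domain of `tailMap` whether or not its bit prefix is
      -- stable, and the two values can be compared.
      obtain ⟨w, hw⟩ := h1 (bits y ++ [none])
      simp only [List.append_assoc] at hw
      have h3 := tailMap_hash π.1 (z ++ y) w
      simp only [bits_append, List.append_assoc] at h3
      have h4 : some _ = some _ := h3.symm.trans hw
      have h5 := Option.some.inj h4
      rw [← List.append_assoc v] at h5
      exact (List.append_cancel_right h5).symm
    have h3 : v = bits (π.1 z) := by simpa [bits] using h2 []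
    refine ⟨fun y => bits_injective ?_, h3⟩
    rw [← h2, h3, bits_append]
  · rintro ⟨h, rfl⟩
    exact le_maxExt (tailMap_iso π.1) _ _ (tailMap_bits h)

theorem ofTail_map_symm (π : tailPerm) : (ofTail π)⁻¹ = ofTail π⁻¹ := (map_inv ofTail π).symm

/-- All words z# are in the domain, so minimality cuts a word of the domain code off at its first #.
The only other danger is the empty word, which is excluded by instability. -/
theorem domCode_ofTail_subset {π : tailPerm} (h : ¬ Stable π.1 []) :
    domCode (ofTail π) ⊆ codeWords := by
  rintro u ⟨hu, hmin⟩
  rcases bitRest_cases u with h2 | ⟨t, h2⟩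
  · have h3 := bits_of_bitRest_eq_nil h2
    refine Or.inl ⟨bitPrefix u, fun h4 => h ?_, h3⟩
    obtain ⟨v, hv⟩ := hu
    rw [h3, h4] at hv
    exact (mem_map_bits.1 hv).1
  · have hu' : u = bits (bitPrefix u) ++ none :: t := by rw [← h2, bits_append_bitRest]
    refine Or.inr ⟨bitPrefix u, (hmin _ ⟨t, ?_⟩ ⟨_, map_hash π _⟩).symm⟩
    rw [hu']
    simp [bitsHash, bitPrefix_bits_append, bitPrefix]

theorem mapsInto_bits (π : tailPerm) :
    MapsInto (ofTail π) (Set.range bits) (Set.range bits) := by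
  rintro _ ⟨z, rfl⟩ v hv
  exact ⟨_, (mem_map_bits.1 hv).2.symm⟩

theorem mapsInto_hash (π : tailPerm) :
    MapsInto (ofTail π) (Set.range bitsHash) (Set.range bitsHash) := by
  rintro _ ⟨z, rfl⟩ v hv
  rw [map_hash] at hv
  exact ⟨_, Option.some.inj hv⟩

/-! ### Reduction of strong simulation to the action on bit strings -/

/-- A sufficient condition for strong simulation in terms of the action on bit strings. -/
theorem stronglySimulates_ofTail {m n : ℕ} (π : tailPerm) (f : (Fin m → Bool) → (Fin n → Bool))
    (hmod : ∀ z, (π.1 z).length ≡ z.length [MOD 3])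
    (hval : ∀ (x : Fin m → Bool) (y : List Bool), π.1 (false :: (List.ofFn x ++ y)) =
      List.replicate (1 + pad n) false ++ List.ofFn (f x) ++ List.ofFn x ++ y)
    (hnil : π.1 [] = [true, true, true]) :
    StronglySimulates (ofTail π) f := by
  have hzero : ∀ t : List Bool, m ≤ t.length → ∃ s, π.1 (false :: t) = false :: s := by
    intro t ht
    have h1 : t = List.ofFn (fun i : Fin m => t.get ⟨i, by omega⟩) ++ t.drop m := by
      conv_lhs => rw [← List.take_append_drop m t]
      congr 1
      refine List.ext_getElem (by simp [ht]) fun k h1 h2 => ?_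
      simp
    rw [h1, hval, add_comm, List.replicate_succ]
    exact ⟨_, rfl⟩
  -- Otherwise every image would start with 111, but a long string that starts with 0 has an image
  -- that starts with 0.
  have hst : ¬ Stable π.1 [] := fun h => by
    have h1 := h (false :: List.replicate m false)
    obtain ⟨s, hs⟩ := hzero (List.replicate m false) (by simp)
    rw [List.nil_append, hs, hnil] at h1
    simp at h1
  -- Otherwise the preimage of 111 would end with 111, but it is empty.
  have hst' : ¬ Stable (π⁻¹).1 [] := fun h => by
    have h1 := h [true, true, true]
    have h2 : (π⁻¹).1 [true, true, true] = [] := by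
      change (π.1)⁻¹ _ = _
      rw [← hnil, inv_apply_self]
    rw [List.nil_append, h2] at h1
    simp at h1
  have hsim : Simulates (ofTail π) f :=
    { mod3 := by
        intro x y hy
        rw [(mem_map_bits.1 hy).2]
        simpa [bits] using hmod x
      domCode_subset := domCode_ofTail_subset hst
      imCode_subset := by
        rw [imCode, ofTail_map_symm]
        exact domCode_ofTail_subset hst'
      value := by
        intro x
        have h0 := hval x []
        simp only [List.append_nil] at h0
        refine mem_map_bits.2 ⟨fun y => ?_, by rw [h0]⟩
        rw [List.cons_append, hval, h0]
      maps_bits := mapsInto_bits π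
      maps_bits_inv := by rw [ofTail_map_symm]; exact mapsInto_bits _
      maps_hash := mapsInto_hash π
      maps_hash_inv := by rw [ofTail_map_symm]; exact mapsInto_hash _
      maps_zero := by
        rintro _ ⟨z, rfl⟩ v hv
        obtain ⟨h1, rfl⟩ := mem_map_bits.1 hv
        -- The extension is long enough for `hzero`, and as it starts with 1 it also excludes that
        -- the image of 0z is empty.
        have h2 := h1 (true :: List.replicate m true)
        obtain ⟨s, hs⟩ := hzero (z ++ true :: List.replicate m true) (by simp; omega)
        rw [List.cons_append, hs] at h2
        rcases h : π.1 (false :: z) with _ | ⟨b, t⟩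
        · rw [h] at h2; simp at h2
        · rw [h] at h2
          simp only [List.cons_append, List.cons.injEq] at h2
          exact ⟨t, by rw [h2.1]⟩
      maps_one_inv := by
        rw [ofTail_map_symm]
        rintro _ ⟨z, rfl⟩ v hv
        obtain ⟨h1, rfl⟩ := mem_map_bits.1 hv
        have h2 : ∀ y, π.1 ((π⁻¹).1 (true :: z) ++ y) = true :: z ++ y := by
          intro y
          rw [← h1]
          exact apply_inv_self π.1 _
        -- If the preimage were empty or began with 0, some long extension of it would begin with 0,
        -- and its image would begin with 0 and with 1.
        rcases h : (π⁻¹).1 (true :: z) with _ | ⟨b, t⟩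
        · have h3 := h2 (false :: List.replicate m false)
          obtain ⟨s, hs⟩ := hzero (List.replicate m false) (by simp)
          rw [h, List.nil_append, hs] at h3
          simp at h3
        · cases b
          · have h3 := h2 (List.replicate m false)
            obtain ⟨s, hs⟩ := hzero (t ++ List.replicate m false) (by simp)
            rw [h, List.cons_append, hs] at h3
            simp at h3
          · exact ⟨t, rfl⟩ }
  exact { hsim with defined_short := fun k _ x => by rw [map_hash]; rfl }

/-! ### The transpositions -/

/-- The permutation of bit strings by which `τ_{i,i+1}` acts. -/
def tauPermList (ρ : ShortRule) (i : ℕ) : Equiv.Perm (List Bool) where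
  toFun := permute (tauPerm ρ i)
  invFun := permute fun ℓ => (tauPerm ρ i ℓ)⁻¹
  left_inv := permute_inv_permute _
  right_inv z := by simpa using permute_inv_permute (fun ℓ => (tauPerm ρ i ℓ)⁻¹) z

theorem tauPermList_apply (ρ : ShortRule) (i : ℕ) (z : List Bool) :
    tauPermList ρ i z = permute (tauPerm ρ i) z := rfl

theorem length_tauPermList (ρ : ShortRule) (i : ℕ) (z : List Bool) :
    (tauPermList ρ i z).length = z.length := length_permute _ _

theorem length_tauPermList_inv (ρ : ShortRule) (i : ℕ) (z : List Bool) :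
    ((tauPermList ρ i)⁻¹ z).length = z.length :=
  length_permute (fun ℓ => (tauPerm ρ i ℓ)⁻¹) z

theorem stable_tauPermList (ρ : ShortRule) (i : ℕ) {z : List Bool} (h : i + 1 < z.length) :
    Stable (tauPermList ρ i) z := fun y => permute_swap_append ρ i z y h

theorem tauPermList_mem (ρ : ShortRule) (i : ℕ) : tauPermList ρ i ∈ tailPerm := by
  refine ⟨⟨i + 2, fun z hz => stable_tauPermList ρ i hz⟩, ⟨i + 2, fun z hz => ?_⟩⟩
  have h := stable_tauPermList ρ i (z := (tauPermList ρ i)⁻¹ z)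
    (by rw [length_tauPermList_inv]; omega)
  have h2 := Stable.inv h
  rw [apply_inv_self] at h2
  exact h2

/-- The map that defines the transposition is a restriction of `tailMap`, and isomorphisms of
essential ideals one of which extends the other have the same maximum extension. -/
theorem tau_eq_ofTail (ρ : ShortRule) (i : ℕ) :
    tau ρ i = ofTail ⟨tauPermList ρ i, tauPermList_mem ρ i⟩ := by
  refine ofIso_eq_of_le (tauMap_isFinEssIso ρ i) (tailMap_isFinEssIso (tauPermList_mem ρ i))
    fun u v h => ?_
  change rearrange _ i u = some v at h
  unfold rearrange at h
  split_ifs at h with h1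
  rw [Option.some.injEq] at h
  rw [mem_tailMap]
  rcases bitRest_cases u with h2 | ⟨t, h2⟩
  · refine Or.inl ⟨bitPrefix u, stable_tauPermList ρ i ?_, bits_of_bitRest_eq_nil h2, ?_⟩
    · simpa [h2] using h1
    · rw [← h, h2, List.append_nil]; rfl
  · refine Or.inr ⟨bitPrefix u, t, by rw [← h2, bits_append_bitRest], ?_⟩
    rw [← h, h2]; rfl

end G31

/-! ## The instructions from which the words are composed -/

namespace G31

theorem mem_tailPerm_of_stable {π : Equiv.Perm (List Bool)} (N : ℕ)
    (h : ∀ z : List Bool, N ≤ z.length → Stable π z)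
    (h' : ∀ z : List Bool, N ≤ z.length → Stable π⁻¹ z) : π ∈ tailPerm :=
  ⟨⟨N, h⟩, ⟨N, h'⟩⟩

/-- Inserts `000` after the first letter of `0s`, and keeps `10s`. -/
def insZeroFun : List Bool → List Bool
  | [] => []
  | [true] => [true]
  | false :: s => false :: false :: false :: false :: s
  | true :: false :: s => true :: false :: s
  | [true, true] => [false, false]
  | true :: true :: false :: s => false :: false :: true :: s
  | [true, true, true] => [false, false, false]
  | true :: true :: true :: false :: s => false :: false :: false :: true :: s
  | [true, true, true, true] => [false]
  | true :: true :: true :: true :: false :: s => false :: true :: s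
  | true :: true :: true :: true :: true :: s => true :: true :: s

def insZeroInv : List Bool → List Bool
  | [] => []
  | [true] => [true]
  | true :: false :: s => true :: false :: s
  | true :: true :: s => true :: true :: true :: true :: true :: s
  | [false] => [true, true, true, true]
  | false :: true :: s => true :: true :: true :: true :: false :: s
  | [false, false] => [true, true]
  | false :: false :: true :: s => true :: true :: false :: s
  | [false, false, false] => [true, true, true]
  | false :: false :: false :: true :: s => true :: true :: true :: false :: s
  | false :: false :: false :: false :: s => false :: s

/-- The insertion frees the cones 01, 001 and 0001. They are filled from 11110, 110 and 1110, and
11111 takes the place of 11. The finitely many strings between these cones are matched so that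
lengths agree modulo 3. -/
def insZero : Equiv.Perm (List Bool) where
  toFun := insZeroFun
  invFun := insZeroInv
  left_inv z := by unfold insZeroFun; split <;> rfl
  right_inv z := by unfold insZeroInv; split <;> rfl

/-- Inserts `000` after the prefix of `10s`, and keeps `0s`. -/
def insOneFun : List Bool → List Bool
  | [] => []
  | [true] => [true]
  | false :: s => false :: s
  | true :: false :: s => true :: false :: false :: false :: false :: s
  | [true, true] => [true, false]
  | true :: true :: false :: s => true :: false :: true :: s
  | [true, true, true] => [true, false, false]
  | true :: true :: true :: false :: s => true :: false :: false :: true :: s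
  | [true, true, true, true] => [true, false, false, false]
  | true :: true :: true :: true :: false :: s => true :: false :: false :: false :: true :: s
  | true :: true :: true :: true :: true :: s => true :: true :: s

def insOneInv : List Bool → List Bool
  | [] => []
  | [true] => [true]
  | false :: s => false :: s
  | true :: true :: s => true :: true :: true :: true :: true :: s
  | [true, false] => [true, true]
  | true :: false :: true :: s => true :: true :: false :: s
  | [true, false, false] => [true, true, true]
  | true :: false :: false :: true :: s => true :: true :: true :: false :: s
  | [true, false, false, false] => [true, true, true, true]
  | true :: false :: false :: false :: true :: s => true :: true :: true :: true :: false :: s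
  | true :: false :: false :: false :: false :: s => true :: false :: s

def insOne : Equiv.Perm (List Bool) where
  toFun := insOneFun
  invFun := insOneInv
  left_inv z := by unfold insOneFun; split <;> rfl
  right_inv z := by unfold insOneInv; split <;> rfl

theorem exists_cons_of_length {n : ℕ} {z : List Bool} (h : n + 1 ≤ z.length) :
    ∃ b s, z = b :: s ∧ n ≤ s.length := by
  rcases z with _ | ⟨b, s⟩
  · simp at h
  · exact ⟨b, s, rfl, by simpa using h⟩

theorem insZero_mem : insZero ∈ tailPerm := by
  refine mem_tailPerm_of_stable 5 ?_ ?_ <;>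
  · intro z hz y
    -- Five letters decide the branch, both for the map and for its inverse.
    obtain ⟨a, z, rfl, h1⟩ := exists_cons_of_length hz
    obtain ⟨b, z, rfl, h2⟩ := exists_cons_of_length h1
    obtain ⟨c, z, rfl, h3⟩ := exists_cons_of_length h2
    obtain ⟨d, z, rfl, h4⟩ := exists_cons_of_length h3
    obtain ⟨e, z, rfl, h5⟩ := exists_cons_of_length h4
    cases a <;> cases b <;> cases c <;> cases d <;> cases e <;> rfl

theorem insOne_mem : insOne ∈ tailPerm := by
  refine mem_tailPerm_of_stable 5 ?_ ?_ <;>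
  · intro z hz y
    obtain ⟨a, z, rfl, h1⟩ := exists_cons_of_length hz
    obtain ⟨b, z, rfl, h2⟩ := exists_cons_of_length h1
    obtain ⟨c, z, rfl, h3⟩ := exists_cons_of_length h2
    obtain ⟨d, z, rfl, h4⟩ := exists_cons_of_length h3
    obtain ⟨e, z, rfl, h5⟩ := exists_cons_of_length h4
    cases a <;> cases b <;> cases c <;> cases d <;> cases e <;> rfl

/-- `π` changes lengths by multiples of `3`. -/
def KeepsMod3 (π : Equiv.Perm (List Bool)) : Prop :=
  ∀ z, (π z).length ≡ z.length [MOD 3]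

theorem KeepsMod3.mul {π σ : Equiv.Perm (List Bool)} (hπ : KeepsMod3 π) (hσ : KeepsMod3 σ) :
    KeepsMod3 (π * σ) := fun z => (hπ (σ z)).trans (hσ z)

theorem KeepsMod3.inv {π : Equiv.Perm (List Bool)} (hπ : KeepsMod3 π) : KeepsMod3 π⁻¹ :=
  fun z => by
    have h := hπ (π⁻¹ z)
    rw [apply_inv_self] at h
    exact h.symm

theorem keepsMod3_insZero : KeepsMod3 insZero := by
  intro z
  change (insZeroFun z).length ≡ _ [MOD 3]
  unfold insZeroFun
  split <;> simp only [List.length_cons, List.length_nil, Nat.ModEq] <;> omega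

theorem keepsMod3_insOne : KeepsMod3 insOne := by
  intro z
  change (insOneFun z).length ≡ _ [MOD 3]
  unfold insOneFun
  split <;> simp only [List.length_cons, List.length_nil, Nat.ModEq] <;> omega

/-- Applies a permutation to the letters `1`, `2`, `3` of the words that start with `0`. -/
def slotFun (e : Equiv.Perm (Bool × Bool × Bool)) : List Bool → List Bool
  | false :: a :: b :: d :: s =>
    false :: (e (a, b, d)).1 :: (e (a, b, d)).2.1 :: (e (a, b, d)).2.2 :: s
  | z => z

theorem slotFun_inv {e e' : Equiv.Perm (Bool × Bool × Bool)} (h : ∀ x, e' (e x) = x)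
    (z : List Bool) : slotFun e' (slotFun e z) = z := by
  rcases z with _ | ⟨_ | _, _ | ⟨a, _ | ⟨b, _ | ⟨d, s⟩⟩⟩⟩ <;> simp [slotFun, h]

def slotPerm (e : Equiv.Perm (Bool × Bool × Bool)) : Equiv.Perm (List Bool) where
  toFun := slotFun e
  invFun := slotFun e⁻¹
  left_inv := slotFun_inv fun x => e.symm_apply_apply x
  right_inv := slotFun_inv fun x => e.apply_symm_apply x

theorem slotFun_append (e : Equiv.Perm (Bool × Bool × Bool)) {z : List Bool} (h : 4 ≤ z.length)
    (y : List Bool) : slotFun e (z ++ y) = slotFun e z ++ y := by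
  obtain ⟨a, z, rfl, h1⟩ := exists_cons_of_length h
  obtain ⟨b, z, rfl, h2⟩ := exists_cons_of_length h1
  obtain ⟨c, z, rfl, h3⟩ := exists_cons_of_length h2
  obtain ⟨d, z, rfl, h4⟩ := exists_cons_of_length h3
  cases a <;> rfl

theorem slotPerm_mem (e : Equiv.Perm (Bool × Bool × Bool)) : slotPerm e ∈ tailPerm :=
  mem_tailPerm_of_stable 4 (fun _ hz y => slotFun_append e hz y)
    fun _ hz y => slotFun_append e⁻¹ hz y

theorem length_slotFun (e : Equiv.Perm (Bool × Bool × Bool)) (z : List Bool) :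
    (slotFun e z).length = z.length := by
  unfold slotFun
  split <;> rfl

theorem keepsMod3_slotPerm (e : Equiv.Perm (Bool × Bool × Bool)) : KeepsMod3 (slotPerm e) :=
  fun z => by
    change (slotFun e z).length ≡ _ [MOD 3]
    rw [length_slotFun]

/-- Exchanges the prefixes `010` and `101`. -/
def flagFun : List Bool → List Bool
  | false :: true :: false :: s => true :: false :: true :: s
  | true :: false :: true :: s => false :: true :: false :: s
  | z => z

theorem flagFun_involutive : Function.Involutive flagFun := by
  intro z
  rcases z with _ | ⟨_ | _, _ | ⟨_ | _, _ | ⟨_ | _, s⟩⟩⟩ <;> rfl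

def flagPerm : Equiv.Perm (List Bool) := flagFun_involutive.toPerm

theorem flagFun_append {z : List Bool} (h : 3 ≤ z.length) (y : List Bool) :
    flagFun (z ++ y) = flagFun z ++ y := by
  obtain ⟨a, z, rfl, h1⟩ := exists_cons_of_length h
  obtain ⟨b, z, rfl, h2⟩ := exists_cons_of_length h1
  obtain ⟨c, z, rfl, h3⟩ := exists_cons_of_length h2
  cases a <;> cases b <;> cases c <;> rfl

theorem flagPerm_mem : flagPerm ∈ tailPerm :=
  mem_tailPerm_of_stable 3 (fun _ hz y => flagFun_append hz y)
    fun _ hz y => flagFun_append hz y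

theorem keepsMod3_flagPerm : KeepsMod3 flagPerm := by
  intro z
  change (flagFun z).length ≡ _ [MOD 3]
  unfold flagFun
  split <;> rfl

/-- Exchanges the words of length `0` and `3` that end with `1`s only. -/
def twistPerm : Equiv.Perm (List Bool) := Equiv.swap [] [true, true, true]

theorem twistPerm_of_cons (b : Bool) (s : List Bool) (h : b :: s ≠ [true, true, true]) :
    twistPerm (b :: s) = b :: s :=
  Equiv.swap_apply_of_ne_of_ne (by simp) h

theorem twistPerm_mem : twistPerm ∈ tailPerm := by
  have h : ∀ z : List Bool, 4 ≤ z.length → Stable twistPerm z := by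
    intro z hz y
    have h1 : ∀ t : List Bool, 4 ≤ t.length → twistPerm t = t := fun t ht =>
      Equiv.swap_apply_of_ne_of_ne (by rintro rfl; simp at ht) (by rintro rfl; simp at ht)
    rw [h1 _ hz, h1 _ (by simp; omega)]
  refine mem_tailPerm_of_stable 4 h ?_
  rw [show twistPerm⁻¹ = twistPerm from Equiv.swap_inv _ _]
  exact h

theorem keepsMod3_twistPerm : KeepsMod3 twistPerm := by
  intro z
  unfold twistPerm
  rw [Equiv.swap_apply_def]
  split_ifs with h1 h2
  · subst h1; rfl
  · subst h2; rfl
  · rfl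

/-- The reversible gates: they act on the letters `1`, `2`, `3` (two slots and the first letter
of the tape) of words that start with `0`. -/
inductive SlotGate : Type
  | load1
  | load2
  | neg
  | write (op : Bool → Bool → Bool)

/-- Every gate adds to one bit a function of other bits, hence is its own inverse; a second use
undoes a computation. -/
def SlotGate.fn : SlotGate → Bool × Bool × Bool → Bool × Bool × Bool
  | .load1, (a, b, d) => (xor a d, b, d)
  | .load2, (a, b, d) => (a, xor b d, d)
  | .neg, (a, b, d) => (a, b, !d)
  | .write op, (a, b, d) => (a, b, xor d (op a b))

theorem SlotGate.fn_involutive (g : SlotGate) : Function.Involutive g.fn := by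
  rintro ⟨a, b, d⟩
  cases g <;> simp [SlotGate.fn]

def SlotGate.perm (g : SlotGate) : Equiv.Perm (Bool × Bool × Bool) := g.fn_involutive.toPerm

/-- The instructions other than the transpositions. -/
inductive Prim : Type
  | ins
  | del
  | insOne
  | flag
  | twist
  | gate (g : SlotGate)

/-- `ins` and `del` act in parallel on normal words 0s and on flagged words 10s, so that the padding
of flagged words grows and shrinks with the tape of normal ones. `insOne` alone separates the two
kinds: it gives extra padding to flagged words. -/
def Prim.perm : Prim → Equiv.Perm (List Bool)
  | .ins => insZero * G31.insOne
  | .del => (insZero * G31.insOne)⁻¹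
  | .insOne => G31.insOne
  | .flag => flagPerm
  | .twist => twistPerm
  | .gate g => slotPerm g.perm

theorem Prim.perm_mem (p : Prim) : p.perm ∈ tailPerm := by
  cases p with
  | ins => exact mul_mem insZero_mem insOne_mem
  | del => exact inv_mem (mul_mem insZero_mem insOne_mem)
  | insOne => exact insOne_mem
  | flag => exact flagPerm_mem
  | twist => exact twistPerm_mem
  | gate g => exact slotPerm_mem _

theorem Prim.keepsMod3 (p : Prim) : KeepsMod3 p.perm := by
  cases p with
  | ins => exact keepsMod3_insZero.mul keepsMod3_insOne
  | del => exact (keepsMod3_insZero.mul keepsMod3_insOne).inv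
  | insOne => exact keepsMod3_insOne
  | flag => exact keepsMod3_flagPerm
  | twist => exact keepsMod3_twistPerm
  | gate g => exact keepsMod3_slotPerm _

/-- An instruction: a `Prim`, or the transposition `τ_{i,i+1}`. -/
inductive Instr : Type
  | prim (p : Prim)
  | tau (i : ℕ)

def Instr.perm (ρ : ShortRule) : Instr → Equiv.Perm (List Bool)
  | .prim p => p.perm
  | .tau i => tauPermList ρ i

theorem Instr.perm_mem (ρ : ShortRule) (a : Instr) : a.perm ρ ∈ tailPerm := by
  cases a with
  | prim p => exact p.perm_mem
  | tau i => exact tauPermList_mem ρ i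

theorem Instr.keepsMod3 (ρ : ShortRule) (a : Instr) : KeepsMod3 (a.perm ρ) := by
  cases a with
  | prim p => exact p.keepsMod3
  | tau i => intro z; rw [Instr.perm, length_tauPermList]

/-- The action of a program, whose first instruction acts first. -/
def run (ρ : ShortRule) : List Instr → List Bool → List Bool
  | [], z => z
  | a :: p, z => run ρ p (a.perm ρ z)

theorem run_append (ρ : ShortRule) (p q : List Instr) (z : List Bool) :
    run ρ (p ++ q) z = run ρ q (run ρ p z) := by
  induction p generalizing z with
  | nil => rfl
  | cons a p ih => exact ih _

/-- A program as an element of `tailPerm`. -/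
def runTail (ρ : ShortRule) : List Instr → tailPerm
  | [] => 1
  | a :: p => runTail ρ p * ⟨a.perm ρ, a.perm_mem ρ⟩

theorem runTail_apply (ρ : ShortRule) (p : List Instr) (z : List Bool) :
    (runTail ρ p).1 z = run ρ p z := by
  induction p generalizing z with
  | nil => rfl
  | cons a p ih => exact ih _

theorem run_keepsMod3 (ρ : ShortRule) (p : List Instr) (z : List Bool) :
    (run ρ p z).length ≡ z.length [MOD 3] := by
  induction p generalizing z with
  | nil => rfl
  | cons a p ih => exact (ih _).trans (a.keepsMod3 ρ z)

/-! ### The action of the instructions on normal and on flagged words -/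

theorem del_false (s : List Bool) :
    Prim.del.perm (false :: false :: false :: false :: s) = false :: s := rfl

theorem insOne_false (s : List Bool) : Prim.insOne.perm (false :: s) = false :: s := rfl

theorem gate_false (g : SlotGate) (a b d : Bool) (s : List Bool) :
    (Prim.gate g).perm (false :: a :: b :: d :: s) =
      false :: (g.fn (a, b, d)).1 :: (g.fn (a, b, d)).2.1 :: (g.fn (a, b, d)).2.2 :: s := rfl

theorem gate_true (g : SlotGate) (s : List Bool) :
    (Prim.gate g).perm (true :: s) = true :: s := by
  change slotFun g.perm (true :: s) = _
  simp [slotFun]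

/-- A flagged word, with `z` zeros of padding. -/
def flagged (z : ℕ) (t : List Bool) : List Bool :=
  true :: false :: (List.replicate z false ++ t)

theorem ins_flagged (z : ℕ) (t : List Bool) :
    Prim.ins.perm (flagged z t) = flagged (z + 3) t := rfl

theorem insOne_flagged (z : ℕ) (t : List Bool) :
    Prim.insOne.perm (flagged z t) = flagged (z + 3) t := rfl

theorem del_flagged (z : ℕ) (t : List Bool) :
    Prim.del.perm (flagged (z + 3) t) = flagged z t := rfl

theorem flag_flagged (z : ℕ) (t : List Bool) :
    flagPerm (flagged (z + 1) t) = flagged (z + 1) t := rfl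

theorem tauPermList_swap (ρ : ShortRule) (u v : List Bool) (a b : Bool) :
    tauPermList ρ u.length (u ++ a :: b :: v) = u ++ b :: a :: v := by
  have key : ∀ (ℓ : ℕ), u.length + 1 < ℓ → ∀ k : Fin ℓ, ((tauPerm ρ u.length ℓ k : Fin ℓ) : ℕ) =
      if (k : ℕ) = u.length then u.length + 1
      else if (k : ℕ) = u.length + 1 then u.length else k := by
    intro ℓ hℓ k
    rw [tauPerm, dif_pos hℓ, Equiv.swap_apply_def]
    simp only [Fin.ext_iff]
    split_ifs <;> rfl
  refine List.ext_getElem (by simp [length_tauPermList]) fun k h1 h2 => ?_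
  rw [length_tauPermList] at h1
  have e1 : (tauPermList ρ u.length (u ++ a :: b :: v))[k]'(by rwa [length_tauPermList]) =
      (u ++ a :: b :: v).get (tauPerm ρ u.length _ ⟨k, h1⟩) := by
    simp only [tauPermList_apply, permute, List.getElem_ofFn]
  rw [e1, List.get_eq_getElem]
  have h3 := key (u ++ a :: b :: v).length (by simp) ⟨k, h1⟩
  simp only [h3]
  rcases lt_trichotomy k u.length with h | h | h
  · rw [List.getElem_append_left (by rw [if_neg (by omega), if_neg (by omega)]; exact h),
      List.getElem_append_left h]
    congr 1
    rw [if_neg (by omega), if_neg (by omega)]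
  · subst h
    simp [List.getElem_append_right]
  · rcases Nat.eq_or_lt_of_le h with h | h
    · have h' : k = u.length + 1 := by omega
      subst h'
      simp [List.getElem_append_right]
    · obtain ⟨j, rfl⟩ : ∃ j, k = u.length + 2 + j := ⟨k - (u.length + 2), by omega⟩
      have e2 : (if u.length + 2 + j = u.length then u.length + 1
          else if u.length + 2 + j = u.length + 1 then u.length else u.length + 2 + j) =
          u.length + 2 + j := by
        rw [if_neg (by omega), if_neg (by omega)]
      simp only [e2]
      rw [List.getElem_append_right (by omega), List.getElem_append_right (by omega)]
      have e3 : u.length + 2 + j - u.length = j + 2 := by omega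
      simp only [e3]
      simp

/-- The transpositions keep the first letter and rearrange the other letters. -/
theorem tauPermList_cons (ρ : ShortRule) {i : ℕ} (hi : 0 < i) (b : Bool) (s : List Bool) :
    ∃ s', tauPermList ρ i (b :: s) = b :: s' ∧ s'.Perm s := by
  have h0 : tauPerm ρ i (b :: s).length ⟨0, by simp⟩ = ⟨0, by simp⟩ := by
    unfold tauPerm
    split_ifs with h
    · refine Equiv.swap_apply_of_ne_of_ne ?_ ?_ <;> (simp only [ne_eq, Fin.ext_iff]; omega)
    · exact ρ.fix_first i hi _ _
  have h1 : tauPermList ρ i (b :: s) =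
      List.ofFn fun k => (b :: s).get (tauPerm ρ i (b :: s).length k) := rfl
  have h2 : (tauPermList ρ i (b :: s)).Perm (b :: s) := by
    rw [h1]
    have h3 := (List.ofFn_get (b :: s))
    conv_rhs => rw [← h3]
    exact Equiv.Perm.ofFn_comp_perm (tauPerm ρ i (b :: s).length) _
  have h3 : (tauPermList ρ i (b :: s)).head? = some b := by
    rw [h1, List.head?_eq_getElem?, List.getElem?_ofFn]
    simp only [List.length_cons, lt_add_iff_pos_left, Nat.zero_lt_succ, ↓reduceDIte]
    have h4 : (b :: s).get (tauPerm ρ i (b :: s).length ⟨0, by simp⟩) = b := by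
      rw [h0]; rfl
    exact congrArg some h4
  rcases h : tauPermList ρ i (b :: s) with _ | ⟨c, s'⟩
  · rw [h] at h3; simp at h3
  · rw [h] at h3 h2
    have : c = b := by simpa using h3
    subst this
    exact ⟨s', rfl, h2.cons_inv⟩

/-- The padding occupies the positions 2, ..., z + 1, so the two exchanged letters are both 0. -/
theorem tauPermList_flagged (ρ : ShortRule) {i z : ℕ} (hi : 2 ≤ i) (hz : i ≤ z) (t : List Bool) :
    tauPermList ρ i (flagged z t) = flagged z t := by
  obtain ⟨j, rfl⟩ : ∃ j, i = j + 2 := ⟨i - 2, by omega⟩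
  obtain ⟨r, rfl⟩ : ∃ r, z = j + (r + 2) := ⟨z - (j + 2), by omega⟩
  have h := tauPermList_swap ρ (true :: false :: List.replicate j false)
    (List.replicate r false ++ t) false false
  have e : flagged (j + (r + 2)) t = true :: false :: List.replicate j false ++
      false :: false :: (List.replicate r false ++ t) := by
    simp [flagged, List.replicate_add, List.replicate_succ]
  rw [e]
  simpa using h

end G31

/-! ## Access to remote letters, and the length tests -/

namespace G31

/-- An unflagged word with the contents `a`, `b` of the two slots and with the tape `T`. -/
def word (a b : Bool) (T : List Bool) : List Bool := false :: a :: b :: T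

/-- Moves the first letter of the tape to position `P` of the tape. -/
def up (P : ℕ) : List Instr := (List.range P).map fun j => .tau (3 + j)

/-- Moves the letter at position `P` of the tape to the front. -/
def down (P : ℕ) : List Instr := (up P).reverse

/-- Applies a gate to the slots and the letter at position `P` of the tape. -/
def access (g : SlotGate) (P : ℕ) : List Instr := down P ++ .prim (.gate g) :: up P

/-- Adds the sum of the first `n` letters of the tape to the first slot. -/
def par (n : ℕ) : List Instr := (List.range n).flatMap (access .load1)

theorem up_succ (P : ℕ) : up (P + 1) = up P ++ [.tau (3 + P)] := by
  simp [up, List.range_succ]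

theorem down_succ (P : ℕ) : down (P + 1) = .tau (3 + P) :: down P := by
  simp [down, up_succ]

theorem par_succ (n : ℕ) : par (n + 1) = par n ++ access .load1 n := by
  simp [par, List.range_succ]

section
variable (ρ : ShortRule)

theorem tau_word (a b c d : Bool) (r v : List Bool) :
    tauPermList ρ (3 + r.length) (word a b (r ++ c :: d :: v)) =
      word a b (r ++ d :: c :: v) := by
  have h := tauPermList_swap ρ (false :: a :: b :: r) v c d
  rw [show (false :: a :: b :: r).length = 3 + r.length by simp; omega] at h
  exact h

theorem run_up (a b d : Bool) (r v : List Bool) :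
    run ρ (up r.length) (word a b (d :: (r ++ v))) = word a b (r ++ d :: v) := by
  induction r using List.reverseRecOn generalizing v with
  | nil => rfl
  | append_singleton r c ih =>
    rw [List.length_append, List.length_singleton, up_succ, run_append, List.append_assoc, ih]
    change tauPermList ρ _ _ = _
    rw [List.singleton_append, tau_word]
    simp

theorem run_down (a b d : Bool) (r v : List Bool) :
    run ρ (down r.length) (word a b (r ++ d :: v)) = word a b (d :: (r ++ v)) := by
  induction r using List.reverseRecOn generalizing v with
  | nil => rfl
  | append_singleton r c ih =>
    rw [List.length_append, List.length_singleton, down_succ]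
    change run ρ _ (tauPermList ρ _ _) = _
    rw [List.append_assoc, List.singleton_append, tau_word, ih]
    simp

/-- The letters in front of the accessed one are shifted by one place while the gate acts, and are
shifted back afterwards. -/
theorem run_access (g : SlotGate) (a b d : Bool) (r v : List Bool) :
    run ρ (access g r.length) (word a b (r ++ d :: v)) =
      word (g.fn (a, b, d)).1 (g.fn (a, b, d)).2.1 (r ++ (g.fn (a, b, d)).2.2 :: v) := by
  rw [access, run_append, run_down]
  change run ρ (up _) ((Prim.gate g).perm _) = _
  rw [word, gate_false]
  exact run_up ρ _ _ _ _ _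

/-- The sum of bits modulo `2`. -/
def parity (r : List Bool) : Bool := r.foldr xor false

theorem parity_append (r s : List Bool) : parity (r ++ s) = xor (parity r) (parity s) := by
  induction r with
  | nil => simp [parity]
  | cons a r ih => simpa [parity] using ih

/-- Parity is the information about a word that survives the unknown permutations on too short
words; the length tests rest on it. -/
theorem parity_perm {r s : List Bool} (h : r.Perm s) : parity r = parity s := by
  induction h with
  | nil => rfl
  | cons x _ ih => simpa [parity] using ih
  | swap x y l => simp [parity, Bool.xor_left_comm]
  | trans _ _ h1 h2 => exact h1.trans h2

theorem run_par (a b : Bool) (r v : List Bool) :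
    run ρ (par r.length) (word a b (r ++ v)) = word (xor a (parity r)) b (r ++ v) := by
  induction r using List.reverseRecOn generalizing v with
  | nil => simp [par, run, parity]
  | append_singleton r c ih =>
    rw [List.length_append, List.length_singleton, par_succ, run_append, List.append_assoc, ih,
      List.singleton_append, run_access]
    have h : parity (r ++ [c]) = xor (parity r) c := by
      rw [parity_append]; simp [parity]
    rw [h, ← Bool.xor_assoc]
    rfl

/-- The instructions that act trivially on the flagged words with at least `B` zeros. -/
def Instr.IsLocal (B : ℕ) : Instr → Prop
  | .prim (.gate _) => True
  | .prim _ => False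
  | .tau i => 3 ≤ i ∧ i < B

theorem Instr.IsLocal.mono {B B' : ℕ} (h : B ≤ B') {a : Instr} (ha : a.IsLocal B) :
    a.IsLocal B' := by
  rcases a with p | i
  · cases p <;> exact ha
  · exact ⟨ha.1, ha.2.trans_le h⟩

/-- Gates act only on words that start with 0, and the transpositions in question stay within the
padding. -/
theorem run_flagged {B z : ℕ} {p : List Instr} (hp : ∀ a ∈ p, a.IsLocal B) (hz : B ≤ z + 1)
    (t : List Bool) : run ρ p (flagged z t) = flagged z t := by
  induction p with
  | nil => rfl
  | cons a p ih =>
    have h1 : a.perm ρ (flagged z t) = flagged z t := by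
      have h := hp a (by simp)
      rcases a with q | i
      · cases q with
        | gate g => exact gate_true _ _
        | _ => exact h.elim
      · exact tauPermList_flagged ρ (by have := h.1; omega) (by have := h.2; omega) t
    rw [run, h1]
    exact ih fun a ha => hp a (by simp [ha])

end

theorem up_isLocal {P B : ℕ} (h : 3 + P ≤ B) : ∀ a ∈ up P, a.IsLocal B := by
  intro a ha
  simp only [up, List.mem_map, List.mem_range] at ha
  obtain ⟨j, hj, rfl⟩ := ha
  exact ⟨by omega, by omega⟩

theorem down_isLocal {P B : ℕ} (h : 3 + P ≤ B) : ∀ a ∈ down P, a.IsLocal B := fun a ha =>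
  up_isLocal h a (List.mem_reverse.1 ha)

theorem access_isLocal {g : SlotGate} {P B : ℕ} (h : 3 + P ≤ B) :
    ∀ a ∈ access g P, a.IsLocal B := by
  intro a ha
  simp only [access, List.mem_append, List.mem_cons] at ha
  rcases ha with ha | rfl | ha
  · exact down_isLocal h a ha
  · trivial
  · exact up_isLocal h a ha

theorem par_isLocal {n B : ℕ} (h : 2 + n ≤ B) : ∀ a ∈ par n, a.IsLocal B := by
  intro a ha
  simp only [par, List.mem_flatMap, List.mem_range] at ha
  obtain ⟨j, hj, ha⟩ := ha
  exact access_isLocal (by omega) a ha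

/-! ### Length tests by parity -/

/-- The test whether the word `0000x` has `|x| > k`. The words with `|x| = k` become flagged. -/
def test (k : ℕ) : List Instr :=
  up (k + 1) ++ .prim .ins :: (par (k + 4) ++ .prim (.gate .neg) :: (up (k + 4) ++
    .prim .ins :: (par (k + 7) ++ .prim .flag :: (List.replicate (k + 5) (.prim .insOne) ++
    .prim .del :: (down (k + 4) ++ .prim (.gate .neg) :: (par (k + 4) ++
    .prim .del :: down (k + 1)))))))

section
variable (ρ : ShortRule)

theorem run_replicate_insOne_flagged (n z : ℕ) (t : List Bool) :
    run ρ (List.replicate n (.prim .insOne)) (flagged z t) = flagged (z + 3 * n) t := by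
  induction n generalizing z with
  | zero => rfl
  | succ n ih =>
    rw [List.replicate_succ]
    change run ρ _ (Prim.insOne.perm _) = _
    rw [insOne_flagged, ih]
    congr 1; omega

theorem run_replicate_insOne_false (n : ℕ) (s : List Bool) :
    run ρ (List.replicate n (.prim .insOne)) (false :: s) = false :: s := by
  induction n with
  | zero => rfl
  | succ n ih =>
    rw [List.replicate_succ]
    change run ρ _ (Prim.insOne.perm _) = _
    rw [insOne_false, ih]

theorem run_cons_prim (p : Prim) (q : List Instr) (z : List Bool) :
    run ρ (.prim p :: q) z = run ρ q (p.perm z) := rfl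

/-- The two insertions and the two deletions cancel, and only the k + 5 copies of `insOne` have a
lasting effect. So a word flagged by an earlier test remains flagged, and its padding grows. -/
theorem run_test_flagged (k z : ℕ) (t : List Bool) (hz : 3 * k + 6 ≤ z) :
    run ρ (test k) (flagged z t) = flagged (z + 3 * (k + 5)) t := by
  have hg : ∀ g z t, (Prim.gate g).perm (flagged z t) = flagged z t := fun g z t =>
    gate_true g _
  rw [test, run_append, run_flagged ρ (up_isLocal le_rfl) (by omega), run_cons_prim, ins_flagged,
    run_append, run_flagged ρ (par_isLocal le_rfl) (by omega), run_cons_prim, hg,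
    run_append, run_flagged ρ (up_isLocal le_rfl) (by omega), run_cons_prim, ins_flagged,
    run_append, run_flagged ρ (par_isLocal le_rfl) (by omega), run_cons_prim]
  change run ρ _ (flagPerm _) = _
  rw [flag_flagged, run_append, run_replicate_insOne_flagged, run_cons_prim,
    show z + 3 + 3 + 3 * (k + 5) = z + 3 * (k + 5) + 3 + 3 by omega, del_flagged,
    run_append, run_flagged ρ (down_isLocal le_rfl) (by omega), run_cons_prim, hg,
    run_append, run_flagged ρ (par_isLocal le_rfl) (by omega), run_cons_prim, del_flagged,
    run_flagged ρ (down_isLocal le_rfl) (by omega)]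

theorem ins_word (a b : Bool) (T : List Bool) :
    Prim.ins.perm (word a b T) = word false false (false :: a :: b :: T) := rfl

theorem del_word (a b : Bool) (T : List Bool) :
    Prim.del.perm (word false false (false :: a :: b :: T)) = word a b T := rfl

theorem neg_word (a b d : Bool) (T : List Bool) :
    (Prim.gate .neg).perm (word a b (d :: T)) = word a b ((!d) :: T) := gate_false _ _ _ _ _

/-- All transpositions stay inside the word and act as intended. The marker 1 comes to lie just
behind the letters that the second parity sums, so this parity equals the first one, the flag is not
raised, and the second half of the test undoes the first. -/
theorem run_test_long (k : ℕ) (x y : List Bool) (hx : x.length = k + 1) :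
    run ρ (test k) (word false false (false :: (x ++ y))) =
      word false false (false :: (x ++ y)) := by
  have hpar : ∀ a b n r v, r.length = n →
      run ρ (par n) (word a b (r ++ v)) = word (xor a (parity r)) b (r ++ v) := by
    rintro a b _ r v rfl; exact run_par ρ a b r v
  have hup : ∀ a b d n r v, r.length = n →
      run ρ (up n) (word a b (d :: (r ++ v))) = word a b (r ++ d :: v) := by
    rintro a b d _ r v rfl; exact run_up ρ a b d r v
  have hdown : ∀ a b d n r v, r.length = n →
      run ρ (down n) (word a b (r ++ d :: v)) = word a b (d :: (r ++ v)) := by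
    rintro a b d _ r v rfl; exact run_down ρ a b d r v
  have e1 : ∀ c v, false :: false :: false :: (x ++ c :: v) =
      (false :: false :: false :: x) ++ c :: v := by simp
  have e2 : ∀ c v, false :: false :: (x ++ c :: v) =
      (false :: false :: (x ++ [c])) ++ v := by simp
  have e3 : false :: (xor false (parity (false :: false :: false :: x))) :: false ::
      ((false :: false :: (x ++ [false])) ++ true :: y) =
      (false :: (xor false (parity (false :: false :: false :: x))) :: false ::
        (false :: false :: (x ++ [false]))) ++ true :: y := by simp
  -- The second sum contains the first parity as a letter next to the letters that it came from, so
  -- it vanishes.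
  have e4 : xor false (parity (false :: (xor false (parity (false :: false :: false :: x))) ::
      false :: (false :: false :: (x ++ [false])))) = false := by
    have h : parity (x ++ [false]) = parity x := by simp [parity]
    have h' : ∀ b r, parity (b :: r) = xor b (parity r) := fun _ _ => rfl
    simp only [h', h]
    simp
  -- On the way back the first parity is added to the slot once more and clears it.
  have e5 : xor (xor false (parity (false :: false :: false :: x)))
      (parity (false :: false :: false :: x)) = false := by simp
  rw [test, run_append, hup _ _ _ _ x y hx, run_cons_prim, ins_word, e1, run_append,
    hpar _ _ _ _ _ (by simp [hx]), run_cons_prim, ← e1, neg_word, run_append, e2,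
    Bool.not_false, hup _ _ _ _ _ _ (by simp [hx]), run_cons_prim, ins_word, e3, run_append,
    hpar _ _ _ _ _ (by simp [hx]), e4, run_cons_prim]
  change run ρ _ (word _ _ _) = _
  rw [run_append]
  have e6 : ∀ T, run ρ (List.replicate (k + 5) (.prim .insOne)) (word false false T) =
      word false false T := fun T => run_replicate_insOne_false ρ _ _
  rw [e6, run_cons_prim, ← e3, del_word, run_append, hdown _ _ _ _ _ _ (by simp [hx]),
    run_cons_prim, neg_word, ← e2, Bool.not_true, e1, run_append,
    hpar _ _ _ _ _ (by simp [hx]), e5, run_cons_prim, ← e1, del_word,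
    hdown _ _ _ _ _ _ hx]

/-- This holds without any assumption on lengths. All indices are at least 3, so that too short
words also keep their first letter. -/
theorem run_up_cons (P : ℕ) (b : Bool) (s : List Bool) :
    ∃ s', run ρ (up P) (b :: s) = b :: s' ∧ s'.Perm s := by
  induction P with
  | zero => exact ⟨s, rfl, List.Perm.refl _⟩
  | succ P ih =>
    obtain ⟨s', h1, h2⟩ := ih
    obtain ⟨s'', h3, h4⟩ := tauPermList_cons ρ (i := 3 + P) (by omega) b s'
    refine ⟨s'', ?_, h4.trans h2⟩
    rw [up_succ, run_append, h1]
    exact h3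

/-- Here each parity runs over the entire tape, so it is irrelevant how the short rule has
rearranged the letters. The second sum contains the first parity, its summands, and the marker 1; it
equals 1, and 010 is exchanged for 101. Of the padding 3(k + 5) given afterwards, two deletions
remove 6. -/
theorem run_test_short (k : ℕ) (x : List Bool) (hx : x.length = k) :
    ∃ z t, run ρ (test k) (word false false (false :: x)) = flagged z t ∧ 3 * k + 9 ≤ z := by
  have hpar : ∀ a b n r, r.length = n →
      run ρ (par n) (word a b r) = word (xor a (parity r)) b r := by
    rintro a b _ r rfl
    simpa using run_par ρ a b r []
  obtain ⟨s, h1, h2⟩ := run_up_cons ρ (k + 1) false (false :: false :: false :: x)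
  have hs : s.length = k + 3 := by rw [h2.length_eq]; simp [hx]
  have h1' : run ρ (up (k + 1)) (word false false (false :: x)) = false :: s := h1
  have hi : ∀ s, Prim.ins.perm (false :: s) = word false false (false :: s) := fun _ => rfl
  have hg : ∀ g z t, (Prim.gate g).perm (flagged z t) = flagged z t := fun g z t =>
    gate_true g _
  rw [test, run_append, h1', run_cons_prim, hi, run_append, hpar _ _ _ _ (by simp [hs]),
    run_cons_prim, neg_word, run_append]
  obtain ⟨s', h3, h4⟩ := run_up_cons ρ (k + 4) false
    (xor false (parity (false :: s)) :: false :: (!false) :: s)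
  have hs' : s'.length = k + 6 := by rw [h4.length_eq]; simp [hs]
  -- The parity of s occurs once as a letter and once through the letters of s; the marker 1 is
  -- left.
  have hp : parity s' = true := by
    rw [parity_perm h4]
    simp [parity]
  rw [word, h3, run_cons_prim, hi, run_append, hpar _ _ _ _ (by simp [hs']), run_cons_prim,
    show xor false (parity (false :: s')) = true by simpa [parity] using hp]
  change ∃ z t, run ρ _ (flagged 0 (true :: false :: s')) = _ ∧ _
  refine ⟨3 * k + 9, true :: false :: s', ?_, le_rfl⟩
  rw [run_append, run_replicate_insOne_flagged, run_cons_prim,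
    show 0 + 3 * (k + 5) = 3 * k + 9 + 3 + 3 by omega, del_flagged,
    run_append, run_flagged ρ (down_isLocal le_rfl) (by omega), run_cons_prim, hg,
    run_append, run_flagged ρ (par_isLocal le_rfl) (by omega), run_cons_prim, del_flagged,
    run_flagged ρ (down_isLocal le_rfl) (by omega)]

/-- The length tests for `k < m`. -/
def tests (m : ℕ) : List Instr := (List.range m).flatMap test

theorem tests_succ (m : ℕ) : tests (m + 1) = tests m ++ test m := by
  simp [tests, List.range_succ]

theorem run_tests_long (m : ℕ) (x : List Bool) (hx : m ≤ x.length) :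
    run ρ (tests m) (word false false (false :: x)) = word false false (false :: x) := by
  induction m with
  | zero => rfl
  | succ m ih =>
    rw [tests_succ, run_append, ih (by omega)]
    have h := run_test_long ρ m (x.take (m + 1)) (x.drop (m + 1)) (by simp; omega)
    rwa [List.take_append_drop] at h

/-- The tests with k below the length of x do not change the word, the test with k equal to this
length flags it, and the later ones only add padding. -/
theorem run_tests_short (m : ℕ) (x : List Bool) (hx : x.length < m) :
    ∃ z t, run ρ (tests m) (word false false (false :: x)) = flagged z t ∧ 3 * m + 6 ≤ z := by
  induction m with
  | zero => simp at hx
  | succ m ih =>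
    rw [tests_succ, run_append]
    rcases Nat.lt_succ_iff_lt_or_eq.1 hx with h | h
    · obtain ⟨z, t, h1, h2⟩ := ih h
      exact ⟨_, t, by rw [h1, run_test_flagged ρ m z t (by omega)], by omega⟩
    · rw [run_tests_long ρ m x h.ge]
      obtain ⟨z, t, h1, h2⟩ := run_test_short ρ m x h
      exact ⟨z, t, h1, by omega⟩

end

end G31

/-! ## The simulation of circuits -/

namespace BoolCircuit

/-- A port, with the numbers of input variables and of gates forgotten. -/
inductive RawPort : Type
  | input (k : ℕ)
  | gate (j : ℕ) (second : Bool)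

def Port.raw {m g : ℕ} : Port m g → RawPort
  | .input k => .input k
  | .gate j b => .gate j b

/-- The kinds of the items in the description of a circuit: gates and output variables. -/
inductive Kind : Type
  | and
  | or
  | not
  | fork
  | out

def Kind.op : Kind → Bool → Bool → Bool
  | .and, a, b => a && b
  | .or, a, b => a || b
  | .not, a, _ => !a
  | .fork, a, _ => a
  | .out, a, _ => a

/-- A gate or an output variable, with the ports that feed it. -/
structure Item : Type where
  kind : Kind
  fst : RawPort
  snd : Option RawPort

def Gate.item {m g : ℕ} : Gate (Port m g) → Item
  | .and a b => ⟨.and, a.raw, some b.raw⟩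
  | .or a b => ⟨.or, a.raw, some b.raw⟩
  | .not a => ⟨.not, a.raw, none⟩
  | .fork a => ⟨.fork, a.raw, none⟩

def Port.outItem {m g : ℕ} (p : Port m g) : Item := ⟨.out, p.raw, none⟩

variable {m n : ℕ} (C : BoolCircuit m n)

def gateItems : List Item := List.ofFn fun j => (C.gate j).item

def outItems : List Item := List.ofFn fun i => (C.out i).outItem

/-! ### Simultaneous evaluation of all gates -/

/-- The values of the gates after `r` rounds of simultaneous evaluation. -/
def layerValue (x : Fin m → Bool) : ℕ → Fin C.gates → Bool
  | 0 => fun _ => false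
  | r + 1 => fun j => (C.gate j).eval (portValue x (layerValue x r))

-- As long as some gate is not settled, a minimal unsettled gate is fed by settled gates and input
-- variables only, so it is settled in the next round. Hence as many rounds as there are gates
-- suffice, in whatever order the gates are listed.
open Finset in
theorem layerValue_gates (x : Fin m → Bool) : C.layerValue x C.gates = C.gateValue x := by
  classical
  -- The gates whose value is correct from round r on. Correctness in all later rounds makes the
  -- sets increase.
  let S : ℕ → Finset (Fin C.gates) := fun r =>
    univ.filter fun j => ∀ r', r ≤ r' → C.layerValue x r' j = C.gateValue x j
  have hmono : ∀ r, S r ⊆ S (r + 1) := by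
    intro r j hj
    simp only [S, mem_filter, mem_univ, true_and] at hj ⊢
    exact fun r' hr => hj r' (by omega)
  have hstep : ∀ r, S r ≠ univ → S r ⊂ S (r + 1) := by
    intro r hr
    have hne : {j | j ∉ S r}.Nonempty := by
      by_contra h
      exact hr (eq_univ_of_forall fun j => by_contra fun hj => h ⟨j, hj⟩)
    obtain ⟨j, hj, hmin⟩ := C.wf_feeds.has_min _ hne
    refine ssubset_of_subset_of_ne (hmono r) fun h => hj ?_
    rw [h]
    simp only [S, mem_filter, mem_univ, true_and]
    intro r' hr'
    obtain ⟨s, rfl⟩ : ∃ s, r' = s + 1 := ⟨r' - 1, by omega⟩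
    rw [gateValue_eq, layerValue]
    refine Gate.eval_congr _ fun p hp => ?_
    cases p with
    | input k => rfl
    | gate i b =>
      have hi : i ∈ S r := by_contra fun hi => hmin i hi ⟨b, hp⟩
      simp only [S, mem_filter, mem_univ, true_and] at hi
      exact hi s (by omega)
  -- An increasing chain that is strict until it reaches the full set has at least r elements at
  -- stage r.
  have hcard : ∀ r, S r = univ ∨ r ≤ (S r).card := by
    intro r
    induction r with
    | zero => exact Or.inr (Nat.zero_le _)
    | succ r ih =>
      by_cases h : S r = univ
      · exact Or.inl (univ_subset_iff.1 (h ▸ hmono r))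
      · exact Or.inr ((ih.resolve_left h).trans_lt (card_lt_card (hstep r h)))
  have huniv : S C.gates = univ :=
    (hcard C.gates).elim id fun h => eq_univ_of_card _
      (le_antisymm (card_le_univ _) (by simpa using h))
  funext j
  have hj : j ∈ S C.gates := huniv ▸ mem_univ j
  simp only [S, mem_filter, mem_univ, true_and] at hj
  exact hj _ le_rfl

/-- The position on the tape of the value at a port, if the input variables start at `x` and
the values of the gates at `y`. -/
def RawPort.pos (x y : ℕ) : RawPort → ℕ
  | .input k => x + k
  | .gate j _ => y + j

def Item.posFst (x y : ℕ) (it : Item) : ℕ := it.fst.pos x y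

/-- An item with one source reads position 0 as a dummy. This letter is always on the tape and in
front of every section that is written, and the operation ignores it. -/
def Item.posSnd (x y : ℕ) (it : Item) : ℕ := it.snd.elim 0 (RawPort.pos x y)

/-- The value of an item, read from the tape. -/
def Item.value (x y : ℕ) (T : List Bool) (it : Item) : Bool :=
  it.kind.op (T.getD (it.posFst x y) false) (T.getD (it.posSnd x y) false)

end BoolCircuit

namespace G31

open BoolCircuit

/-- Adds the value of an item to the letter at position `t` of the tape. -/
def itemProg (x y t : ℕ) (it : Item) : List Instr :=
  access .load1 (it.posFst x y) ++ (access .load2 (it.posSnd x y) ++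
    (access (.write it.kind.op) t ++ (access .load2 (it.posSnd x y) ++
      access .load1 (it.posFst x y))))

/-- Adds the values of the items to the letters from position `t` on. -/
def pass (x y : ℕ) : ℕ → List Item → List Instr
  | _, [] => []
  | t, it :: its => itemProg x y t it ++ pass x y (t + 1) its

section
variable (ρ : ShortRule)

theorem eq_take_append_getD {T : List Bool} {P : ℕ} (h : P < T.length) :
    T = T.take P ++ T.getD P false :: T.drop (P + 1) := by
  rw [List.getD_eq_getElem _ _ h]
  simp

theorem run_load1 (a b : Bool) {T : List Bool} {P : ℕ} (h : P < T.length) :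
    run ρ (access .load1 P) (word a b T) = word (xor a (T.getD P false)) b T := by
  have h1 := run_access ρ .load1 a b (T.getD P false) (T.take P) (T.drop (P + 1))
  simp only [SlotGate.fn] at h1
  rwa [← eq_take_append_getD h, List.length_take, min_eq_left h.le] at h1

theorem run_load2 (a b : Bool) {T : List Bool} {P : ℕ} (h : P < T.length) :
    run ρ (access .load2 P) (word a b T) = word a (xor b (T.getD P false)) T := by
  have h1 := run_access ρ .load2 a b (T.getD P false) (T.take P) (T.drop (P + 1))
  simp only [SlotGate.fn] at h1
  rwa [← eq_take_append_getD h, List.length_take, min_eq_left h.le] at h1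

theorem getD_append_cons_of_ne {pre s : List Bool} {P : ℕ} (c c' : Bool) (h : P ≠ pre.length) :
    (pre ++ c :: s).getD P false = (pre ++ c' :: s).getD P false := by
  rcases lt_or_gt_of_ne h with h | h
  · rw [List.getD_append _ _ _ _ h, List.getD_append _ _ _ _ h]
  · rw [List.getD_append_right _ _ _ _ h.le, List.getD_append_right _ _ _ _ h.le]
    obtain ⟨j, hj⟩ : ∃ j, P - pre.length = j + 1 := ⟨P - pre.length - 1, by omega⟩
    rw [hj]; rfl

/-- The sources are not at the written position, so they still have their old values when they are
loaded a second time, which clears the slots. -/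
theorem run_itemProg (x y : ℕ) (it : Item) (pre post : List Bool) (c : Bool)
    (h1 : it.posFst x y ≠ pre.length) (h2 : it.posSnd x y ≠ pre.length)
    (h3 : it.posFst x y < (pre ++ c :: post).length)
    (h4 : it.posSnd x y < (pre ++ c :: post).length) :
    run ρ (itemProg x y pre.length it) (word false false (pre ++ c :: post)) =
      word false false (pre ++ (xor c (it.value x y (pre ++ c :: post))) :: post) := by
  rw [itemProg, run_append, run_load1 ρ _ _ h3, run_append, run_load2 ρ _ _ h4, run_append,
    run_access]
  simp only [SlotGate.fn, Bool.false_bne]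
  set c' := xor c (it.kind.op _ _) with hc'
  rw [run_append, run_load2 ρ _ _ (by simpa using h4), run_load1 ρ _ _ (by simpa using h3),
    getD_append_cons_of_ne c' c h1, getD_append_cons_of_ne c' c h2]
  simp [hc', Item.value]

/-- The position `P` is on the tape and outside a section of length `l` that starts at `k`. -/
def Outside (k l L P : ℕ) : Prop := P < L ∧ (P < k ∨ k + l ≤ P)

/-- All sources lie outside the section that is written, so every item can be evaluated on the tape
as it was before the pass. As values are added modulo 2, a second pass with the same sources undoes
the first. -/
theorem run_pass (x y : ℕ) (its : List Item) (pre mid post : List Bool)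
    (hmid : mid.length = its.length)
    (h1 : ∀ it ∈ its, Outside pre.length mid.length (pre ++ (mid ++ post)).length (it.posFst x y))
    (h2 : ∀ it ∈ its, Outside pre.length mid.length (pre ++ (mid ++ post)).length
      (it.posSnd x y)) :
    run ρ (pass x y pre.length its) (word false false (pre ++ (mid ++ post))) =
      word false false (pre ++ (List.zipWith xor mid
        (its.map (Item.value x y (pre ++ (mid ++ post)))) ++ post)) := by
  induction its generalizing pre mid with
  | nil =>
    rw [List.length_nil, List.length_eq_zero_iff] at hmid
    subst hmid; rfl
  | cons it its ih =>
    rcases mid with _ | ⟨c, mid⟩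
    · simp at hmid
    have hmid' : mid.length = its.length := by simpa using hmid
    have ha := h1 it (by simp)
    have hb := h2 it (by simp)
    simp only [Outside, List.length_cons, List.cons_append] at ha hb
    rw [pass, run_append, List.cons_append, run_itemProg ρ x y it pre _ c (by omega) (by omega)
      (by simpa using ha.1) (by simpa using hb.1)]
    set T := pre ++ c :: (mid ++ post) with hT
    set c' := xor c (it.value x y T) with hc'
    have e : ∀ d, pre ++ d :: (mid ++ post) = (pre ++ [d]) ++ (mid ++ post) := by simp
    have hlen : (pre ++ [c']).length = pre.length + 1 := by simp
    -- Writing the first item does not change the values of the remaining ones.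
    have hval : ∀ it ∈ its, Item.value x y ((pre ++ [c']) ++ (mid ++ post)) it =
        Item.value x y T it := by
      intro it' hit
      have ha := h1 it' (by simp [hit])
      have hb := h2 it' (by simp [hit])
      simp only [Outside, List.length_cons, List.cons_append] at ha hb
      rw [Item.value, Item.value, ← e, getD_append_cons_of_ne c' c (by omega),
        getD_append_cons_of_ne c' c (by omega)]
    rw [e, ← hlen, ih _ _ hmid', List.map_congr_left hval]
    · simp [hc', hT]
    · intro it' hit
      have ha := h1 it' (by simp [hit])
      simp only [Outside, List.length_cons, List.length_append, List.length_nil] at ha ⊢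
      omega
    · intro it' hit
      have ha := h2 it' (by simp [hit])
      simp only [Outside, List.length_cons, List.length_append, List.length_nil] at ha ⊢
      omega

theorem run_replicate_ins (k : ℕ) (T : List Bool) :
    run ρ (List.replicate k (.prim .ins)) (word false false (false :: T)) =
      word false false (false :: (List.replicate (3 * k) false ++ T)) := by
  induction k generalizing T with
  | zero => rfl
  | succ k ih =>
    rw [List.replicate_succ, run_cons_prim, ins_word,
      ih (false :: false :: false :: T), show 3 * (k + 1) = 3 * k + 3 by ring,
      List.replicate_add]
    simp

theorem run_replicate_del (k : ℕ) (T : List Bool) :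
    run ρ (List.replicate k (.prim .del))
      (word false false (false :: (List.replicate (3 * k) false ++ T))) =
      word false false (false :: T) := by
  induction k with
  | zero => rfl
  | succ k ih =>
    rw [List.replicate_succ, run_cons_prim, show 3 * (k + 1) = 3 + 3 * k by ring,
      List.replicate_add, List.append_assoc]
    exact ih

theorem run_replicate_ins_flagged (k z : ℕ) (t : List Bool) :
    run ρ (List.replicate k (.prim .ins)) (flagged z t) = flagged (z + 3 * k) t := by
  induction k generalizing z with
  | zero => rfl
  | succ k ih =>
    rw [List.replicate_succ, run_cons_prim, ins_flagged, ih]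
    congr 1; omega

theorem run_replicate_del_flagged (k z : ℕ) (t : List Bool) :
    run ρ (List.replicate k (.prim .del)) (flagged (z + 3 * k) t) = flagged z t := by
  induction k with
  | zero => rfl
  | succ k ih =>
    rw [List.replicate_succ, run_cons_prim, show z + 3 * (k + 1) = z + 3 * k + 3 by ring,
      del_flagged, ih]

end

/-! ### The stack of layers and the program of a circuit -/

/-- Computes `r` layers, from the layer `0` on; `x` is the position of the first input variable
at the start. -/
def ups (G : List Item) (x : ℕ) : ℕ → List Instr
  | 0 => []
  | r + 1 => ups G x r ++ (List.replicate G.length (.prim .ins) ++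
      pass (x + 3 * G.length * (r + 1)) (1 + 3 * G.length) 1 G)

/-- The reverse of `ups`. -/
def downs (G : List Item) (x : ℕ) : ℕ → List Instr
  | 0 => []
  | r + 1 => pass (x + 3 * G.length * (r + 1)) (1 + 3 * G.length) 1 G ++
      (List.replicate G.length (.prim .del) ++ downs G x r)

/-- The number of insertions that make room for `n` output variables. -/
def roomFor (n : ℕ) : ℕ := (n + 2) / 3

/-- Zeros are inserted in threes, and the room for n outputs, rounded up, is exactly n + i(n), as
simulation demands. -/
theorem three_mul_roomFor (n : ℕ) : 3 * roomFor n = pad n + n := by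
  unfold roomFor pad; omega

/-- The position of the first input variable above `r + 1` layers. -/
def inputPos (g n r : ℕ) : ℕ := 1 + 3 * roomFor n + 3 * g + 3 * g * r

/-- Computes the circuit with the gates `G` and the output variables `O` on normal words. -/
def circuitProg (G O : List Item) : List Instr :=
  List.replicate (roomFor O.length) (.prim .ins) ++ (List.replicate G.length (.prim .ins) ++
    (ups G (inputPos G.length O.length 0) G.length ++
      (pass (inputPos G.length O.length G.length) 1
          (inputPos G.length O.length G.length - O.length) O ++
        (downs G (inputPos G.length O.length 0) G.length ++
          List.replicate G.length (.prim .del)))))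

/-- The program for the circuit with `m` input variables, gates `G` and output variables `O`. -/
def prog (m : ℕ) (G O : List Item) : List Instr :=
  .prim .ins :: (tests m ++ (circuitProg G O ++ [.prim .del, .prim .twist]))

section
variable (ρ : ShortRule) {m n : ℕ} (C : BoolCircuit m n) (x : Fin m → Bool)

theorem length_gateItems : C.gateItems.length = C.gates := by simp [gateItems]

theorem length_outItems : C.outItems.length = n := by simp [outItems]

/-- A layer of the tape. -/
def layer (r : ℕ) : List Bool :=
  List.ofFn (C.layerValue x r) ++ List.replicate (2 * C.gates) false

/-- The layers `r, ..., 0` of the tape. -/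
def layers : ℕ → List Bool
  | 0 => layer C x 0
  | r + 1 => layer C x (r + 1) ++ layers r

theorem length_layer (r : ℕ) : (layer C x r).length = 3 * C.gates := by
  simp [layer]; ring

theorem length_layers (r : ℕ) : (layers C x r).length = 3 * C.gates + 3 * C.gates * r := by
  induction r with
  | zero => simp [layers, length_layer]
  | succ r ih => rw [layers, List.length_append, ih, length_layer]; ring

theorem layers_eq (r : ℕ) : ∃ s, layers C x r = List.ofFn (C.layerValue x r) ++ s := by
  cases r with
  | zero => exact ⟨_, rfl⟩
  | succ r => exact ⟨_, by rw [layers, layer, List.append_assoc]⟩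

theorem getD_append_add (u v : List Bool) (k : ℕ) :
    (u ++ v).getD (u.length + k) false = v.getD k false := by
  rw [List.getD_append_right _ _ _ _ (by omega)]
  congr 1; omega

theorem getD_ofFn_append {l : ℕ} (f : Fin l → Bool) (s : List Bool) (k : Fin l) :
    (List.ofFn f ++ s).getD k false = f k := by
  rw [List.getD_append _ _ _ _ (by simp), List.getD_eq_getElem _ _ (by simp)]
  simp

/-- The tape `T` holds the values of the input variables from position `a` on, and the values
`v` of the gates from position `b` on. -/
structure Holds (v : Fin C.gates → Bool) (a b : ℕ) (T : List Bool) : Prop where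
  input : ∀ k : Fin m, T.getD (a + k) false = x k
  gate : ∀ j : Fin C.gates, T.getD (b + j) false = v j

theorem Holds.pos {v : Fin C.gates → Bool} {a b : ℕ} {T : List Bool} (h : Holds C x v a b T)
    (p : Port m C.gates) : T.getD (p.raw.pos a b) false = portValue x v p := by
  cases p with
  | input k => exact h.input k
  | gate j _ => exact h.gate j

theorem Holds.gate_value {v : Fin C.gates → Bool} {a b : ℕ} {T : List Bool}
    (h : Holds C x v a b T) (G : Gate (Port m C.gates)) :
    G.item.value a b T = G.eval (portValue x v) := by
  cases G <;> simp [Gate.item, Item.value, Item.posFst, Item.posSnd, Kind.op, Gate.eval, h.pos,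
    -List.getD_eq_getElem?_getD]

theorem Holds.out_value {v : Fin C.gates → Bool} {a b : ℕ} {T : List Bool}
    (h : Holds C x v a b T) (p : Port m C.gates) :
    p.outItem.value a b T = portValue x v p := by
  simp [Port.outItem, Item.value, Item.posFst, Kind.op, h.pos, -List.getD_eq_getElem?_getD]

theorem raw_pos_cases {a b : ℕ} (p : Port m C.gates) :
    (∃ k : Fin m, p.raw.pos a b = a + k) ∨ ∃ k : Fin C.gates, p.raw.pos a b = b + k := by
  cases p with
  | input k => exact Or.inl ⟨k, rfl⟩
  | gate j _ => exact Or.inr ⟨j, rfl⟩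

theorem item_pos_cases {a b P : ℕ} {it : Item} (hit : it ∈ C.gateItems ∨ it ∈ C.outItems)
    (hP : P = it.posFst a b ∨ P = it.posSnd a b) :
    P = 0 ∨ (∃ k, k < m ∧ P = a + k) ∨ ∃ k, k < C.gates ∧ P = b + k := by
  have key : ∀ p : Port m C.gates, p.raw.pos a b = P →
      (∃ k, k < m ∧ P = a + k) ∨ ∃ k, k < C.gates ∧ P = b + k := by
    rintro p rfl
    rcases raw_pos_cases C (a := a) (b := b) p with ⟨k, h⟩ | ⟨k, h⟩
    · exact Or.inl ⟨k, k.2, h⟩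
    · exact Or.inr ⟨k, k.2, h⟩
  rcases hit with hit | hit
  · simp only [gateItems, List.mem_ofFn] at hit
    obtain ⟨j, rfl⟩ := hit
    cases h : C.gate j <;> rw [h] at hP <;>
      simp only [Gate.item, Item.posFst, Item.posSnd, Option.elim] at hP <;>
      rcases hP with rfl | rfl <;> first | exact Or.inr (key _ rfl) | exact Or.inl rfl
  · simp only [outItems, List.mem_ofFn] at hit
    obtain ⟨j, rfl⟩ := hit
    simp only [Port.outItem, Item.posFst, Item.posSnd, Option.elim] at hP
    rcases hP with rfl | rfl
    · exact Or.inr (key _ rfl)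
    · exact Or.inl rfl

/-- The pass writes at position 1 and reads the layer behind it and the input variables. The old
contents u are arbitrary: with u = 0 the pass computes the layer r + 1, and with u equal to this
layer it erases it. -/
theorem run_sweep (r l : ℕ) (u : Fin C.gates → Bool) (Z y : List Bool)
    (hZ : Z.length = 3 * roomFor l) :
    run ρ (pass (inputPos C.gates l (r + 1)) (1 + 3 * C.gates) 1 C.gateItems)
      (word false false (false :: ((List.ofFn u ++ List.replicate (2 * C.gates) false) ++
        (layers C x r ++ (Z ++ (List.ofFn x ++ y)))))) =
      word false false (false ::
        ((List.ofFn (fun j => xor (u j) (C.layerValue x (r + 1) j)) ++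
          List.replicate (2 * C.gates) false) ++
        (layers C x r ++ (Z ++ (List.ofFn x ++ y))))) := by
  set post := List.replicate (2 * C.gates) false ++ (layers C x r ++ (Z ++ (List.ofFn x ++ y)))
    with hpost
  have hlen : (false :: (List.ofFn u ++ post)).length =
      inputPos C.gates l (r + 1) + m + y.length := by
    simp only [hpost, inputPos, List.length_cons, List.length_append, List.length_ofFn,
      List.length_replicate, length_layers, hZ]
    ring
  have hholds : Holds C x (C.layerValue x r) (inputPos C.gates l (r + 1)) (1 + 3 * C.gates)
      (false :: (List.ofFn u ++ post)) := by
    constructor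
    · intro k
      have e : false :: (List.ofFn u ++ post) = (false :: (List.ofFn u ++
          (List.replicate (2 * C.gates) false ++ (layers C x r ++ Z)))) ++
            (List.ofFn x ++ y) := by simp [hpost]
      have e2 : inputPos C.gates l (r + 1) + k = (false :: (List.ofFn u ++
          (List.replicate (2 * C.gates) false ++ (layers C x r ++ Z)))).length + k := by
        simp only [inputPos, List.length_cons, List.length_append, List.length_ofFn,
          List.length_replicate, length_layers, hZ]
        ring
      rw [e, e2, getD_append_add, getD_ofFn_append]
    · intro j
      obtain ⟨s, hs⟩ := layers_eq C x r
      have e : false :: (List.ofFn u ++ post) = (false :: (List.ofFn u ++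
          List.replicate (2 * C.gates) false)) ++
            (List.ofFn (C.layerValue x r) ++ (s ++ (Z ++ (List.ofFn x ++ y)))) := by
        simp [hpost, hs]
      have e2 : 1 + 3 * C.gates + j = (false :: (List.ofFn u ++
          List.replicate (2 * C.gates) false)).length + j := by
        simp only [List.length_cons, List.length_append, List.length_ofFn,
          List.length_replicate]
        ring
      rw [e, e2, getD_append_add, getD_ofFn_append]
  have hout : ∀ it ∈ C.gateItems, ∀ P,
      (P = it.posFst (inputPos C.gates l (r + 1)) (1 + 3 * C.gates) ∨
        P = it.posSnd (inputPos C.gates l (r + 1)) (1 + 3 * C.gates)) →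
      Outside 1 C.gates (inputPos C.gates l (r + 1) + m + y.length) P := by
    intro it hit P hP
    have hb : 1 + 3 * C.gates + 3 * C.gates ≤ inputPos C.gates l (r + 1) := by
      unfold inputPos
      nlinarith [Nat.zero_le (C.gates * r)]
    rcases item_pos_cases C (Or.inl hit) hP with h | ⟨k, hk, h⟩ | ⟨k, hk, h⟩
    · exact ⟨by omega, by omega⟩
    · exact ⟨by omega, by omega⟩
    · exact ⟨by omega, by omega⟩
  have h := run_pass ρ (inputPos C.gates l (r + 1)) (1 + 3 * C.gates) C.gateItems [false]
    (List.ofFn u) post (by simp [length_gateItems])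
    (fun it hit => by
      rw [List.singleton_append, hlen, List.length_ofFn]
      exact hout it hit _ (Or.inl rfl))
    (fun it hit => by
      rw [List.singleton_append, hlen, List.length_ofFn]
      exact hout it hit _ (Or.inr rfl))
  rw [List.singleton_append, List.singleton_append] at h
  rw [List.append_assoc, List.append_assoc, ← hpost]
  refine h.trans ?_
  congr 3
  refine List.ext_getElem (by simp [length_gateItems]) fun k h1 h2 => ?_
  simp [gateItems, hholds.gate_value, layerValue]

theorem run_ups (r l : ℕ) (Z y : List Bool) (hZ : Z.length = 3 * roomFor l) :
    run ρ (ups C.gateItems (inputPos C.gates l 0) r)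
      (word false false (false :: (layers C x 0 ++ (Z ++ (List.ofFn x ++ y))))) =
      word false false (false :: (layers C x r ++ (Z ++ (List.ofFn x ++ y)))) := by
  induction r with
  | zero => rfl
  | succ r ih =>
    have e : inputPos C.gates l 0 + 3 * C.gates * (r + 1) = inputPos C.gates l (r + 1) := by
      simp [inputPos]
    have h0 : List.replicate (3 * C.gates) false =
        List.ofFn (fun _ : Fin C.gates => false) ++ List.replicate (2 * C.gates) false := by
      rw [List.ofFn_const, ← List.replicate_add]
      congr 1; ring
    rw [ups, run_append, ih, run_append, length_gateItems, run_replicate_ins, e, h0,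
      run_sweep ρ C x r l _ Z y hZ]
    simp [layers, layer]

/-- Z is arbitrary of the given length, because the room that was all zeros on the way up holds the
outputs on the way down. -/
theorem run_downs (r l : ℕ) (Z y : List Bool) (hZ : Z.length = 3 * roomFor l) :
    run ρ (downs C.gateItems (inputPos C.gates l 0) r)
      (word false false (false :: (layers C x r ++ (Z ++ (List.ofFn x ++ y))))) =
      word false false (false :: (layers C x 0 ++ (Z ++ (List.ofFn x ++ y)))) := by
  induction r with
  | zero => rfl
  | succ r ih =>
    have e : inputPos C.gates l 0 + 3 * C.gates * (r + 1) = inputPos C.gates l (r + 1) := by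
      simp [inputPos]
    have h0 : List.replicate (3 * C.gates) false =
        List.ofFn (fun _ : Fin C.gates => false) ++ List.replicate (2 * C.gates) false := by
      rw [List.ofFn_const, ← List.replicate_add]
      congr 1; ring
    have e2 : layers C x (r + 1) ++ (Z ++ (List.ofFn x ++ y)) =
        (List.ofFn (C.layerValue x (r + 1)) ++ List.replicate (2 * C.gates) false) ++
          (layers C x r ++ (Z ++ (List.ofFn x ++ y))) := by
      simp [layers, layer]
    rw [downs, run_append, length_gateItems, e, e2,
      run_sweep ρ C x r l _ Z y hZ]
    simp only [Bool.xor_self]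
    rw [← h0, run_append, run_replicate_del, ih]

/-- The front layer is the layer number `C.gates`, hence holds the true gate values. The last n
letters of the room, directly in front of the input variables, receive the outputs; the other zeros
remain as the padding i(n). -/
theorem run_outs (y : List Bool) :
    run ρ (pass (inputPos C.gates n C.gates) 1 (inputPos C.gates n C.gates - n) C.outItems)
      (word false false (false :: (layers C x C.gates ++
        (List.replicate (3 * roomFor n) false ++ (List.ofFn x ++ y))))) =
      word false false (false :: (layers C x C.gates ++
        ((List.replicate (pad n) false ++ List.ofFn (C.fn x)) ++ (List.ofFn x ++ y)))) := by
  set pre := false :: (layers C x C.gates ++ List.replicate (pad n) false) with hpre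
  have hroom := three_mul_roomFor n
  have hprelen : pre.length = inputPos C.gates n C.gates - n := by
    simp only [hpre, inputPos, List.length_cons, List.length_append, List.length_replicate,
      length_layers]
    omega
  have hin : pre.length + n = inputPos C.gates n C.gates := by
    rw [hprelen]; unfold inputPos; omega
  set T := pre ++ (List.replicate n false ++ (List.ofFn x ++ y)) with hT
  have hTlen : T.length = inputPos C.gates n C.gates + m + y.length := by
    simp only [hT, List.length_append, List.length_replicate, List.length_ofFn]
    omega
  have hholds : Holds C x (C.gateValue x) (inputPos C.gates n C.gates) 1 T := by
    constructor
    · intro k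
      have e : T = (pre ++ List.replicate n false) ++ (List.ofFn x ++ y) := by simp [hT]
      have e2 : inputPos C.gates n C.gates + k =
          (pre ++ List.replicate n false).length + k := by simp; omega
      rw [e, e2, getD_append_add, getD_ofFn_append]
    · intro j
      obtain ⟨s, hs⟩ := layers_eq C x C.gates
      have e : T = [false] ++ (List.ofFn (C.gateValue x) ++ (s ++ (List.replicate (pad n) false ++
          (List.replicate n false ++ (List.ofFn x ++ y))))) := by
        simp [hT, hpre, hs, layerValue_gates]
      rw [e]
      exact (getD_append_add [false] _ _).trans (getD_ofFn_append _ _ _)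
  have hout : ∀ it ∈ C.outItems, ∀ P,
      (P = it.posFst (inputPos C.gates n C.gates) 1 ∨
        P = it.posSnd (inputPos C.gates n C.gates) 1) →
      Outside pre.length n T.length P := by
    intro it hit P hP
    have hb : 1 + C.gates ≤ pre.length := by
      rw [hpre, List.length_cons, List.length_append, length_layers]
      nlinarith [Nat.zero_le (C.gates * C.gates)]
    rcases item_pos_cases C (Or.inr hit) hP with h | ⟨k, hk, h⟩ | ⟨k, hk, h⟩
    · exact ⟨by omega, by omega⟩
    · exact ⟨by omega, by omega⟩
    · exact ⟨by omega, by omega⟩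
  have h := run_pass ρ (inputPos C.gates n C.gates) 1 C.outItems pre
    (List.replicate n false) (List.ofFn x ++ y) (by simp [length_outItems])
    (fun it hit => by
      rw [List.length_replicate]
      exact hout it hit _ (Or.inl rfl))
    (fun it hit => by
      rw [List.length_replicate]
      exact hout it hit _ (Or.inr rfl))
  rw [hprelen] at h
  have e1 : T = false :: (layers C x C.gates ++
      (List.replicate (3 * roomFor n) false ++ (List.ofFn x ++ y))) := by
    rw [hroom, List.replicate_add, hT, hpre]
    simp only [List.cons_append, List.append_assoc]
  rw [← e1, hT, h]
  have e3 : List.zipWith xor (List.replicate n false) (List.map (Item.value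
      (inputPos C.gates n C.gates) 1 T) C.outItems) = List.ofFn (C.fn x) := by
    refine List.ext_getElem (by simp [length_outItems]) fun k h1 h2 => ?_
    simp [outItems, hholds.out_value, BoolCircuit.fn]
  rw [e3]
  simp [hpre]

/-- Compute, copy the result, uncompute: only the room for the outputs has changed in the end. -/
theorem run_circuitProg (y : List Bool) :
    run ρ (circuitProg C.gateItems C.outItems)
      (word false false (false :: (List.ofFn x ++ y))) =
      word false false (false :: (List.replicate (pad n) false ++
        (List.ofFn (C.fn x) ++ (List.ofFn x ++ y)))) := by
  have h0 : layers C x 0 = List.replicate (3 * C.gates) false := by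
    simp only [layers, layer, layerValue]
    rw [List.ofFn_const, ← List.replicate_add]
    congr 1; ring
  have hroom := three_mul_roomFor n
  rw [circuitProg, length_gateItems, length_outItems, run_append, run_replicate_ins, run_append,
    run_replicate_ins, ← h0, run_append, run_ups ρ C x _ n _ y (by simp), run_append,
    run_outs, run_append, run_downs ρ C x _ n _ y (by simp [hroom]), h0, run_replicate_del]
  simp

end

/-! ### Normal, flagged and empty words -/

theorem pass_isLocal {a b t B : ℕ} {its : List Item}
    (h1 : ∀ it ∈ its, 3 + it.posFst a b ≤ B) (h2 : ∀ it ∈ its, 3 + it.posSnd a b ≤ B)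
    (h3 : 2 + t + its.length ≤ B) : ∀ c ∈ pass a b t its, c.IsLocal B := by
  induction its generalizing t with
  | nil => simp [pass]
  | cons it its ih =>
    intro c hc
    have ha := h1 it (by simp)
    have hb := h2 it (by simp)
    rw [List.length_cons] at h3
    simp only [pass, itemProg, List.mem_append] at hc
    rcases hc with (hc | hc | hc | hc | hc) | hc
    · exact access_isLocal ha c hc
    · exact access_isLocal hb c hc
    · exact access_isLocal (by omega) c hc
    · exact access_isLocal hb c hc
    · exact access_isLocal ha c hc
    · exact ih (fun it hit => h1 it (by simp [hit])) (fun it hit => h2 it (by simp [hit]))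
        (by omega) c hc

section
variable (ρ : ShortRule) {m n : ℕ} (C : BoolCircuit m n)

theorem sweep_isLocal (l r : ℕ) :
    ∀ c ∈ pass (inputPos C.gates l (r + 1)) (1 + 3 * C.gates) 1 C.gateItems,
      c.IsLocal (3 + inputPos C.gates l (r + 1) + m) := by
  have hb : 1 + 3 * C.gates + 3 * C.gates ≤ inputPos C.gates l (r + 1) := by
    unfold inputPos
    nlinarith [Nat.zero_le (C.gates * r)]
  have key : ∀ it ∈ C.gateItems, ∀ P,
      (P = it.posFst (inputPos C.gates l (r + 1)) (1 + 3 * C.gates) ∨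
        P = it.posSnd (inputPos C.gates l (r + 1)) (1 + 3 * C.gates)) →
      3 + P ≤ 3 + inputPos C.gates l (r + 1) + m := by
    intro it hit P hP
    rcases item_pos_cases C (Or.inl hit) hP with h | ⟨k, hk, h⟩ | ⟨k, hk, h⟩ <;> omega
  exact pass_isLocal (fun it hit => key it hit _ (Or.inl rfl))
    (fun it hit => key it hit _ (Or.inr rfl)) (by rw [length_gateItems]; omega)

theorem outs_isLocal :
    ∀ c ∈ pass (inputPos C.gates n C.gates) 1 (inputPos C.gates n C.gates - n) C.outItems,
      c.IsLocal (3 + inputPos C.gates n C.gates + m) := by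
  have hb : 1 + n + C.gates ≤ inputPos C.gates n C.gates := by
    have := three_mul_roomFor n
    unfold inputPos
    nlinarith [Nat.zero_le (C.gates * C.gates)]
  have key : ∀ it ∈ C.outItems, ∀ P,
      (P = it.posFst (inputPos C.gates n C.gates) 1 ∨
        P = it.posSnd (inputPos C.gates n C.gates) 1) →
      3 + P ≤ 3 + inputPos C.gates n C.gates + m := by
    intro it hit P hP
    rcases item_pos_cases C (Or.inr hit) hP with h | ⟨k, hk, h⟩ | ⟨k, hk, h⟩ <;> omega
  exact pass_isLocal (fun it hit => key it hit _ (Or.inl rfl))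
    (fun it hit => key it hit _ (Or.inr rfl)) (by rw [length_outItems]; omega)

/-- Each insertion lengthens the padding exactly as it shifts the input variables on normal words.
So the surplus z of the padding over the position of the input variables is constant, and m + 3 is
enough to cover the highest index. -/
theorem run_ups_flagged (l r z : ℕ) (t : List Bool) (hz : m + 3 ≤ z) :
    run ρ (ups C.gateItems (inputPos C.gates l 0) r) (flagged (z + inputPos C.gates l 0) t) =
      flagged (z + inputPos C.gates l r) t := by
  induction r with
  | zero => rfl
  | succ r ih =>
    have e : inputPos C.gates l 0 + 3 * C.gates * (r + 1) = inputPos C.gates l (r + 1) := by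
      simp [inputPos]
    have e2 : z + inputPos C.gates l r + 3 * C.gates = z + inputPos C.gates l (r + 1) := by
      simp only [inputPos]; ring
    rw [ups, run_append, ih, run_append, length_gateItems, run_replicate_ins_flagged, e2, e,
      run_flagged ρ (sweep_isLocal C l r) (by omega)]

theorem run_downs_flagged (l r z : ℕ) (t : List Bool) (hz : m + 3 ≤ z) :
    run ρ (downs C.gateItems (inputPos C.gates l 0) r) (flagged (z + inputPos C.gates l r) t) =
      flagged (z + inputPos C.gates l 0) t := by
  induction r with
  | zero => rfl
  | succ r ih =>
    have e : inputPos C.gates l 0 + 3 * C.gates * (r + 1) = inputPos C.gates l (r + 1) := by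
      simp [inputPos]
    have e2 : z + inputPos C.gates l r + 3 * C.gates = z + inputPos C.gates l (r + 1) := by
      simp only [inputPos]; ring
    rw [downs, run_append, length_gateItems, e, run_flagged ρ (sweep_isLocal C l r) (by omega),
      run_append, ← e2, run_replicate_del_flagged, ih]

/-- Insertions and deletions for the layers cancel, and everything else is local; only the room for
the n outputs is left. -/
theorem run_circuitProg_flagged (z : ℕ) (t : List Bool) (hz : m + 4 ≤ z) :
    run ρ (circuitProg C.gateItems C.outItems) (flagged z t) =
      flagged (z + 3 * roomFor n) t := by
  -- One zero of the padding pays for the summand 1 in `inputPos`, which stands for position 0 of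
  -- the tape.
  obtain ⟨z, rfl⟩ : ∃ z', z = z' + 1 := ⟨z - 1, by omega⟩
  have e : z + 1 + 3 * roomFor n + 3 * C.gates = z + inputPos C.gates n 0 := by
    simp only [inputPos]; ring
  rw [circuitProg, length_gateItems, length_outItems, run_append, run_replicate_ins_flagged,
    run_append, run_replicate_ins_flagged, e, run_append,
    run_ups_flagged ρ C n C.gates z t (by omega), run_append,
    run_flagged ρ (outs_isLocal C) (by omega), run_append,
    run_downs_flagged ρ C n C.gates z t (by omega), ← e, run_replicate_del_flagged]

theorem run_prog (x : Fin m → Bool) (y : List Bool) :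
    run ρ (prog m C.gateItems C.outItems) (false :: (List.ofFn x ++ y)) =
      List.replicate (1 + pad n) false ++ List.ofFn (C.fn x) ++ List.ofFn x ++ y := by
  have h1 : ∀ s, Prim.ins.perm (false :: s) = word false false (false :: s) := fun _ => rfl
  rw [prog, run_cons_prim, h1, run_append, run_tests_long ρ m _ (by simp), run_append,
    run_circuitProg, run_cons_prim]
  change run ρ [_] (Prim.del.perm (false :: false :: false :: false :: _)) = _
  rw [del_false]
  change twistPerm _ = _
  rw [twistPerm_of_cons _ _ (by simp), add_comm, List.replicate_succ]
  simp

/-- The tests depend on m only and produce a flagged word, and the part that depends on the circuit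
adds to it a padding that depends on n only. -/
theorem run_prog_short (C' : BoolCircuit m n) (s : List Bool) (hs : s.length < m) :
    run ρ (prog m C.gateItems C.outItems) (false :: s) =
      run ρ (prog m C'.gateItems C'.outItems) (false :: s) := by
  have h1 : ∀ s, Prim.ins.perm (false :: s) = word false false (false :: s) := fun _ => rfl
  obtain ⟨z, t, h2, h3⟩ := run_tests_short ρ m s hs
  rw [prog, prog, run_cons_prim, run_cons_prim, h1, run_append, run_append ρ (tests m), h2, run_append,
    run_append ρ (circuitProg _ _) _ (flagged _ _), run_circuitProg_flagged ρ C z t (by omega),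
    run_circuitProg_flagged ρ C' z t (by omega)]

theorem run_nil {p : List Instr} (h : .prim .twist ∉ p) : run ρ p [] = [] := by
  induction p with
  | nil => rfl
  | cons a p ih =>
    have h1 : a.perm ρ [] = [] := by
      rcases a with q | i
      · cases q with
        | twist => simp at h
        | _ => rfl
      · exact List.length_eq_zero_iff.1 (length_tauPermList ρ i [])
    rw [run, h1]
    exact ih fun h2 => h (List.mem_cons_of_mem _ h2)

end

theorem twist_notMem_of_isLocal {B : ℕ} {p : List Instr} (h : ∀ a ∈ p, a.IsLocal B) :
    .prim .twist ∉ p := fun h1 => h _ h1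

end G31

/-! ## The words -/

namespace G31

open BoolCircuit

section
variable (ρ : ShortRule)

theorem twist_notMem_replicate (k : ℕ) {p : Prim} (h : p ≠ .twist) :
    .prim .twist ∉ List.replicate k (Instr.prim p) := by
  intro h1
  have := List.eq_of_mem_replicate h1
  rw [Instr.prim.injEq] at this
  exact h this.symm

theorem twist_notMem_tests (m : ℕ) : .prim .twist ∉ tests m := by
  intro h
  simp only [tests, List.mem_flatMap] at h
  obtain ⟨k, -, h⟩ := h
  simp only [test, List.mem_append, List.mem_cons, Instr.prim.injEq, reduceCtorEq, false_or] at h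
  rcases h with h | h | h | h | h | h | h | h
  · exact twist_notMem_of_isLocal (up_isLocal le_rfl) h
  · exact twist_notMem_of_isLocal (par_isLocal le_rfl) h
  · exact twist_notMem_of_isLocal (up_isLocal le_rfl) h
  · exact twist_notMem_of_isLocal (par_isLocal le_rfl) h
  · exact twist_notMem_replicate _ (by simp) h
  · exact twist_notMem_of_isLocal (down_isLocal le_rfl) h
  · exact twist_notMem_of_isLocal (par_isLocal le_rfl) h
  · exact twist_notMem_of_isLocal (down_isLocal le_rfl) h

theorem inputPos_zero_add (g n r : ℕ) :
    inputPos g n 0 + 3 * g * (r + 1) = inputPos g n (r + 1) := by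
  simp [inputPos]

variable {m n : ℕ} (C : BoolCircuit m n)

theorem mem_ups {l r : ℕ} {a : Instr} (ha : a ∈ ups C.gateItems (inputPos C.gates l 0) r) :
    a = .prim .ins ∨ a.IsLocal (3 + inputPos C.gates l r + m) := by
  induction r with
  | zero => simp [ups] at ha
  | succ r ih =>
    simp only [ups, List.mem_append, length_gateItems, inputPos_zero_add] at ha
    rcases ha with ha | ha | ha
    · refine (ih ha).imp id (Instr.IsLocal.mono ?_)
      unfold inputPos; nlinarith [Nat.zero_le (C.gates * r)]
    · exact Or.inl (List.eq_of_mem_replicate ha)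
    · exact Or.inr (sweep_isLocal C l r a ha)

theorem mem_downs {l r : ℕ} {a : Instr} (ha : a ∈ downs C.gateItems (inputPos C.gates l 0) r) :
    a = .prim .del ∨ a.IsLocal (3 + inputPos C.gates l r + m) := by
  induction r with
  | zero => simp [downs] at ha
  | succ r ih =>
    simp only [downs, List.mem_append, length_gateItems, inputPos_zero_add] at ha
    rcases ha with ha | ha | ha
    · exact Or.inr (sweep_isLocal C l r a ha)
    · exact Or.inl (List.eq_of_mem_replicate ha)
    · refine (ih ha).imp id (Instr.IsLocal.mono ?_)
      unfold inputPos; nlinarith [Nat.zero_le (C.gates * r)]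

theorem mem_circuitProg {a : Instr} (ha : a ∈ circuitProg C.gateItems C.outItems) :
    a = .prim .ins ∨ a = .prim .del ∨ a.IsLocal (3 + inputPos C.gates n C.gates + m) := by
  simp only [circuitProg, List.mem_append, length_gateItems, length_outItems] at ha
  rcases ha with ha | ha | ha | ha | ha | ha
  · exact Or.inl (List.eq_of_mem_replicate ha)
  · exact Or.inl (List.eq_of_mem_replicate ha)
  · exact (mem_ups C ha).imp id Or.inr
  · exact Or.inr (Or.inr (outs_isLocal C a ha))
  · exact Or.inr (mem_downs C ha)
  · exact Or.inr (Or.inl (List.eq_of_mem_replicate ha))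

/-- All instructions but the final `twist` fix the empty string. Without the twist the empty word
could lie in the domain code, for instance if the program acted as the identity. -/
theorem run_prog_nil : run ρ (prog m C.gateItems C.outItems) [] = [true, true, true] := by
  have e : prog m C.gateItems C.outItems =
      (.prim .ins :: (tests m ++ (circuitProg C.gateItems C.outItems ++ [.prim .del]))) ++
        [.prim .twist] := by simp [prog]
  rw [e, run_append, run_nil]
  · exact Equiv.swap_apply_left _ _
  · simp only [List.mem_cons, List.mem_append, Instr.prim.injEq, reduceCtorEq, false_or,
      List.not_mem_nil, or_false, not_or]
    refine ⟨twist_notMem_tests m, fun h => ?_⟩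
    rcases mem_circuitProg C h with h | h | h
    · simp at h
    · simp at h
    · exact h

/-- The program of a circuit strongly simulates its input-output function. -/
theorem stronglySimulates_prog :
    StronglySimulates (ofTail (runTail ρ (prog m C.gateItems C.outItems))) C.fn := by
  refine stronglySimulates_ofTail _ _ (fun z => ?_) (fun x y => ?_) ?_
  · rw [runTail_apply]; exact run_keepsMod3 ρ _ z
  · rw [runTail_apply, run_prog]
  · rw [runTail_apply, run_prog_nil]

theorem map_prog_short (C' : BoolCircuit m n) {k : ℕ} (hk : k < m) (x : Fin k → Bool) :
    (ofTail (runTail ρ (prog m C.gateItems C.outItems))).map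
        (bitsHash (false :: List.ofFn x)) =
      (ofTail (runTail ρ (prog m C'.gateItems C'.outItems))).map
        (bitsHash (false :: List.ofFn x)) := by
  rw [map_hash, map_hash, runTail_apply, runTail_apply,
    run_prog_short ρ C C' _ (by simpa using hk)]

end

/-! ### Lengths -/

theorem length_up (P : ℕ) : (up P).length = P := by simp [up]

theorem length_down (P : ℕ) : (down P).length = P := by simp [down, length_up]

theorem length_access (g : SlotGate) (P : ℕ) : (access g P).length = 2 * P + 1 := by
  simp [access, length_up, length_down]; omega

theorem length_par (n : ℕ) : (par n).length = n * n := by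
  induction n with
  | zero => rfl
  | succ n ih => rw [par_succ, List.length_append, ih, length_access]; ring

theorem length_test_le (k : ℕ) : (test k).length ≤ 200 * (k + 1) ^ 2 := by
  simp only [test, List.length_append, List.length_cons, length_up, length_down, length_par,
    List.length_replicate]
  nlinarith

theorem length_tests_le (m : ℕ) : (tests m).length ≤ 200 * m * (m + 1) ^ 2 := by
  induction m with
  | zero => simp [tests]
  | succ m ih =>
    rw [tests_succ, List.length_append]
    have := length_test_le m
    nlinarith

/-- An item needs five accesses, each of length at most 2B + 1. -/
theorem length_pass_le {a b t B : ℕ} {its : List Item} (h1 : ∀ it ∈ its, it.posFst a b ≤ B)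
    (h2 : ∀ it ∈ its, it.posSnd a b ≤ B) (h3 : t + its.length ≤ B) :
    (pass a b t its).length ≤ its.length * (10 * B + 5) := by
  induction its generalizing t with
  | nil => simp [pass]
  | cons it its ih =>
    have ha := h1 it (by simp)
    have hb := h2 it (by simp)
    rw [List.length_cons] at h3
    have h := ih (t := t + 1) (fun it hit => h1 it (by simp [hit]))
      (fun it hit => h2 it (by simp [hit])) (by omega)
    simp only [pass, itemProg, List.length_append, length_access, List.length_cons, add_mul]
    omega

section
variable {m n : ℕ} (C : BoolCircuit m n)

theorem inputPos_mono {g l r r' : ℕ} (h : r ≤ r') : inputPos g l r ≤ inputPos g l r' := by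
  unfold inputPos
  have := Nat.mul_le_mul_left (3 * g) h
  omega

theorem length_sweep_le (l r : ℕ) :
    (pass (inputPos C.gates l (r + 1)) (1 + 3 * C.gates) 1 C.gateItems).length ≤
      C.gates * (10 * (inputPos C.gates l (r + 1) + m) + 5) := by
  have hb : 1 + 3 * C.gates + 3 * C.gates ≤ inputPos C.gates l (r + 1) := by
    unfold inputPos
    nlinarith [Nat.zero_le (C.gates * r)]
  have key : ∀ it ∈ C.gateItems, ∀ P,
      (P = it.posFst (inputPos C.gates l (r + 1)) (1 + 3 * C.gates) ∨
        P = it.posSnd (inputPos C.gates l (r + 1)) (1 + 3 * C.gates)) →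
      P ≤ inputPos C.gates l (r + 1) + m := by
    intro it hit P hP
    rcases item_pos_cases C (Or.inl hit) hP with h | ⟨k, hk, h⟩ | ⟨k, hk, h⟩ <;> omega
  have h := length_pass_le (t := 1) (fun it hit => key it hit _ (Or.inl rfl))
    (fun it hit => key it hit _ (Or.inr rfl)) (by rw [length_gateItems]; omega)
  rwa [length_gateItems] at h

theorem length_outs_le :
    (pass (inputPos C.gates n C.gates) 1 (inputPos C.gates n C.gates - n) C.outItems).length ≤
      n * (10 * (inputPos C.gates n C.gates + m) + 5) := by
  have hb : 1 + n + C.gates ≤ inputPos C.gates n C.gates := by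
    have := three_mul_roomFor n
    unfold inputPos
    nlinarith [Nat.zero_le (C.gates * C.gates)]
  have key : ∀ it ∈ C.outItems, ∀ P,
      (P = it.posFst (inputPos C.gates n C.gates) 1 ∨
        P = it.posSnd (inputPos C.gates n C.gates) 1) →
      P ≤ inputPos C.gates n C.gates + m := by
    intro it hit P hP
    rcases item_pos_cases C (Or.inr hit) hP with h | ⟨k, hk, h⟩ | ⟨k, hk, h⟩ <;> omega
  have h := length_pass_le (t := inputPos C.gates n C.gates - n)
    (fun it hit => key it hit _ (Or.inl rfl))
    (fun it hit => key it hit _ (Or.inr rfl)) (by rw [length_outItems]; omega)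
  rwa [length_outItems] at h

theorem length_ups_le (l r R : ℕ) (hr : r ≤ R) :
    (ups C.gateItems (inputPos C.gates l 0) r).length ≤
      r * (C.gates + C.gates * (10 * (inputPos C.gates l R + m) + 5)) := by
  induction r with
  | zero => simp [ups]
  | succ r ih =>
    have h1 := ih (by omega)
    have h2 := length_sweep_le C l r
    have h3 : C.gates * (10 * (inputPos C.gates l (r + 1) + m) + 5) ≤
        C.gates * (10 * (inputPos C.gates l R + m) + 5) := by
      have := inputPos_mono (g := C.gates) (l := l) hr
      gcongr
    simp only [ups, List.length_append, List.length_replicate, length_gateItems,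
      inputPos_zero_add]
    rw [add_mul, one_mul]
    omega

theorem length_downs (G : List Item) (x r : ℕ) :
    (downs G x r).length = (ups G x r).length := by
  induction r with
  | zero => rfl
  | succ r ih =>
    simp only [ups, downs, List.length_append, List.length_replicate, ih]
    omega

end

end G31

/-! ### Bounds in terms of the size of the circuit -/

namespace BoolCircuit

open G31

theorem le_size_outputs {m n : ℕ} (C : BoolCircuit m n) : n ≤ C.size := Nat.le_add_left _ _

theorem one_le_length_sources {P : Type} (G : Gate P) : 1 ≤ G.sources.length := by
  cases G <;> simp [Gate.sources]

theorem gates_le_size {m n : ℕ} (C : BoolCircuit m n) : C.gates ≤ C.size := by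
  have h : ∑ _j : Fin C.gates, 1 ≤ ∑ j, (C.gate j).sources.length :=
    Finset.sum_le_sum fun j _ => one_le_length_sources _
  simp only [Finset.sum_const, Finset.card_univ, Fintype.card_fin, smul_eq_mul, mul_one] at h
  unfold size
  omega

/-- Every input variable is the start of some wire, so the m distinct input ports occur in the list
of all wire sources, which has |C| entries. -/
theorem inputs_le_size {m n : ℕ} (C : BoolCircuit m n) : m ≤ C.size := by
  have h1 : List.ofFn (Port.input (m := m) (g := C.gates)) ⊆
      (List.ofFn fun j => (C.gate j).sources).flatten ++ List.ofFn C.out := by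
    intro p hp
    obtain ⟨k, rfl⟩ := (List.mem_ofFn' _ _).1 hp
    rcases C.input_connected k with ⟨i, hi⟩ | ⟨i, hi⟩
    · refine List.mem_append_left _ (List.mem_flatten.2 ⟨_, ?_, hi⟩)
      exact (List.mem_ofFn' _ _).2 ⟨i, rfl⟩
    · exact List.mem_append_right _ ((List.mem_ofFn' _ _).2 ⟨i, hi⟩)
  have h2 : (List.ofFn (Port.input (m := m) (g := C.gates))).Nodup :=
    List.nodup_ofFn.2 fun a b h => by simpa using h
  have h3 := (List.subperm_of_subset h2 h1).length_le
  simpa [size, List.length_flatten, List.sum_ofFn, Function.comp_def] using h3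

theorem inputPos_le {m n : ℕ} (C : BoolCircuit m n) :
    3 + inputPos C.gates n C.gates + m ≤ 8 * (C.size + 1) ^ 2 := by
  have h1 := C.le_size_outputs
  have h2 := C.gates_le_size
  have h3 := C.inputs_le_size
  have h4 : roomFor n * 3 ≤ n + 2 := by unfold roomFor; omega
  have h5 := Nat.mul_le_mul h2 h2
  unfold inputPos
  nlinarith

theorem length_prog_le {m n : ℕ} (C : BoolCircuit m n) :
    (prog m C.gateItems C.outItems).length ≤ 1000 * (C.size + 1) ^ 4 := by
  have h1 := C.le_size_outputs
  have h2 := C.gates_le_size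
  have h3 := C.inputs_le_size
  have h4 := C.inputPos_le
  set S := C.size + 1 with hS
  have hS1 : 1 ≤ S := by omega
  have hB : 10 * (inputPos C.gates n C.gates + m) + 5 ≤ 80 * S ^ 2 := by omega
  have e2 : S ≤ S ^ 4 := Nat.le_self_pow (by omega) S
  have t1 : (tests m).length ≤ 200 * S ^ 4 := by
    refine (length_tests_le m).trans ?_
    calc 200 * m * (m + 1) ^ 2 ≤ 200 * S * S ^ 2 := by gcongr <;> omega
      _ = 200 * S ^ 3 := by ring
      _ ≤ 200 * S ^ 4 := by gcongr; omega
  -- At most S rounds of at most S gates, each with accesses at distance O(S^2): this is the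
  -- dominant term, and it determines the exponent 4.
  have t2 : (ups C.gateItems (inputPos C.gates n 0) C.gates).length ≤ 81 * S ^ 4 := by
    refine (length_ups_le C n _ _ le_rfl).trans ?_
    calc C.gates * (C.gates + C.gates * (10 * (inputPos C.gates n C.gates + m) + 5))
        ≤ S * (S + S * (80 * S ^ 2)) := by gcongr <;> omega
      _ = S ^ 2 + 80 * S ^ 4 := by ring
      _ ≤ S ^ 4 + 80 * S ^ 4 := by gcongr; omega
      _ = 81 * S ^ 4 := by ring
  have t3 : (pass (inputPos C.gates n C.gates) 1 (inputPos C.gates n C.gates - n)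
      C.outItems).length ≤ 80 * S ^ 4 := by
    refine (length_outs_le C).trans ?_
    calc n * (10 * (inputPos C.gates n C.gates + m) + 5) ≤ S * (80 * S ^ 2) := by
          gcongr; omega
      _ = 80 * S ^ 3 := by ring
      _ ≤ 80 * S ^ 4 := by gcongr; omega
  have t4 : roomFor n ≤ S := by unfold roomFor; omega
  simp only [prog, circuitProg, List.length_append, List.length_cons, List.length_replicate,
    length_gateItems, length_outItems, length_downs, List.length_nil]
  omega

end BoolCircuit

/-! ### Words that stand for the programs and determine the circuits -/

namespace G31

open BoolCircuit

section
variable {d : ℕ} (δ : Fin d → G31) (ρ : ShortRule)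

theorem evalWord_append (u v : List (Gen d)) :
    evalWord δ ρ (u ++ v) = evalWord δ ρ u * evalWord δ ρ v := by
  simp [evalWord]

/-- Transpositions are kept out of the word, so that inverses can be formed letter by letter, and
the index bound depends only on the transpositions of the program. -/
theorem exists_word (hδ : Subgroup.closure (Set.range δ) = ⊤) (φ : G31) :
    ∃ w : List (Gen d), evalWord δ ρ w = φ ∧ ∀ i, Gen.tau i ∉ w := by
  have h : φ ∈ Subgroup.closure (Set.range δ) := hδ ▸ Subgroup.mem_top φ
  induction h using Subgroup.closure_induction with
  | mem x hx =>
    obtain ⟨k, rfl⟩ := hx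
    exact ⟨[.pos k], by simp [evalWord, Gen.toGroup], by simp⟩
  | one => exact ⟨[], rfl, by simp⟩
  | mul x y _ _ hx hy =>
    obtain ⟨u, rfl, hu⟩ := hx
    obtain ⟨v, rfl, hv⟩ := hy
    exact ⟨u ++ v, evalWord_append δ ρ u v, by simp [hu, hv]⟩
  | inv x hxm hx =>
    obtain ⟨u, rfl, hu⟩ := hx
    clear hδ hxm
    induction u with
    | nil => exact ⟨[], by simp [evalWord], by simp⟩
    | cons a u ih =>
      obtain ⟨v, hv, hv'⟩ := ih fun i hi => hu i (by simp [hi])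
      have e : evalWord δ ρ (a :: u) = a.toGroup δ ρ * evalWord δ ρ u := by simp [evalWord]
      cases a with
      | pos k =>
        refine ⟨v ++ [.neg k], ?_, by simpa using hv'⟩
        rw [e, mul_inv_rev, evalWord_append, hv]
        simp [evalWord, Gen.toGroup]
      | neg k =>
        refine ⟨v ++ [.pos k], ?_, by simpa using hv'⟩
        rw [e, mul_inv_rev, evalWord_append, hv]
        simp [evalWord, Gen.toGroup]
      | tau i => exact absurd (by simp) (hu i)

instance : Finite SlotGate := by
  refine Finite.of_surjective (α := Option (Option (Option (Bool → Bool → Bool))))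
    (fun o => match o with
      | none => .load1
      | some none => .load2
      | some (some none) => .neg
      | some (some (some f)) => .write f) ?_
  rintro (_ | _ | _ | f)
  exacts [⟨none, rfl⟩, ⟨some none, rfl⟩, ⟨some (some none), rfl⟩, ⟨some (some (some f)), rfl⟩]

instance : Finite Prim := by
  refine Finite.of_surjective (α := Option (Option (Option (Option (Option SlotGate)))))
    (fun o => match o with
      | none => .ins
      | some none => .del
      | some (some none) => .insOne
      | some (some (some none)) => .flag
      | some (some (some (some none))) => .twist
      | some (some (some (some (some g)))) => .gate g) ?_
  rintro (_ | _ | _ | _ | _ | g)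
  exacts [⟨none, rfl⟩, ⟨some none, rfl⟩, ⟨some (some none), rfl⟩,
    ⟨some (some (some none)), rfl⟩, ⟨some (some (some (some none))), rfl⟩,
    ⟨some (some (some (some (some g)))), rfl⟩]

/-- The letters for an instruction, if the words for the elements of `Prim` are given. -/
def Instr.letters (chunk : Prim → List (Gen d)) : Instr → List (Gen d)
  | .prim p => chunk p
  | .tau i => [.tau i]

/-- Writes a program in front of a word. The instruction that acts first is written first. -/
def emit (chunk : Prim → List (Gen d)) : List Instr → List (Gen d) → List (Gen d)
  | [], w => w
  | a :: p, w => emit chunk p (a.letters chunk ++ w)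

theorem exists_emit_eq (chunk : Prim → List (Gen d)) (p : List Instr) (w : List (Gen d)) :
    ∃ u, emit chunk p w = u ++ w := by
  induction p generalizing w with
  | nil => exact ⟨[], rfl⟩
  | cons a p ih =>
    obtain ⟨u, hu⟩ := ih (a.letters chunk ++ w)
    exact ⟨u ++ a.letters chunk, by rw [emit, hu, List.append_assoc]⟩

theorem evalWord_emit {chunk : Prim → List (Gen d)}
    (h : ∀ p : Prim, evalWord δ ρ (chunk p) = ofTail ⟨p.perm, p.perm_mem⟩)
    (p : List Instr) (w : List (Gen d)) :
    evalWord δ ρ (emit chunk p w) = ofTail (runTail ρ p) * evalWord δ ρ w := by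
  induction p generalizing w with
  | nil => simp [emit, runTail]
  | cons a p ih =>
    have h1 : evalWord δ ρ (a.letters chunk) = ofTail ⟨a.perm ρ, a.perm_mem ρ⟩ := by
      cases a with
      | prim q => exact h q
      | tau i =>
        simp only [Instr.letters, evalWord, List.map_cons, List.map_nil, List.prod_singleton,
          Gen.toGroup]
        exact tau_eq_ofTail ρ i
    rw [emit, ih, evalWord_append, runTail, map_mul, ← h1, mul_assoc]

theorem mem_emit {chunk : Prim → List (Gen d)} {p : List Instr} {w : List (Gen d)} {a : Gen d}
    (h : a ∈ emit chunk p w) : a ∈ w ∨ ∃ b ∈ p, a ∈ b.letters chunk := by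
  induction p generalizing w with
  | nil => exact Or.inl h
  | cons b p ih =>
    rcases ih h with h | ⟨c, hc, h⟩
    · rcases List.mem_append.1 h with h | h
      · exact Or.inr ⟨b, by simp, h⟩
      · exact Or.inl h
    · exact Or.inr ⟨c, by simp [hc], h⟩

theorem length_emit_le {chunk : Prim → List (Gen d)} {K : ℕ} (hK : 1 ≤ K)
    (h : ∀ p, (chunk p).length ≤ K) (p : List Instr) (w : List (Gen d)) :
    (emit chunk p w).length ≤ K * p.length + w.length := by
  induction p generalizing w with
  | nil => simp [emit]
  | cons a p ih =>
    have h1 : (a.letters chunk).length ≤ K := by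
      cases a with
      | prim q => exact h q
      | tau i => exact hK
    have h2 := ih (a.letters chunk ++ w)
    rw [List.length_append] at h2
    rw [emit, List.length_cons, mul_add]
    omega

/-! ### Words for the unit element that encode circuits -/

/-- A binary code for the symbols in which circuits are written down, and an end marker. -/
def symbolCode : Option Symbol → Bool × Bool × Bool × Bool
  | none => (false, false, false, false)
  | some .input => (false, false, false, true)
  | some .and => (false, false, true, false)
  | some .or => (false, false, true, true)
  | some .not => (false, true, false, false)
  | some .fork => (false, true, false, true)
  | some .out => (false, true, true, false)
  | some .fromInput => (false, true, true, true)
  | some (.fromGate false) => (true, false, false, false)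
  | some (.fromGate true) => (true, false, false, true)
  | some .tick => (true, false, true, false)

theorem symbolCode_injective : Function.Injective symbolCode := by
  intro a b h
  rcases a with _ | _ | _ | _ | _ | _ | _ | _ | _ | _ | _ <;>
  rcases b with _ | _ | _ | _ | _ | _ | _ | _ | _ | _ | _ <;>
  first
    | rfl
    | (simp [symbolCode] at h; done)
    | (rename_i b c; cases b <;> cases c <;> first | rfl | simp [symbolCode] at h)
    | (rename_i b; cases b <;> simp [symbolCode] at h)

/-- A bit as a word for the unit element: `δ_k δ_k⁻¹` or `δ_k⁻¹ δ_k`. -/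
def bitLetters (k : Fin d) (b : Bool) : List (Gen d) :=
  [cond b (.pos k) (.neg k), cond b (.neg k) (.pos k)]

/-- A symbol as a word for the unit element. -/
def block (k : Fin d) (o : Option Symbol) : List (Gen d) :=
  bitLetters k (symbolCode o).1 ++ (bitLetters k (symbolCode o).2.1 ++
    (bitLetters k (symbolCode o).2.2.1 ++ bitLetters k (symbolCode o).2.2.2))

theorem length_block (k : Fin d) (o : Option Symbol) : (block k o).length = 8 := rfl

theorem block_injective (k : Fin d) : Function.Injective (block k) := by
  intro a b h
  have key : ∀ b c : Bool, (cond b (.pos k) (.neg k) : Gen d) = cond c (.pos k) (.neg k) →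
      b = c := by
    intro b c; cases b <;> cases c <;> simp
  refine symbolCode_injective ?_
  simp only [block, bitLetters, List.cons_append, List.nil_append, List.cons.injEq] at h
  exact Prod.ext (key _ _ h.1) (Prod.ext (key _ _ h.2.2.1)
    (Prod.ext (key _ _ h.2.2.2.2.1) (key _ _ h.2.2.2.2.2.2.1)))

theorem evalWord_block (k : Fin d) (o : Option Symbol) : evalWord δ ρ (block k o) = 1 := by
  have key : ∀ b, evalWord δ ρ (bitLetters k b) = 1 := by
    intro b; cases b <;> simp [bitLetters, evalWord, Gen.toGroup]
  simp [block, evalWord_append, key]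

theorem tau_notMem_block (k : Fin d) (o : Option Symbol) (i : ℕ) : Gen.tau i ∉ block k o := by
  have key : ∀ b, Gen.tau i ∉ bitLetters k b := by
    intro b; cases b <;> simp [bitLetters]
  simp [block, key]

/-- Writes the code of a string in front of a word. -/
def emitCode (k : Fin d) : List Symbol → List (Gen d) → List (Gen d)
  | [], w => w
  | s :: l, w => emitCode k l (block k (some s) ++ w)

theorem emitCode_eq (k : Fin d) (l : List Symbol) (w : List (Gen d)) :
    emitCode k l w = emitCode k l [] ++ w := by
  induction l generalizing w with
  | nil => rfl
  | cons s l ih => rw [emitCode, emitCode, ih, ih (_ ++ []), List.append_assoc]; simp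

theorem emitCode_cons (k : Fin d) (s : Symbol) (l : List Symbol) :
    emitCode k (s :: l) [] = emitCode k l [] ++ block k (some s) := by
  rw [emitCode, emitCode_eq, List.append_nil]

/-- The word is decoded from its right end, in blocks of eight letters. The end marker is the block
of no symbol, so the reading stops at the right place, whatever u is. -/
theorem emitCode_injective (k : Fin d) {l l' : List Symbol} {u u' : List (Gen d)}
    (h : u ++ (block k none ++ emitCode k l []) = u' ++ (block k none ++ emitCode k l' [])) :
    l = l' := by
  induction l generalizing l' with
  | nil =>
    cases l' with
    | nil => rfl
    | cons s l' =>
      rw [emitCode_cons, emitCode, List.append_nil, ← List.append_assoc, ← List.append_assoc] at h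
      have h1 := (List.append_inj' h (by simp [length_block])).2
      simpa using block_injective k h1
  | cons s l ih =>
    cases l' with
    | nil =>
      rw [emitCode_cons, emitCode, List.append_nil, ← List.append_assoc, ← List.append_assoc] at h
      have h1 := (List.append_inj' h (by simp [length_block])).2
      simpa using block_injective k h1
    | cons s' l' =>
      simp only [emitCode_cons, ← List.append_assoc] at h
      obtain ⟨h1, h2⟩ := List.append_inj' h (by simp [length_block])
      have h3 := block_injective k h2
      simp only [Option.some.injEq] at h3
      simp only [List.append_assoc] at h1
      rw [h3, ih h1]

theorem evalWord_emitCode (k : Fin d) (l : List Symbol) :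
    evalWord δ ρ (emitCode k l []) = 1 := by
  induction l with
  | nil => rfl
  | cons s l ih => rw [emitCode_cons, evalWord_append, ih, evalWord_block, one_mul]

theorem tau_notMem_emitCode (k : Fin d) (l : List Symbol) (i : ℕ) :
    Gen.tau i ∉ emitCode k l [] := by
  induction l with
  | nil => simp [emitCode]
  | cons s l ih => simp [emitCode_cons, ih, tau_notMem_block]

theorem length_emitCode (k : Fin d) (l : List Symbol) :
    (emitCode k l []).length = 8 * l.length := by
  induction l with
  | nil => rfl
  | cons s l ih => rw [emitCode_cons, List.length_append, ih, length_block, List.length_cons]; ring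

end

end G31

/-! ### The encoding of circuits -/

namespace BoolCircuit

def Kind.symbol : Kind → Symbol
  | .and => .and
  | .or => .or
  | .not => .not
  | .fork => .fork
  | .out => .out

def RawPort.encode : RawPort → List Symbol
  | .input k => .fromInput :: List.replicate k .tick
  | .gate j b => .fromGate b :: List.replicate j .tick

def Item.encode (it : Item) : List Symbol :=
  it.kind.symbol :: (it.fst.encode ++ it.snd.elim [] RawPort.encode)

theorem Port.encode_raw {m g : ℕ} (p : Port m g) : p.raw.encode = p.encode := by
  cases p <;> rfl

theorem Gate.encode_item {m g : ℕ} (G : Gate (Port m g)) : G.item.encode = G.encode := by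
  cases G <;>
    simp [Gate.item, Item.encode, Gate.encode, Kind.symbol, Port.encode_raw]

theorem Port.encode_outItem {m g : ℕ} (p : Port m g) : p.outItem.encode = .out :: p.encode := by
  simp [Port.outItem, Item.encode, Kind.symbol, Port.encode_raw]

variable {m n : ℕ} (C : BoolCircuit m n)

theorem encode_eq : C.encode = List.replicate m .input ++
    (C.gateItems.flatMap Item.encode ++ C.outItems.flatMap Item.encode) := by
  rw [encode, List.append_assoc, gateItems, outItems, List.flatMap, List.flatMap]
  simp only [List.map_ofFn, Function.comp_def, Gate.encode_item, Port.encode_outItem]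

/-- An item with the number of ports that its kind requires. -/
def Item.WellFormed (it : Item) : Prop :=
  match it.kind with
  | .and => it.snd.isSome
  | .or => it.snd.isSome
  | _ => it.snd = none

theorem Gate.wellFormed_item {m g : ℕ} (G : Gate (Port m g)) : G.item.WellFormed := by
  cases G <;> simp [Gate.item, Item.WellFormed]

theorem Gate.kind_item_ne {m g : ℕ} (G : Gate (Port m g)) : G.item.kind ≠ .out := by
  cases G <;> simp [Gate.item]

theorem wellFormed_of_mem {it : Item} (h : it ∈ C.gateItems ++ C.outItems) : it.WellFormed := by
  simp only [gateItems, outItems, List.mem_append, List.mem_ofFn] at h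
  rcases h with ⟨j, rfl⟩ | ⟨i, rfl⟩
  · exact (C.gate j).wellFormed_item
  · rfl

theorem kind_ne_of_mem {it : Item} (h : it ∈ C.gateItems) : it.kind ≠ .out := by
  simp only [gateItems, List.mem_ofFn] at h
  obtain ⟨j, rfl⟩ := h
  exact (C.gate j).kind_item_ne

theorem kind_eq_of_mem {it : Item} (h : it ∈ C.outItems) : it.kind = .out := by
  simp only [outItems, List.mem_ofFn] at h
  obtain ⟨i, rfl⟩ := h
  rfl

/-- A unary number can be read off if it is not followed by another tick; this is the form in which
all parts of a description are separated. -/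
theorem replicate_append_inj {α : Type} {a : α} {k k' : ℕ} {X X' : List α}
    (hX : X.head? ≠ some a) (hX' : X'.head? ≠ some a)
    (h : List.replicate k a ++ X = List.replicate k' a ++ X') : k = k' ∧ X = X' := by
  induction k generalizing k' with
  | zero =>
    cases k' with
    | zero => exact ⟨rfl, h⟩
    | succ k' =>
      refine absurd ?_ hX
      rw [List.replicate_zero, List.nil_append] at h
      rw [h]; rfl
  | succ k ih =>
    cases k' with
    | zero =>
      refine absurd ?_ hX'
      rw [List.replicate_zero, List.nil_append] at h
      rw [← h]; rfl
    | succ k' =>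
      simp only [List.replicate_succ, List.cons_append, List.cons.injEq, true_and] at h
      obtain ⟨h1, h2⟩ := ih h
      exact ⟨by rw [h1], h2⟩

theorem RawPort.encode_append_inj {p p' : RawPort} {X X' : List Symbol}
    (hX : X.head? ≠ some .tick) (hX' : X'.head? ≠ some .tick)
    (h : p.encode ++ X = p'.encode ++ X') : p = p' ∧ X = X' := by
  cases p <;> cases p' <;>
    simp only [RawPort.encode, List.cons_append, List.cons.injEq, reduceCtorEq, false_and,
      Symbol.fromGate.injEq, true_and] at h
  · obtain ⟨rfl, h2⟩ := replicate_append_inj hX hX' h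
    exact ⟨rfl, h2⟩
  · obtain ⟨rfl, h⟩ := h
    obtain ⟨rfl, h2⟩ := replicate_append_inj hX hX' h
    exact ⟨rfl, h2⟩

theorem Kind.symbol_injective : Function.Injective Kind.symbol := by
  intro a b h
  cases a <;> cases b <;> first | rfl | simp [Kind.symbol] at h

theorem head?_flatMap_encode (l : List Item) :
    (l.flatMap Item.encode).head? = l.head?.map fun it => it.kind.symbol := by
  cases l <;> rfl

theorem Kind.symbol_ne (k : Kind) : k.symbol ≠ .tick ∧ k.symbol ≠ .input := by
  cases k <;> simp [Kind.symbol]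

theorem head?_flatMap_encode_ne (l : List Item) :
    (l.flatMap Item.encode).head? ≠ some .tick ∧
      (l.flatMap Item.encode).head? ≠ some .input := by
  rw [head?_flatMap_encode]
  cases l with
  | nil => simp
  | cons it l => simpa using it.kind.symbol_ne

theorem RawPort.head?_encode_ne (p : RawPort) (X : List Symbol) :
    (p.encode ++ X).head? ≠ some .tick := by
  cases p <;> simp [RawPort.encode]

/-- The first symbol of an item gives its kind, the kind gives the number of ports, and each port
ends where the ticks end. -/
theorem flatMap_encode_injective {l l' : List Item} (hl : ∀ it ∈ l, it.WellFormed)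
    (hl' : ∀ it ∈ l', it.WellFormed) (h : l.flatMap Item.encode = l'.flatMap Item.encode) :
    l = l' := by
  induction l generalizing l' with
  | nil =>
    cases l' with
    | nil => rfl
    | cons it l' => simp [Item.encode] at h
  | cons it l ih =>
    cases l' with
    | nil => simp [Item.encode] at h
    | cons it' l' =>
      have hw := hl it (by simp)
      have hw' := hl' it' (by simp)
      obtain ⟨k, p, q⟩ := it
      obtain ⟨k', p', q'⟩ := it'
      simp only [List.flatMap_cons, Item.encode, List.cons_append, List.cons.injEq,
        List.append_assoc] at h
      obtain ⟨h1, h⟩ := h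
      have h2 := Kind.symbol_injective h1
      subst h2
      have hn : ∀ (q : Option RawPort) (l : List Item),
          (q.elim [] RawPort.encode ++ l.flatMap Item.encode).head? ≠ some .tick := by
        intro q l
        cases q with
        | none => exact (head?_flatMap_encode_ne l).1
        | some q => exact RawPort.head?_encode_ne q _
      obtain ⟨rfl, h3⟩ := RawPort.encode_append_inj (hn _ _) (hn _ _) h
      have key : q = q' ∧ l.flatMap Item.encode = l'.flatMap Item.encode := by
        -- Without well-formedness a missing second port could not be told from what follows.
        have hsome : q.isSome = q'.isSome := by
          cases k <;> simp_all [Item.WellFormed]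
        rcases q with _ | q <;> rcases q' with _ | q' <;> simp at hsome
        · exact ⟨rfl, h3⟩
        · obtain ⟨rfl, h2⟩ := RawPort.encode_append_inj (head?_flatMap_encode_ne _).1
            (head?_flatMap_encode_ne _).1 h3
          exact ⟨rfl, h2⟩
      obtain ⟨rfl, h4⟩ := key
      rw [ih (fun it hit => hl it (by simp [hit])) (fun it hit => hl' it (by simp [hit])) h4]

theorem Port.raw_injective {m g : ℕ} : Function.Injective (Port.raw (m := m) (g := g)) := by
  intro p q h
  cases p <;> cases q <;> simp [Port.raw, Fin.ext_iff] at h ⊢ <;> exact h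

theorem Gate.item_injective {m g : ℕ} : Function.Injective (Gate.item (m := m) (g := g)) := by
  intro G G' h
  cases G <;> cases G' <;> simp [Gate.item] at h ⊢ <;>
    first
      | exact ⟨Port.raw_injective h.1, Port.raw_injective h.2⟩
      | exact Port.raw_injective h

/-- The gates end where the first output item begins, so the two lists need no separator. -/
theorem append_inj_of_kind {G O G' O' : List Item} (hG : ∀ it ∈ G, it.kind ≠ .out)
    (hG' : ∀ it ∈ G', it.kind ≠ .out) (hO : ∀ it ∈ O, it.kind = .out)
    (hO' : ∀ it ∈ O', it.kind = .out) (h : G ++ O = G' ++ O') : G = G' ∧ O = O' := by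
  induction G generalizing G' with
  | nil =>
    cases G' with
    | nil => exact ⟨rfl, h⟩
    | cons it G' =>
      exact absurd (hO it (by rw [List.nil_append] at h; simp [h])) (hG' it (by simp))
  | cons it G ih =>
    cases G' with
    | nil =>
      exact absurd (hO' it (by rw [List.nil_append] at h; simp [← h])) (hG it (by simp))
    | cons it' G' =>
      simp only [List.cons_append, List.cons.injEq] at h
      obtain ⟨rfl, h⟩ := h
      obtain ⟨rfl, h2⟩ := ih (fun it hit => hG it (by simp [hit]))
        (fun it hit => hG' it (by simp [hit])) h
      exact ⟨rfl, h2⟩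

/-- The numbers of input variables, gates and outputs are recovered first, which makes the two
circuits comparable; then gates and outputs agree entry by entry, and the remaining fields are
proofs. -/
theorem anyEncode_injective : Function.Injective AnyBoolCircuit.encode := by
  rintro ⟨m, n, C⟩ ⟨m', n', C'⟩ h
  change C.encode = C'.encode at h
  rw [encode_eq, encode_eq, ← List.flatMap_append, ← List.flatMap_append] at h
  obtain ⟨rfl, h1⟩ := replicate_append_inj (head?_flatMap_encode_ne _).2
    (head?_flatMap_encode_ne _).2 h
  have h2 := flatMap_encode_injective (fun _ => C.wellFormed_of_mem)
    (fun _ => C'.wellFormed_of_mem) h1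
  obtain ⟨hG, hO⟩ := append_inj_of_kind (fun _ => C.kind_ne_of_mem)
    (fun _ => C'.kind_ne_of_mem) (fun _ => C.kind_eq_of_mem) (fun _ => C'.kind_eq_of_mem) h2
  have hn : n = n' := by simpa [outItems] using congrArg List.length hO
  subst hn
  have hg : C.gates = C'.gates := by simpa [gateItems] using congrArg List.length hG
  obtain ⟨g, gate, out, h3, h4, h5⟩ := C
  obtain ⟨g', gate', out', h3', h4', h5'⟩ := C'
  change g = g' at hg
  subst hg
  have e1 : gate = gate' := by
    funext j
    exact Gate.item_injective (congrFun (List.ofFn_injective hG) j)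
  have e2 : out = out' := by
    funext i
    have := congrFun (List.ofFn_injective hO) i
    simp only [Port.outItem, Item.mk.injEq, and_true, true_and] at this
    exact Port.raw_injective this
  subst e1 e2
  rfl

theorem length_encode_raw_le {m n : ℕ} (C : BoolCircuit m n) (p : Port m C.gates) :
    p.raw.encode.length ≤ C.size + 1 := by
  have h1 := C.gates_le_size
  have h2 := C.inputs_le_size
  cases p with
  | input k => have := k.2; simp [Port.raw, RawPort.encode]; omega
  | gate j b => have := j.2; simp [Port.raw, RawPort.encode]; omega

theorem length_encode_item_le {m n : ℕ} (C : BoolCircuit m n) {it : Item}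
    (h : it ∈ C.gateItems ++ C.outItems) : it.encode.length ≤ 2 * C.size + 3 := by
  simp only [gateItems, outItems, List.mem_append, List.mem_ofFn] at h
  rcases h with ⟨j, rfl⟩ | ⟨i, rfl⟩
  · cases C.gate j with
    | and a b | or a b =>
      have ha := C.length_encode_raw_le a
      have hb := C.length_encode_raw_le b
      simp [Gate.item, Item.encode]; omega
    | not a | fork a =>
      have ha := C.length_encode_raw_le a
      simp [Gate.item, Item.encode]; omega
  · have ha := C.length_encode_raw_le (C.out i)
    simp [Port.outItem, Item.encode]; omega

theorem length_encode_le {m n : ℕ} (C : BoolCircuit m n) :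
    C.encode.length ≤ 8 * (C.size + 1) ^ 2 := by
  have h1 := C.le_size_outputs
  have h2 := C.gates_le_size
  have h3 := C.inputs_le_size
  have h4 : ((C.gateItems ++ C.outItems).flatMap Item.encode).length ≤
      (C.gateItems ++ C.outItems).length * (2 * C.size + 3) := by
    rw [List.length_flatMap]
    refine (List.sum_le_card_nsmul _ (2 * C.size + 3) ?_).trans (by simp)
    intro k hk
    obtain ⟨it, hit, rfl⟩ := List.mem_map.1 hk
    exact C.length_encode_item_le hit
  rw [List.length_append, G31.length_gateItems, G31.length_outItems] at h4
  rw [encode_eq, List.length_append, ← List.flatMap_append, List.length_replicate]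
  nlinarith

end BoolCircuit

/-! ### The word of a circuit: value, injectivity and bounds -/

namespace G31

open BoolCircuit

variable {d : ℕ} (δ : Fin d → G31) (ρ : ShortRule)

/-- The word for a circuit. -/
def circuitWord (chunk : Prim → List (Gen d)) (k : Fin d) (C : AnyBoolCircuit) : List (Gen d) :=
  emit chunk (prog C.1 C.2.2.gateItems C.2.2.outItems)
    (block k none ++ emitCode k C.encode [])

theorem circuitWord_injective (chunk : Prim → List (Gen d)) (k : Fin d) :
    Function.Injective (circuitWord chunk k) := by
  intro C C' h
  obtain ⟨u, hu⟩ := exists_emit_eq chunk (prog C.1 C.2.2.gateItems C.2.2.outItems)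
    (block k none ++ emitCode k C.encode [])
  obtain ⟨u', hu'⟩ := exists_emit_eq chunk (prog C'.1 C'.2.2.gateItems C'.2.2.outItems)
    (block k none ++ emitCode k C'.encode [])
  rw [circuitWord, circuitWord, hu, hu'] at h
  exact anyEncode_injective (emitCode_injective k h)

theorem evalWord_circuitWord {chunk : Prim → List (Gen d)}
    (h : ∀ p : Prim, evalWord δ ρ (chunk p) = ofTail ⟨p.perm, p.perm_mem⟩) (k : Fin d)
    (C : AnyBoolCircuit) : evalWord δ ρ (circuitWord chunk k C) =
      ofTail (runTail ρ (prog C.1 C.2.2.gateItems C.2.2.outItems)) := by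
  rw [circuitWord, evalWord_emit δ ρ h, evalWord_append, evalWord_block, evalWord_emitCode,
    one_mul, mul_one]

/-- The summand 72 is 64 + 8: eight letters for each of at most 8(|C| + 1)^2 symbols, and eight for
the end marker. -/
theorem length_circuitWord_le {chunk : Prim → List (Gen d)} {K : ℕ} (hK : 1 ≤ K)
    (h : ∀ p, (chunk p).length ≤ K) (k : Fin d) (C : AnyBoolCircuit) :
    (circuitWord chunk k C).length ≤ (1000 * K + 72) * (C.size + 1) ^ 4 := by
  have h1 := length_emit_le hK h (prog C.1 C.2.2.gateItems C.2.2.outItems)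
    (block k none ++ emitCode k C.encode [])
  have h2 : (prog C.1 C.2.2.gateItems C.2.2.outItems).length ≤ 1000 * (C.size + 1) ^ 4 :=
    length_prog_le C.2.2
  have h3 : C.encode.length ≤ 8 * (C.size + 1) ^ 2 := length_encode_le C.2.2
  have h4 : (C.size + 1) ^ 2 ≤ (C.size + 1) ^ 4 := Nat.pow_le_pow_right (by omega) (by omega)
  have h5 : 1 ≤ (C.size + 1) ^ 4 := Nat.one_le_pow _ _ (by omega)
  rw [List.length_append, length_block, length_emitCode] at h1
  have h6 := Nat.mul_le_mul_left K h2
  rw [circuitWord]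
  nlinarith

theorem test_isLocal {k : ℕ} {i : ℕ} (h : Instr.tau i ∈ test k) : i < k + 9 := by
  have key : ∀ {B : ℕ} {p : List Instr}, (∀ a ∈ p, a.IsLocal B) → B ≤ k + 9 →
      Instr.tau i ∈ p → i < k + 9 := fun h1 h2 h3 => (h1 _ h3).2.trans_le h2
  simp only [test, List.mem_append, List.mem_cons, reduceCtorEq, false_or] at h
  rcases h with h | h | h | h | h | h | h | h
  · exact key (up_isLocal le_rfl) (by omega) h
  · exact key (par_isLocal le_rfl) (by omega) h
  · exact key (up_isLocal le_rfl) (by omega) h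
  · exact key (par_isLocal le_rfl) (by omega) h
  · simpa using List.eq_of_mem_replicate h
  · exact key (down_isLocal le_rfl) (by omega) h
  · exact key (par_isLocal le_rfl) (by omega) h
  · exact key (down_isLocal le_rfl) (by omega) h

theorem tau_mem_prog {m n : ℕ} (C : BoolCircuit m n) {i : ℕ}
    (h : Instr.tau i ∈ prog m C.gateItems C.outItems) : i + 1 ≤ 9 * (C.size + 1) ^ 2 := by
  have h1 := C.inputs_le_size
  have h2 := C.inputPos_le
  simp only [prog, List.mem_append, List.mem_cons, reduceCtorEq, false_or, List.not_mem_nil,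
    or_false] at h
  rcases h with h | h
  · simp only [tests, List.mem_flatMap, List.mem_range] at h
    obtain ⟨k, hk, h⟩ := h
    have := test_isLocal h
    nlinarith
  · rcases mem_circuitProg C h with h | h | h
    · simp at h
    · simp at h
    · have := h.2
      omega

theorem tau_mem_circuitWord {chunk : Prim → List (Gen d)} (h : ∀ p i, Gen.tau i ∉ chunk p)
    (k : Fin d) (C : AnyBoolCircuit) {i : ℕ} (hi : Gen.tau i ∈ circuitWord chunk k C) :
    i + 1 ≤ 9 * (C.size + 1) ^ 2 := by
  rcases mem_emit hi with h1 | ⟨a, ha, h1⟩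
  · rcases List.mem_append.1 h1 with h1 | h1
    · exact absurd h1 (tau_notMem_block k _ i)
    · exact absurd h1 (tau_notMem_emitCode k _ i)
  · cases a with
    | prim p => exact absurd h1 (h p i)
    | tau j =>
      have : i = j := by simpa [Instr.letters] using h1
      subst this
      exact tau_mem_prog C.2.2 ha

/-- Converts estimates in |C| + 1 into the required shape with one constant as factor and as
summand; this form also covers size 0. -/
theorem pow_succ_le (s k : ℕ) : (s + 1) ^ k ≤ 2 ^ k * s ^ k + 2 ^ k := by
  rcases Nat.eq_zero_or_pos s with rfl | h
  · simp only [zero_add, one_pow]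
    have := Nat.one_le_two_pow (n := k)
    omega
  · calc (s + 1) ^ k ≤ (2 * s) ^ k := Nat.pow_le_pow_left (by omega) k
      _ = 2 ^ k * s ^ k := by rw [mul_pow]
      _ ≤ _ := Nat.le_add_right _ _

theorem exists_chunk (hδ : Subgroup.closure (Set.range δ) = ⊤) :
    ∃ chunk : Prim → List (Gen d),
      (∀ p : Prim, evalWord δ ρ (chunk p) = ofTail ⟨p.perm, p.perm_mem⟩) ∧
        ∀ p i, Gen.tau i ∉ chunk p := by
  choose chunk h1 h2 using fun p : Prim =>
    exists_word δ ρ hδ (ofTail ⟨p.perm, p.perm_mem⟩)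
  exact ⟨chunk, h1, h2⟩

/-- The group is not trivial, as the twist moves the word #; so some generator is available for
writing the code of a circuit. -/
theorem pos_of_closure (hδ : Subgroup.closure (Set.range δ) = ⊤) : 0 < d := by
  rcases Nat.eq_zero_or_pos d with rfl | h
  · exfalso
    have h1 : ofTail ⟨twistPerm, twistPerm_mem⟩ ∈ Subgroup.closure (Set.range δ) :=
      hδ ▸ Subgroup.mem_top _
    rw [Set.range_eq_empty, Subgroup.closure_empty, Subgroup.mem_bot] at h1
    have h2 := map_hash ⟨twistPerm, twistPerm_mem⟩ []
    rw [h1, ← map_one ofTail, map_hash] at h2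
    have h3 : twistPerm [] = [true, true, true] := Equiv.swap_apply_left _ _
    simp [bitsHash, bits, h3] at h2
  · exact h

theorem circuitWord_bounds {chunk : Prim → List (Gen d)} (h : ∀ p i, Gen.tau i ∉ chunk p)
    (k : Fin d) : ∃ c : ℕ, 0 < c ∧ ∀ C : AnyBoolCircuit,
      (circuitWord chunk k C).length < c * C.size ^ 4 + c ∧
        ∀ i : ℕ, Gen.tau i ∈ circuitWord chunk k C → i + 1 ≤ c * C.size ^ 2 + c := by
  -- `Prim` is finite, so the words chosen for its elements have bounded length.
  obtain ⟨K, hK⟩ := (Set.finite_range fun p => (chunk p).length).bddAbove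
  have hK' : ∀ p, (chunk p).length ≤ K + 1 := fun p => (hK ⟨p, rfl⟩).trans (Nat.le_succ K)
  -- The factor 16 is 2^4 from `pow_succ_le`, and the summand 1 makes the inequality strict.
  refine ⟨16 * (1000 * (K + 1) + 72) + 1, by omega, fun C => ⟨?_, fun i hi => ?_⟩⟩
  · have h1 := length_circuitWord_le (Nat.le_add_left 1 K) hK' k C
    have h2 := Nat.mul_le_mul_left (1000 * (K + 1) + 72) (pow_succ_le C.size 4)
    calc _ ≤ _ := h1
      _ ≤ _ := h2
      _ < _ := by norm_num; nlinarith [Nat.zero_le (C.size ^ 4)]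
  · have h1 := tau_mem_circuitWord h k C hi
    have h2 := pow_succ_le C.size 2
    nlinarith [Nat.zero_le (C.size ^ 2), Nat.zero_le (K * C.size ^ 2)]

end G31

/-! ### A structured language for stack machines -/

namespace G31

open BoolCircuit Turing

namespace Machine

/-- The names of the counters. -/
inductive Cn
  | p | q | r | s | u | m | k | g | n | x | h | l | a | b | t | y
  deriving DecidableEq

instance : Fintype Cn :=
  ⟨{.p, .q, .r, .s, .u, .m, .k, .g, .n, .x, .h, .l, .a, .b, .t, .y}, fun c => by cases c <;> decide⟩

inductive Stack
  | inp
  | aux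
  | out
  | cnt (c : Cn)
  deriving DecidableEq, Fintype

instance : Finite Symbol := by
  refine Finite.of_surjective (α := Fin 10)
    (fun i => match i with
      | 0 => .input
      | 1 => .and
      | 2 => .or
      | 3 => .not
      | 4 => .fork
      | 5 => .out
      | 6 => .fromInput
      | 7 => .fromGate false
      | 8 => .fromGate true
      | 9 => .tick) ?_
  rintro (_ | _ | _ | _ | _ | _ | _ | (_ | _) | _)
  exacts [⟨0, rfl⟩, ⟨1, rfl⟩, ⟨2, rfl⟩, ⟨3, rfl⟩, ⟨4, rfl⟩, ⟨5, rfl⟩, ⟨6, rfl⟩, ⟨7, rfl⟩, ⟨8, rfl⟩,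
    ⟨9, rfl⟩]

noncomputable instance : Fintype Symbol := Fintype.ofFinite _

/-- The letters on each of the stacks. A counter is a stack over a single letter. -/
abbrev Letter (d : ℕ) : Stack → Type
  | .inp => Symbol
  | .aux => Symbol
  | .out => GenSymbol d
  | .cnt _ => Unit

/-- The memory of a machine: a register, the input stack, an auxiliary stack, the output stack, and
the counters. -/
structure St (d : ℕ) where
  reg : Option Symbol
  inp : List Symbol
  aux : List Symbol
  out : List (GenSymbol d)
  p : ℕ
  q : ℕ
  r : ℕ
  s : ℕ
  u : ℕ
  m : ℕ
  k : ℕ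
  g : ℕ
  n : ℕ
  x : ℕ
  h : ℕ
  l : ℕ
  a : ℕ
  b : ℕ
  t : ℕ
  y : ℕ

variable {d : ℕ}

namespace St

def get (s : St d) : Cn → ℕ
  | .p => s.p
  | .q => s.q
  | .r => s.r
  | .s => s.s
  | .u => s.u
  | .m => s.m
  | .k => s.k
  | .g => s.g
  | .n => s.n
  | .x => s.x
  | .h => s.h
  | .l => s.l
  | .a => s.a
  | .b => s.b
  | .t => s.t
  | .y => s.y

def set (s : St d) (c : Cn) (v : ℕ) : St d :=
  match c with
  | .p => { s with p := v }
  | .q => { s with q := v }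
  | .r => { s with r := v }
  | .s => { s with s := v }
  | .u => { s with u := v }
  | .m => { s with m := v }
  | .k => { s with k := v }
  | .g => { s with g := v }
  | .n => { s with n := v }
  | .x => { s with x := v }
  | .h => { s with h := v }
  | .l => { s with l := v }
  | .a => { s with a := v }
  | .b => { s with b := v }
  | .t => { s with t := v }
  | .y => { s with y := v }

@[simp] theorem get_set_self (s : St d) (c : Cn) (v : ℕ) : (s.set c v).get c = v := by
  cases c <;> rfl

theorem get_set_ne (s : St d) {c c' : Cn} (h : c' ≠ c) (v : ℕ) : (s.set c v).get c' = s.get c' := by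
  cases c <;> cases c' <;> first | rfl | exact absurd rfl h

@[simp] theorem reg_set (s : St d) (c : Cn) (v : ℕ) : (s.set c v).reg = s.reg := by cases c <;> rfl
@[simp] theorem inp_set (s : St d) (c : Cn) (v : ℕ) : (s.set c v).inp = s.inp := by cases c <;> rfl
@[simp] theorem aux_set (s : St d) (c : Cn) (v : ℕ) : (s.set c v).aux = s.aux := by cases c <;> rfl
@[simp] theorem out_set (s : St d) (c : Cn) (v : ℕ) : (s.set c v).out = s.out := by cases c <;> rfl

def setReg (s : St d) (o : Option Symbol) : St d := { s with reg := o }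

theorem get_setReg (s : St d) (o : Option Symbol) (c : Cn) : (s.setReg o).get c = s.get c := by
  cases c <;> rfl

/-- The contents of the stacks. -/
def stk (s : St d) : ∀ i : Stack, List (Letter d i)
  | .inp => s.inp
  | .aux => s.aux
  | .out => s.out
  | .cnt c => List.replicate (s.get c) ()

end St

/-- The basic operations. -/
inductive Basic (d : ℕ)
  | popInp
  | popAux
  | peekInp
  | pushInp
  | pushAux
  | put (f : Option Symbol → GenSymbol d)
  | inc (c : Cn)
  | pop (c : Cn)
  | clr

namespace Basic

/-- A pop of a counter leaves a tick in the register if the counter was positive, and nothing if it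
was 0; loops test this. The default tick in the push operations serves only to make them total. -/
def exec : Basic d → St d → St d
  | popInp, s => { s with reg := s.inp.head?, inp := s.inp.tail }
  | popAux, s => { s with reg := s.aux.head?, aux := s.aux.tail }
  | peekInp, s => { s with reg := s.inp.head? }
  | pushInp, s => { s with inp := s.reg.getD .tick :: s.inp }
  | pushAux, s => { s with aux := s.reg.getD .tick :: s.aux }
  | put f, s => { s with out := f s.reg :: s.out }
  | inc c, s => s.set c (s.get c + 1)
  | pop c, s =>
    (s.set c (s.get c - 1)).setReg (match s.get c with | 0 => none | _ + 1 => some .tick)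
  | clr, s => { s with reg := none }

def stmt {L : Type} : Basic d → TM2.Stmt (Letter d) L (Option Symbol) →
    TM2.Stmt (Letter d) L (Option Symbol)
  | popInp, S => .pop Stack.inp (fun _ (o : Option Symbol) => o) S
  | popAux, S => .pop Stack.aux (fun _ (o : Option Symbol) => o) S
  | peekInp, S => .peek Stack.inp (fun _ (o : Option Symbol) => o) S
  | pushInp, S => .push Stack.inp (fun o : Option Symbol => o.getD .tick) S
  | pushAux, S => .push Stack.aux (fun o : Option Symbol => o.getD .tick) S
  | put f, S => .push Stack.out f S
  | inc c, S => .push (Stack.cnt c) (fun _ => ()) S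
  | pop c, S => .pop (Stack.cnt c) (fun _ (o : Option Unit) => o.map fun _ => .tick) S
  | clr, S => .load (fun _ => none) S

theorem stepAux_stmt {L : Type} (b : Basic d) (S : TM2.Stmt (Letter d) L (Option Symbol))
    (s : St d) :
    TM2.stepAux (b.stmt S) s.reg s.stk =
      TM2.stepAux S (b.exec s).reg (b.exec s).stk := by
  cases b with
  | inc c =>
    simp only [stmt, exec, TM2.stepAux, St.reg_set]
    congr 1
    funext i
    rcases i with _ | _ | _ | c'
    · simp [St.stk]
    · simp [St.stk]
    · simp [St.stk]
    · by_cases h : c' = c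
      · subst h; simp [St.stk, List.replicate_succ]
      · simp [St.stk, h, St.get_set_ne _ h]
  | pop c =>
    simp only [stmt, exec, TM2.stepAux]
    congr 1
    · simp only [St.stk, St.setReg]; cases s.get c <;> simp [List.replicate_succ]
    · funext i
      rcases i with _ | _ | _ | c'
      · simp [St.stk, St.setReg]
      · simp [St.stk, St.setReg]
      · simp [St.stk, St.setReg]
      · by_cases h : c' = c
        · subst h; simp [St.stk, St.get_setReg]
        · simp [St.stk, h, St.get_setReg, St.get_set_ne _ h]
  | peekInp => rfl
  | clr => rfl
  | _ =>
    simp only [stmt, exec, TM2.stepAux]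
    congr 1
    funext i
    rcases i with _ | _ | _ | c' <;> simp [St.stk, St.get]

end Basic

/-- Executes a list of basic operations. -/
def execAll (l : List (Basic d)) (s : St d) : St d := l.foldl (fun s b => b.exec s) s

theorem stepAux_foldr {L : Type} (l : List (Basic d)) (S : TM2.Stmt (Letter d) L (Option Symbol))
    (s : St d) :
    TM2.stepAux (l.foldr Basic.stmt S) s.reg s.stk =
      TM2.stepAux S (execAll l s).reg (execAll l s).stk := by
  induction l generalizing s with
  | nil => rfl
  | cons b l ih => rw [List.foldr_cons, Basic.stepAux_stmt, ih]; rfl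

inductive Code (d : ℕ)
  | blk (l : List (Basic d))
  | seq (P Q : Code d)
  | ite (c : Option Symbol → Bool) (P Q : Code d)
  /-- Executes `l`, and then stops, unless the register satisfies `c`; in that case it executes `P`
  and starts again. -/
  | loop (l : List (Basic d)) (c : Option Symbol → Bool) (P : Code d)

namespace Code

/-- One label for each point at which control can arrive. The extra label of a branch or a loop is
the one where the register is tested. -/
def Lab : Code d → Type
  | blk _ => Unit
  | seq P Q => P.Lab ⊕ Q.Lab
  | ite _ P Q => Option (P.Lab ⊕ Q.Lab)
  | loop _ _ P => Option P.Lab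

theorem finite_lab : ∀ P : Code d, Finite P.Lab
  | blk _ => inferInstanceAs (Finite Unit)
  | seq P Q =>
    have := P.finite_lab
    have := Q.finite_lab
    inferInstanceAs (Finite (P.Lab ⊕ Q.Lab))
  | ite _ P Q =>
    have := P.finite_lab
    have := Q.finite_lab
    inferInstanceAs (Finite (Option (P.Lab ⊕ Q.Lab)))
  | loop _ _ P =>
    have := P.finite_lab
    inferInstanceAs (Finite (Option P.Lab))

def entry : (P : Code d) → P.Lab
  | blk _ => ()
  | seq P _ => .inl P.entry
  | ite _ _ _ => none
  | loop _ _ _ => none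

/-- The statements of a machine that executes `P` and then proceeds at the label `e`. -/
def comp {L : Type} : (P : Code d) → (P.Lab → L) → L → P.Lab →
    TM2.Stmt (Letter d) L (Option Symbol)
  | blk l, _, e, _ => l.foldr Basic.stmt (.goto fun _ => e)
  | seq P Q, f, _, .inl i => P.comp (fun j => f (.inl j)) (f (.inr Q.entry)) i
  | seq _ Q, f, e, .inr i => Q.comp (fun j => f (.inr j)) e i
  | ite c P Q, f, _, none =>
    .branch c (.goto fun _ => f (some (.inl P.entry))) (.goto fun _ => f (some (.inr Q.entry)))
  | ite _ P _, f, e, some (.inl i) => P.comp (fun j => f (some (.inl j))) e i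
  | ite _ _ Q, f, e, some (.inr i) => Q.comp (fun j => f (some (.inr j))) e i
  | loop l c P, f, e, none =>
    l.foldr Basic.stmt (.branch c (.goto fun _ => f (some P.entry)) (.goto fun _ => e))
  | loop _ _ P, f, _, some i => P.comp (fun j => f (some j)) (f none) i

/-- The number of steps, if each loop is repeated at most `X` times. -/
noncomputable def cost : Code d → Polynomial ℕ
  | blk _ => 1
  | seq P Q => P.cost + Q.cost
  | ite _ P Q => P.cost + Q.cost + 1
  | loop _ _ P => .X * (P.cost + 1) + 1

end Code

/-! ### Execution of structured programs, with time bounds -/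

/-- `t` steps of the machine `M` lead from `a` to `b`. -/
def Reach {L : Type} (M : L → TM2.Stmt (Letter d) L (Option Symbol)) (t : ℕ)
    (a b : TM2.Cfg (Letter d) L (Option Symbol)) : Prop :=
  (flip bind (TM2.step M))^[t] (some a) = some b

theorem Reach.trans {L : Type} {M : L → TM2.Stmt (Letter d) L (Option Symbol)} {t t' : ℕ}
    {a b c : TM2.Cfg (Letter d) L (Option Symbol)} (h : Reach M t a b) (h' : Reach M t' b c) :
    Reach M (t + t') a c := by
  rw [Reach, Nat.add_comm, Function.iterate_add_apply, show _ = _ from h]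
  exact h'

theorem Reach.single {L : Type} {M : L → TM2.Stmt (Letter d) L (Option Symbol)}
    {a b : TM2.Cfg (Letter d) L (Option Symbol)} (h : TM2.step M a = some b) : Reach M 1 a b := h

def cfg {L : Type} (i : L) (s : St d) : TM2.Cfg (Letter d) L (Option Symbol) :=
  ⟨some i, s.reg, s.stk⟩

/-- Every machine that contains the statements of `P` reaches from the entry of `P`, started in the
state `s`, the exit of `P` in the state `s'` after exactly `t` steps. -/
def Exec (P : Code d) (s s' : St d) (t : ℕ) : Prop :=
  ∀ (L : Type) (M : L → TM2.Stmt (Letter d) L (Option Symbol)) (f : P.Lab → L) (e : L),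
    (∀ i, M (f i) = P.comp f e i) → Reach M t (cfg (f P.entry) s) (cfg e s')

/-- `P` leads from `s` to `s'` in a time that is admissible if loops are repeated at most `B`
times. -/
def Runs (B : ℕ) (P : Code d) (s s' : St d) : Prop :=
  ∃ t ≤ P.cost.eval B, Exec P s s' t

/-- `n` repetitions of a loop and the exit from it. -/
def LoopRuns (B : ℕ) (l : List (Basic d)) (c : Option Symbol → Bool) (P : Code d) (n : ℕ)
    (s s' : St d) : Prop :=
  ∃ t ≤ n * (P.cost.eval B + 1) + 1, Exec (.loop l c P) s s' t

section
variable {B : ℕ}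

theorem Runs.blk {l : List (Basic d)} {s s' : St d} (h : execAll l s = s') :
    Runs B (.blk l) s s' := by
  refine ⟨1, by simp [Code.cost], fun L M f e hM => .single ?_⟩
  have := hM ()
  subst h
  simp only [cfg, TM2.step]
  change some (TM2.stepAux (M (f ())) _ _) = _
  rw [this]
  change some (TM2.stepAux (l.foldr Basic.stmt _) _ _) = _
  rw [stepAux_foldr]
  rfl

/-- A machine that contains the statements of the compound contains those of P, with the entry of Q
as exit, and those of Q; `Exec` quantifies over all machines in order to make this restriction
possible. -/
theorem Runs.seq {P Q : Code d} {s s' s'' : St d} (h : Runs B P s s') (h' : Runs B Q s' s'') :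
    Runs B (.seq P Q) s s'' := by
  obtain ⟨t, ht, h⟩ := h
  obtain ⟨t', ht', h'⟩ := h'
  refine ⟨t + t', by simp only [Code.cost, Polynomial.eval_add]; omega, fun L M f e hM => ?_⟩
  exact (h L M (fun j => f (.inl j)) _ fun i => hM (.inl i)).trans
    (h' L M (fun j => f (.inr j)) e fun i => hM (.inr i))

theorem Runs.ite {c : Option Symbol → Bool} {P Q : Code d} {s s' : St d}
    (h : c s.reg = true → Runs B P s s') (h' : c s.reg = false → Runs B Q s s') :
    Runs B (.ite c P Q) s s' := by
  cases hc : c s.reg with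
  | true =>
    obtain ⟨t, ht, h⟩ := h hc
    refine ⟨1 + t, by simp only [Code.cost, Polynomial.eval_add, Polynomial.eval_one]; omega,
      fun L M f e hM => ?_⟩
    refine Reach.trans (.single ?_) (h L M (fun j => f (some (.inl j))) e fun i => hM _)
    change some (TM2.stepAux (M (f none)) _ _) = _
    rw [hM none]
    simp [Code.comp, TM2.stepAux, hc, cfg]
  | false =>
    obtain ⟨t, ht, h⟩ := h' hc
    refine ⟨1 + t, by simp only [Code.cost, Polynomial.eval_add, Polynomial.eval_one]; omega,
      fun L M f e hM => ?_⟩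
    refine Reach.trans (.single ?_) (h L M (fun j => f (some (.inr j))) e fun i => hM _)
    change some (TM2.stepAux (M (f none)) _ _) = _
    rw [hM none]
    simp [Code.comp, TM2.stepAux, hc, cfg]

theorem LoopRuns.zero {l : List (Basic d)} {c : Option Symbol → Bool} {P : Code d} {s s' : St d}
    (h : execAll l s = s') (hc : c s'.reg = false) : LoopRuns B l c P 0 s s' := by
  refine ⟨1, by simp, fun L M f e hM => .single ?_⟩
  subst h
  change some (TM2.stepAux (M (f none)) _ _) = _
  rw [hM none]
  change some (TM2.stepAux (l.foldr Basic.stmt _) _ _) = _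
  rw [stepAux_foldr]
  simp [TM2.stepAux, hc, cfg]

theorem LoopRuns.succ {l : List (Basic d)} {c : Option Symbol → Bool} {P : Code d} {n : ℕ}
    {s s₁ s₂ s' : St d} (h : execAll l s = s₁) (hc : c s₁.reg = true) (h₁ : Runs B P s₁ s₂)
    (h₂ : LoopRuns B l c P n s₂ s') : LoopRuns B l c P (n + 1) s s' := by
  obtain ⟨t, ht, h₁⟩ := h₁
  obtain ⟨t', ht', h₂⟩ := h₂
  refine ⟨1 + t + t', by rw [Nat.succ_mul]; omega, fun L M f e hM => ?_⟩
  refine ((Reach.single ?_).trans (h₁ L M (fun j => f (some j)) (f none) fun i => hM (some i))).trans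
    (h₂ L M f e hM)
  subst h
  change some (TM2.stepAux (M (f none)) _ _) = _
  rw [hM none]
  change some (TM2.stepAux (l.foldr Basic.stmt _) _ _) = _
  rw [stepAux_foldr]
  simp [TM2.stepAux, hc, cfg]

/-- The number of repetitions is counted exactly during an induction, and is compared with B only
here. -/
theorem LoopRuns.runs {l : List (Basic d)} {c : Option Symbol → Bool} {P : Code d} {n : ℕ}
    {s s' : St d} (h : LoopRuns B l c P n s s') (hn : n ≤ B) : Runs B (.loop l c P) s s' := by
  obtain ⟨t, ht, h⟩ := h
  refine ⟨t, ht.trans ?_, h⟩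
  simp only [Code.cost, Polynomial.eval_add, Polynomial.eval_one, Polynomial.eval_mul,
    Polynomial.eval_X]
  gcongr

end

/-- The machine that executes `P` and halts. -/
noncomputable def machine (P : Code d) : TM2ComputableAux Symbol (GenSymbol d) where
  tm :=
    { K := Stack
      k₀ := .inp
      k₁ := .out
      Γ := Letter d
      Λ := Option P.Lab
      main := some P.entry
      ΛFin := have := P.finite_lab; Fintype.ofFinite _
      σ := Option Symbol
      initialState := none
      Γk₀Fin := inferInstanceAs (Fintype Symbol)
      m := fun i => match i with
        | none => .load (fun _ => none) .halt
        | some i => P.comp some none i }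
  inputAlphabet := Equiv.refl _
  outputAlphabet := Equiv.refl _

/-- The initial state with a given input. -/
def St.init (w : List Symbol) : St d := ⟨none, w, [], [], 0, 0, 0, 0, 0, 0, 0, 0, 0, 0, 0, 0, 0, 0, 0, 0⟩

/-- The final state with a given output. -/
def St.final (o : Option Symbol) (w : List (GenSymbol d)) : St d :=
  ⟨o, [], [], w, 0, 0, 0, 0, 0, 0, 0, 0, 0, 0, 0, 0, 0, 0, 0, 0⟩

/-- A halting configuration must have all stacks empty except the output, and the register in its
initial state. The final label resets the register, which costs the one additional step. -/
theorem machine_outputs {B : ℕ} {P : Code d} {v : List Symbol} {w : List (GenSymbol d)}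
    {o : Option Symbol} (h : Runs B P (St.init v) (St.final o w)) {T : ℕ}
    (hT : P.cost.eval B + 1 ≤ T) :
    Nonempty (TM2OutputsInTime (machine P).tm (v.map (machine P).inputAlphabet.symm)
      (some (w.map (machine P).outputAlphabet.symm)) T) := by
  obtain ⟨t, ht, h⟩ := h
  have h := (h (Option P.Lab) (machine P).tm.m some none fun i => rfl).trans
    (.single (b := ⟨none, none, (St.final o w).stk⟩) rfl)
  have e1 : v.map (machine (d := d) P).inputAlphabet.symm = v := List.map_id _
  have e2 : w.map (machine (d := d) P).outputAlphabet.symm = w := List.map_id _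
  rw [e1, e2]
  have i1 : initList (machine P).tm v = cfg (some P.entry) (St.init v) := by
    unfold initList cfg
    congr 1
    funext i
    rcases i with _ | _ | _ | c
    · rfl
    · rfl
    · rfl
    · cases c <;> rfl
  have i2 : haltList (machine P).tm w = ⟨none, none, (St.final o w).stk⟩ := by
    unfold haltList
    congr 1
    funext i
    rcases i with _ | _ | _ | c
    · rfl
    · rfl
    · rfl
    · cases c <;> rfl
  refine ⟨{ steps := t + 1, evals_in_steps := ?_, steps_le_m := (Nat.succ_le_succ ht).trans hT }⟩
  rw [i1]
  exact Eq.trans h (congrArg some i2.symm)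

end Machine

end G31

/-! ### Subroutines that write programs -/

namespace G31

open BoolCircuit

namespace Machine

variable {d : ℕ} {B : ℕ}

/-- Writes a program in front of a string. -/
def emitString (chunk : Prim → List (Gen d)) :
    List Instr → List (GenSymbol d) → List (GenSymbol d)
  | [], o => o
  | a :: I, o => emitString chunk I (encodeWord (a.letters chunk) ++ o)

theorem encodeWord_append (u v : List (Gen d)) :
    encodeWord (u ++ v) = encodeWord u ++ encodeWord v := List.flatMap_append

theorem encodeWord_emit (chunk : Prim → List (Gen d)) (I : List Instr) (w : List (Gen d)) :
    encodeWord (emit chunk I w) = emitString chunk I (encodeWord w) := by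
  induction I generalizing w with
  | nil => rfl
  | cons a I ih => rw [emit, ih, encodeWord_append]; rfl

theorem emitString_append (chunk : Prim → List (Gen d)) (I J : List Instr)
    (o : List (GenSymbol d)) :
    emitString chunk (I ++ J) o = emitString chunk J (emitString chunk I o) := by
  induction I generalizing o with
  | nil => rfl
  | cons a I ih => exact ih _

theorem Runs.cast {P : Code d} {s s' s'' : St d} (h : Runs B P s s') (e : s' = s'') :
    Runs B P s s'' := e ▸ h

theorem LoopRuns.cast {l : List (Basic d)} {c : Option Symbol → Bool} {P : Code d} {n : ℕ}
    {s s' s'' : St d} (h : LoopRuns B l c P n s s') (e : s' = s'') : LoopRuns B l c P n s s'' :=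
  e ▸ h

/-- The states in which the register and the counters for temporary use are empty. -/
def Clean (s : St d) : Prop :=
  s.reg = none ∧ s.p = 0 ∧ s.q = 0 ∧ s.r = 0 ∧ s.s = 0 ∧ s.u = 0

/-- Writes a program in front of the output. -/
def St.write (chunk : Prim → List (Gen d)) (s : St d) (I : List Instr) : St d :=
  { s with out := emitString chunk I s.out }

theorem St.write_write (chunk : Prim → List (Gen d)) (s : St d) (I J : List Instr) :
    (s.write chunk I).write chunk J = s.write chunk (I ++ J) := by
  simp only [St.write, emitString_append]

theorem St.get_write (chunk : Prim → List (Gen d)) (s : St d) (I : List Instr) (c : Cn) :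
    (s.write chunk I).get c = s.get c := by cases c <;> rfl

/-- In the state `s`, whatever the output is, `P` writes the program `J` in front of it. -/
def Writes (B : ℕ) (chunk : Prim → List (Gen d)) (s : St d) (P : Code d) (J : List Instr) : Prop :=
  ∀ I, Runs B P (s.write chunk I) ((s.write chunk I).write chunk J)

/-- Both parts refer to the same state s, because writing changes the output only and `Writes`
allows any program to be written already. -/
theorem Writes.seq {chunk : Prim → List (Gen d)} {P Q : Code d} {s : St d} {I J : List Instr}
    (h : Writes B chunk s P I) (h' : Writes B chunk s Q J) :
    Writes B chunk s (P.seq Q) (I ++ J) := by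
  intro K
  refine ((h K).seq ?_).cast (St.write_write ..)
  rw [St.write_write]
  exact h' _

theorem Writes.runs {chunk : Prim → List (Gen d)} {P : Code d} {s : St d} {J : List Instr}
    (h : Writes B chunk s P J) : Runs B P s (s.write chunk J) := h []

/-- Repeats `P` while the counter `c` can be decreased. -/
def wh (c : Cn) (P : Code d) : Code d := .loop [.pop c] Option.isSome P

theorem wh_zero {c : Cn} {P : Code d} {s : St d} (h : s.get c = 0) :
    LoopRuns B [.pop c] Option.isSome P 0 s (s.setReg none) := by
  refine .zero ?_ rfl
  change (s.set c (s.get c - 1)).setReg _ = _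
  rw [h]
  congr 1
  cases c <;> simp_all [St.get, St.set] <;> cases s <;> simp_all

theorem wh_succ {c : Cn} {P : Code d} {s s₂ s' : St d} {n v : ℕ} (h : s.get c = v + 1)
    (h₁ : Runs B P ((s.set c v).setReg (some .tick)) s₂)
    (h₂ : LoopRuns B [.pop c] Option.isSome P n s₂ s') :
    LoopRuns B [.pop c] Option.isSome P (n + 1) s s' := by
  refine .succ ?_ rfl h₁ h₂
  change (s.set c (s.get c - 1)).setReg _ = _
  rw [h]
  rfl

/-- Puts the given symbols in front of the output. -/
def puts (l : List (Option Symbol → GenSymbol d)) : List (Basic d) := l.reverse.map .put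

theorem execAll_puts (l : List (Option Symbol → GenSymbol d)) (s : St d) :
    execAll (puts l) s = { s with out := l.map (fun f => f s.reg) ++ s.out } := by
  rw [execAll, puts, List.foldl_map, List.foldl_reverse]
  induction l with
  | nil => rfl
  | cons f l ih => rw [List.foldr_cons, ih]; rfl

def putAll (l : List (GenSymbol d)) : List (Basic d) := puts (l.map fun a _ => a)

theorem execAll_putAll (l : List (GenSymbol d)) (s : St d) :
    execAll (putAll l) s = { s with out := l ++ s.out } := by
  rw [putAll, execAll_puts, List.map_map]
  simp [Function.comp_def]

/-- Sets a counter to zero. -/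
def clear (c : Cn) : Code d := wh c (.blk [])

theorem clear_runs {c : Cn} {s : St d} (h : s.get c ≤ B) :
    Runs B (clear c) s ((s.set c 0).setReg none) := by
  refine LoopRuns.runs ?_ h
  generalize hn : s.get c = n
  clear h
  induction n generalizing s with
  | zero =>
    refine (wh_zero hn).cast ?_
    cases c <;> cases s <;> simp_all [St.get, St.set, St.setReg]
  | succ n ih =>
    refine wh_succ hn (.blk rfl) ((ih ?_).cast ?_)
    · rw [execAll, List.foldl_nil, St.get_setReg, St.get_set_self]
    · cases c <;> rfl

/-- Moves the value of the counter `u` to the counter `c`. -/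
def restore (c : Cn) : Code d := wh .u (.blk [.inc c])

theorem restore_runs {c : Cn} (hc : c ≠ .u) {s : St d} (h : s.u ≤ B) :
    Runs B (restore c) s (((s.set c (s.get c + s.u)).set .u 0).setReg none) := by
  refine LoopRuns.runs ?_ h
  generalize hn : s.u = n
  clear h
  induction n generalizing s with
  | zero =>
    refine (wh_zero (c := .u) hn).cast ?_
    cases c <;> cases s <;> simp_all [St.get, St.set, St.setReg]
  | succ n ih =>
    refine wh_succ hn (.blk rfl) ((ih ?_).cast ?_)
    · cases c <;> first | rfl | exact absurd rfl hc
    · cases c <;> first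
        | exact absurd rfl hc
        | simp only [execAll, List.foldl, Basic.exec, St.get, St.set, St.setReg]; congr 1; omega

/-- Adds the value of the counter `c` to the counter `e`. -/
def copy (c e : Cn) : Code d := .seq (wh c (.blk [.inc e, .inc .u])) (restore c)

theorem get_inc_ne (s : St d) {c c' : Cn} (h : c' ≠ c) : ((Basic.inc c).exec s).get c' = s.get c' :=
  s.get_set_ne h _

/-- Comparison counter by counter allows proofs in which the names of the counters are variables. -/
theorem St.ext_get {s s' : St d} (h1 : s.reg = s'.reg) (h2 : s.inp = s'.inp) (h3 : s.aux = s'.aux)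
    (h4 : s.out = s'.out) (h : ∀ c, s.get c = s'.get c) : s = s' := by
  cases s
  cases s'
  obtain rfl := h1
  obtain rfl := h2
  obtain rfl := h3
  obtain rfl := h4
  have := h .p
  have := h .q
  have := h .r
  have := h .s
  have := h .u
  have := h .m
  have := h .k
  have := h .g
  have := h .n
  have := h .x
  have := h .h
  have := h .l
  have := h .a
  have := h .b
  have := h .t
  have := h .y
  simp_all [St.get]

theorem St.get_set (s : St d) (c c' : Cn) (v : ℕ) :
    (s.set c v).get c' = if c' = c then v else s.get c' := by
  split_ifs with h
  · subst h; simp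
  · exact s.get_set_ne h v

/-- A counter can be read only by emptying it. Its value is therefore saved in u and restored from
there; this is why u must be empty and different from both counters. -/
theorem copy_runs {c e : Cn} {s : St d} (hs : Clean s) (h : s.get c ≤ B) (hce : c ≠ e := by decide)
    (hc : c ≠ .u := by decide) (he : e ≠ .u := by decide) :
    Runs B (copy c e) s (s.set e (s.get e + s.get c)) := by
  have key : ∀ (n : ℕ) (s : St d), s.get c = n →
      LoopRuns B [.pop c] Option.isSome (.blk [.inc e, .inc .u]) n s
        ((((s.set e (s.get e + n)).set .u (s.u + n)).set c 0).setReg none) := by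
    intro n
    induction n with
    | zero =>
      intro s hn
      refine (wh_zero hn).cast (St.ext_get rfl (by simp [St.setReg]) (by simp [St.setReg])
        (by simp [St.setReg]) fun i => ?_)
      simp only [St.get_setReg, St.get_set]
      split_ifs <;> simp_all [St.get]
    | succ n ih =>
      intro s hn
      refine wh_succ hn (.blk rfl) ((ih _ ?_).cast (St.ext_get rfl ?_ ?_ ?_ fun i => ?_))
      · rw [execAll, List.foldl_cons, List.foldl_cons, List.foldl_nil, get_inc_ne _ hc,
          get_inc_ne _ hce, St.get_setReg, St.get_set_self]
      · simp [execAll, Basic.exec, St.setReg]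
      · simp [execAll, Basic.exec, St.setReg]
      · simp [execAll, Basic.exec, St.setReg]
      · have e1 : ∀ s : St d, s.u = s.get .u := fun _ => rfl
        simp only [execAll, List.foldl, Basic.exec, St.get_setReg, St.get_set, e1]
        split_ifs <;> simp_all <;> omega
  refine ((key _ s rfl).runs h).seq ((restore_runs hc ?_).cast (St.ext_get ?_ ?_ ?_ ?_ fun i => ?_))
  · change ((((s.set e _).set .u _).set c 0).setReg none).get .u ≤ B
    rw [St.get_setReg, St.get_set_ne _ hc.symm, St.get_set_self, hs.2.2.2.2.2]
    omega
  · simp [St.setReg, hs.1]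
  · simp [St.setReg]
  · simp [St.setReg]
  · simp [St.setReg]
  · have e1 : ∀ s : St d, s.u = s.get .u := fun _ => rfl
    have e2 : s.get .u = 0 := hs.2.2.2.2.2
    simp only [St.get_setReg, St.get_set, e1]
    split_ifs <;> simp_all

/-- Adds the value of the counter `c` and the number `j` to the counter `e`. -/
def load (c e : Cn) (j : ℕ) : Code d := .seq (copy c e) (.blk (List.replicate j (.inc e)))

theorem execAll_replicate_inc (j : ℕ) (e : Cn) (s : St d) :
    execAll (List.replicate j (.inc e)) s = s.set e (s.get e + j) := by
  induction j generalizing s with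
  | zero => cases e <;> rfl
  | succ j ih =>
    change execAll (List.replicate j (.inc e)) ((Basic.inc e).exec s) = _
    rw [ih]
    refine St.ext_get ?_ ?_ ?_ ?_ fun i => ?_ <;> simp only [Basic.exec, St.get_set, St.reg_set,
      St.inp_set, St.aux_set, St.out_set]
    split_ifs with h
    · subst h; omega
    · rfl

theorem load_runs {c e : Cn} {j : ℕ} {s : St d} (hs : Clean s) (h : s.get c ≤ B)
    (hce : c ≠ e := by decide) (hc : c ≠ .u := by decide) (he : e ≠ .u := by decide) :
    Runs B (load c e j) s (s.set e (s.get e + s.get c + j)) := by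
  refine (copy_runs hs h hce hc he).seq (.blk ?_)
  rw [execAll_replicate_inc, St.get_set_self]
  cases e <;> rfl

section
variable (chunk : Prim → List (Gen d))

def putPrim (p : Prim) : Code d := .blk (putAll (encodeWord (chunk p)))

variable {chunk}

theorem putPrim_runs (p : Prim) (s : St d) :
    Runs B (putPrim chunk p) s (s.write chunk [.prim p]) := .blk (execAll_putAll _ _)

theorem putPrim_writes (p : Prim) (s : St d) : Writes B chunk s (putPrim chunk p) [.prim p] :=
  fun _ => putPrim_runs _ _

/-- Writes the transposition with the index `3 + p`. -/
def putTau : Code d :=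
  .seq (wh .p (.blk [.inc .r, .put fun _ => .tick])) <| .seq (wh .r (.blk [.inc .p])) <|
    .blk (putAll [.tau, .tick, .tick, .tick])

/-- The output is a stack, so the ticks are written before the symbol of the transposition, whose
index offset 3 is written together with it. The value of p is saved in r meanwhile. -/
theorem putTau_runs {s : St d} (hr : s.r = 0) (hp : s.p ≤ B) :
    Runs B putTau s ((s.write chunk [.tau (3 + s.p)]).setReg none) := by
  have h1 : ∀ (n : ℕ) (s : St d), s.p = n →
      LoopRuns B [.pop .p] Option.isSome (.blk [.inc .r, .put fun _ => .tick]) n s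
        { s with reg := none, p := 0, r := s.r + n, out := List.replicate n .tick ++ s.out } := by
    intro n
    induction n with
    | zero =>
      intro s hn
      refine (wh_zero (c := .p) hn).cast ?_
      simp only [St.setReg]
      congr 1
    | succ n ih =>
      intro s hn
      refine wh_succ hn (.blk rfl) ((ih _ rfl).cast ?_)
      simp only [execAll, List.foldl, Basic.exec, St.get, St.set, St.setReg]
      congr 1
      · rw [List.replicate_succ', List.append_assoc]; rfl
      · omega
  have h2 : ∀ (n : ℕ) (s : St d), s.r = n →
      LoopRuns B [.pop .r] Option.isSome (.blk [.inc .p]) n s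
        { s with reg := none, r := 0, p := s.p + n } := by
    intro n
    induction n with
    | zero =>
      intro s hn
      refine (wh_zero (c := .r) hn).cast ?_
      simp only [St.setReg]
      congr 1
    | succ n ih =>
      intro s hn
      refine wh_succ hn (.blk rfl) ((ih _ rfl).cast ?_)
      simp only [execAll, List.foldl, Basic.exec, St.get, St.set, St.setReg]
      congr 1
      omega
  refine (((h1 _ s rfl).runs hp).seq ((((h2 _ _ rfl).runs ?_)).seq (.blk rfl))).cast ?_
  · change s.r + s.p ≤ B
    omega
  · rw [execAll_putAll]
    simp only [St.setReg, St.write, hr, emitString, encodeWord, Gen.encode, Instr.letters,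
      List.flatMap_cons, List.flatMap_nil, List.append_nil, List.cons_append, List.nil_append,
      Nat.zero_add]
    congr 1
    rw [Nat.add_comm 3]
    simp only [List.replicate_succ, List.cons_append]

/-- Writes the program that moves the letter at position `p` to the front, and moves the value of
the counter `p` to the counter `q`. -/
def putDown : Code d := wh .p (.seq putTau (.blk [.inc .q]))

theorem putDown_runs {s : St d} (hr : s.r = 0) (hp : s.p ≤ B) :
    Runs B putDown s
      { s.write chunk (down s.p) with reg := none, p := 0, q := s.q + s.p } := by
  refine LoopRuns.runs (n := s.p) ?_ hp
  generalize hn : s.p = n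
  rw [hn] at hp
  induction n generalizing s with
  | zero =>
    refine (wh_zero (c := .p) hn).cast ?_
    simp only [St.setReg]
    congr 1
  | succ n ih =>
    refine wh_succ hn ((putTau_runs (chunk := chunk) (by exact hr) (by change n ≤ B; omega)).seq (.blk rfl))
      ((ih ?_ ?_ ?_).cast ?_)
    · exact hr
    · omega
    · rfl
    · simp only [execAll, List.foldl, Basic.exec, St.get, St.set, St.setReg, St.write, down_succ,
        emitString]
      congr 1
      omega

/-- Writes the program that moves the first letter to position `q`, and moves the value of the
counter `q` to the counter `p`. -/
def putUp : Code d := wh .q (.seq putTau (.blk [.inc .p]))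

theorem putUp_runs {s : St d} (hr : s.r = 0) (hp : s.p = 0) (hq : s.q ≤ B) :
    Runs B putUp s { s.write chunk (up s.q) with reg := none, p := s.q, q := 0 } := by
  refine LoopRuns.runs (n := s.q) ?_ hq
  -- The induction needs a variable start i, since the indices increase while q decreases.
  have key : ∀ (n i : ℕ) (s : St d), s.r = 0 → s.p = i → s.q = n → i + n ≤ B →
      LoopRuns B [.pop .q] Option.isSome (.seq putTau (.blk [.inc .p])) n s
        { s.write chunk ((List.range' i n).map fun j => .tau (3 + j)) with
          reg := none, p := i + n, q := 0 } := by
    intro n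
    induction n with
    | zero =>
      intro i s hr hp hn hB
      refine (wh_zero (c := .q) hn).cast ?_
      simp only [St.setReg, ← hp, ← hn]
      simp only [hn]
      rfl
    | succ n ih =>
      intro i s hr hp hn hB
      refine wh_succ hn ((putTau_runs (chunk := chunk) (by exact hr) ?_).seq (.blk rfl))
        ((ih (i + 1) _ ?_ ?_ ?_ ?_).cast ?_)
      · change s.p ≤ B; omega
      · exact hr
      · change s.p + 1 = i + 1; omega
      · rfl
      · omega
      · simp only [execAll, List.foldl, Basic.exec, St.get, St.set, St.setReg, St.write,
          List.range'_succ, List.map_cons, emitString, hp]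
        congr 1
        omega
  refine (key s.q 0 s hr hp rfl (by omega)).cast ?_
  rw [up, List.range_eq_range', Nat.zero_add]

variable (chunk) in
/-- Writes the access with a gate to position `p`. -/
def putAccess (g : SlotGate) : Code d := .seq putDown <| .seq (putPrim chunk (.gate g)) putUp

theorem putAccess_runs (g : SlotGate) {s : St d} (hr : s.r = 0) (hq : s.q = 0) (hp : s.p ≤ B) :
    Runs B (putAccess chunk g) s ((s.write chunk (access g s.p)).setReg none) := by
  refine ((putDown_runs (chunk := chunk) hr hp).seq ((putPrim_runs _ _).seq
    (putUp_runs (chunk := chunk) ?_ ?_ ?_))).cast ?_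
  · exact hr
  · rfl
  · change s.q + s.p ≤ B; omega
  · simp only [St.write, St.setReg, access, emitString_append, emitString, hq, Nat.zero_add]

/-! #### Programs for the value of a counter -/

variable (c : Cn) (j : ℕ)

def putUpOf : Code d := .seq (load c .q j) <| .seq putUp (clear .p)

theorem putUpOf_runs {s : St d} (hs : Clean s) (h : s.get c + j ≤ B) (hc : c ≠ .q := by decide)
    (hc' : c ≠ .u := by decide) :
    Runs B (putUpOf c j) s (s.write chunk (up (s.get c + j))) := by
  obtain ⟨h0, h1, h2, h3, h4, h5⟩ := hs
  refine ((load_runs ⟨h0, h1, h2, h3, h4, h5⟩ (by omega) hc hc').seq ((putUp_runs (chunk := chunk)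
    (by exact h3) (by exact h1) ?_).seq (clear_runs ?_))).cast ?_
  · change s.q + s.get c + j ≤ B; omega
  · change s.q + s.get c + j ≤ B; omega
  · simp only [St.write, St.setReg, St.set, St.get, h1, h2, h0, Nat.zero_add]

theorem putUpOf_writes {s : St d} (hs : Clean s) (h : s.get c + j ≤ B)
    (hc : c ≠ .q := by decide) (hc' : c ≠ .u := by decide) :
    Writes B chunk s (putUpOf c j) (up (s.get c + j)) := by
  intro I
  have := putUpOf_runs (B := B) (chunk := chunk) c j (s := s.write chunk I) hs
    (by rwa [St.get_write]) hc hc'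
  rwa [St.get_write] at this

def putDownOf : Code d := .seq (load c .p j) <| .seq putDown (clear .q)

theorem putDownOf_runs {s : St d} (hs : Clean s) (h : s.get c + j ≤ B) (hc : c ≠ .p := by decide)
    (hc' : c ≠ .u := by decide) :
    Runs B (putDownOf c j) s (s.write chunk (down (s.get c + j))) := by
  obtain ⟨h0, h1, h2, h3, h4, h5⟩ := hs
  refine ((load_runs ⟨h0, h1, h2, h3, h4, h5⟩ (by omega) hc hc').seq ((putDown_runs (chunk := chunk)
    (by exact h3) ?_).seq (clear_runs ?_))).cast ?_
  · change s.p + s.get c + j ≤ B; omega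
  · change s.q + (s.p + s.get c + j) ≤ B; omega
  · simp only [St.write, St.setReg, St.set, St.get, h1, h2, h0, Nat.zero_add]

theorem putDownOf_writes {s : St d} (hs : Clean s) (h : s.get c + j ≤ B)
    (hc : c ≠ .p := by decide) (hc' : c ≠ .u := by decide) :
    Writes B chunk s (putDownOf c j) (down (s.get c + j)) := by
  intro I
  have := putDownOf_runs (B := B) (chunk := chunk) c j (s := s.write chunk I) hs
    (by rwa [St.get_write]) hc hc'
  rwa [St.get_write] at this

variable (chunk) in
def putAccessOf (g : SlotGate) : Code d :=
  .seq (load c .p 0) <| .seq (putAccess chunk g) (clear .p)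

theorem putAccessOf_runs (g : SlotGate) {s : St d} (hs : Clean s) (h : s.get c ≤ B)
    (hc : c ≠ .p := by decide) (hc' : c ≠ .u := by decide) :
    Runs B (putAccessOf chunk c g) s (s.write chunk (access g (s.get c))) := by
  obtain ⟨h0, h1, h2, h3, h4, h5⟩ := hs
  refine ((load_runs ⟨h0, h1, h2, h3, h4, h5⟩ h hc hc').seq ((putAccess_runs (chunk := chunk) g
    (by exact h3) (by exact h2) ?_).seq (clear_runs ?_))).cast ?_
  · change s.p + s.get c + 0 ≤ B; omega
  · change s.p + s.get c + 0 ≤ B; omega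
  · simp only [St.write, St.setReg, St.set, St.get, h1, h0, Nat.zero_add, Nat.add_zero]

theorem putAccessOf_writes (g : SlotGate) {s : St d} (hs : Clean s) (h : s.get c ≤ B)
    (hc : c ≠ .p := by decide) (hc' : c ≠ .u := by decide) :
    Writes B chunk s (putAccessOf chunk c g) (access g (s.get c)) := by
  intro I
  have := putAccessOf_runs (B := B) (chunk := chunk) c g (s := s.write chunk I) hs
    (by rwa [St.get_write]) hc hc'
  rwa [St.get_write] at this

variable (chunk) in
def putReplicate (p : Prim) : Code d := .seq (load c .s j) (wh .s (putPrim chunk p))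

theorem putReplicate_runs (p : Prim) {s : St d} (hs : Clean s) (h : s.get c + j ≤ B)
    (hc : c ≠ .s := by decide) (hc' : c ≠ .u := by decide) :
    Runs B (putReplicate chunk c j p) s
      (s.write chunk (List.replicate (s.get c + j) (.prim p))) := by
  have key : ∀ (n : ℕ) (s : St d), s.s = n →
      LoopRuns B [.pop .s] Option.isSome (putPrim chunk p) n s
        { s.write chunk (List.replicate n (.prim p)) with reg := none, s := 0 } := by
    intro n
    induction n with
    | zero =>
      intro s hn
      refine (wh_zero (c := .s) hn).cast ?_
      simp only [St.setReg]
      congr 1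
    | succ n ih =>
      intro s hn
      exact wh_succ hn (putPrim_runs _ _) ((ih _ rfl).cast rfl)
  obtain ⟨h0, h1, h2, h3, h4, h5⟩ := hs
  refine ((load_runs ⟨h0, h1, h2, h3, h4, h5⟩ (by omega) hc hc').seq ((key _ _ rfl).runs ?_)).cast ?_
  · change s.s + s.get c + j ≤ B; omega
  · simp only [St.write, St.set, St.get, h4, h0, Nat.zero_add]

theorem putReplicate_writes (p : Prim) {s : St d} (hs : Clean s) (h : s.get c + j ≤ B)
    (hc : c ≠ .s := by decide) (hc' : c ≠ .u := by decide) :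
    Writes B chunk s (putReplicate chunk c j p) (List.replicate (s.get c + j) (.prim p)) := by
  intro I
  have := putReplicate_runs (B := B) (chunk := chunk) c j p (s := s.write chunk I) hs
    (by rwa [St.get_write]) hc hc'
  rwa [St.get_write] at this

variable (chunk) in
def putPar : Code d :=
  .seq (load c .s j) <| .seq (wh .s (.seq (putAccess chunk .load1) (.blk [.inc .p]))) (clear .p)

theorem putPar_runs {s : St d} (hs : Clean s) (h : s.get c + j ≤ B)
    (hc : c ≠ .s := by decide) (hc' : c ≠ .u := by decide) :
    Runs B (putPar chunk c j) s (s.write chunk (par (s.get c + j))) := by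
  -- The counter p is the current position; each access empties it into q and fills it again, so it
  -- only has to be increased.
  have key : ∀ (n i : ℕ) (s : St d), s.r = 0 → s.q = 0 → s.p = i → s.s = n → i + n ≤ B →
      LoopRuns B [.pop .s] Option.isSome (.seq (putAccess chunk .load1) (.blk [.inc .p])) n s
        { s.write chunk ((List.range' i n).flatMap (access .load1)) with
          reg := none, s := 0, p := i + n } := by
    intro n
    induction n with
    | zero =>
      intro i s hr hq hp hn hB
      refine (wh_zero (c := .s) hn).cast ?_
      simp only [St.setReg]
      congr 1
    | succ n ih =>
      intro i s hr hq hp hn hB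
      refine wh_succ hn ((putAccess_runs (chunk := chunk) _ (by exact hr) (by exact hq) ?_).seq (.blk rfl))
        ((ih (i + 1) _ ?_ ?_ ?_ ?_ ?_).cast ?_)
      · change s.p ≤ B; omega
      · exact hr
      · exact hq
      · change s.p + 1 = i + 1; omega
      · rfl
      · omega
      · simp only [execAll, List.foldl, Basic.exec, St.get, St.set, St.setReg, St.write,
          List.range'_succ, List.flatMap_cons, emitString_append, hp]
        congr 1
        omega
  obtain ⟨h0, h1, h2, h3, h4, h5⟩ := hs
  refine ((load_runs ⟨h0, h1, h2, h3, h4, h5⟩ (by omega) hc hc').seq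
    (((key _ 0 _ (by exact h3) (by exact h2) (by exact h1) rfl ?_).runs ?_).seq (clear_runs ?_))).cast ?_
  · change 0 + (s.s + s.get c + j) ≤ B; omega
  · change s.s + s.get c + j ≤ B; omega
  · change 0 + (s.s + s.get c + j) ≤ B; omega
  · simp only [St.write, St.setReg, St.set, St.get, h1, h4, h0, Nat.zero_add, par,
      List.range_eq_range']

theorem putPar_writes {s : St d} (hs : Clean s) (h : s.get c + j ≤ B)
    (hc : c ≠ .s := by decide) (hc' : c ≠ .u := by decide) :
    Writes B chunk s (putPar chunk c j) (par (s.get c + j)) := by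
  intro I
  have := putPar_runs (B := B) (chunk := chunk) c j (s := s.write chunk I) hs
    (by rwa [St.get_write]) hc hc'
  rwa [St.get_write] at this

end

section
variable (chunk : Prim → List (Gen d))

/-- Writes the test for words with `k` letters. -/
def putTest : Code d :=
  .seq (putUpOf .k 1) <| .seq (putPrim chunk .ins) <| .seq (putPar chunk .k 4) <|
  .seq (putPrim chunk (.gate .neg)) <| .seq (putUpOf .k 4) <| .seq (putPrim chunk .ins) <|
  .seq (putPar chunk .k 7) <| .seq (putPrim chunk .flag) <| .seq (putReplicate chunk .k 5 .insOne) <|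
  .seq (putPrim chunk .del) <| .seq (putDownOf .k 4) <| .seq (putPrim chunk (.gate .neg)) <|
  .seq (putPar chunk .k 4) <| .seq (putPrim chunk .del) <| putDownOf .k 1

/-- Writes the tests for words with less than `m` letters. -/
def putTests : Code d := .seq (wh .m (.seq (.blk [.clr]) (.seq (putTest chunk) (.blk [.inc .k])))) (clear .k)

variable {chunk}

theorem putTest_runs {s : St d} (hs : Clean s) (hk : s.k + 7 ≤ B) :
    Runs B (putTest chunk) s (s.write chunk (test s.k)) := by
  have h (j : ℕ) (hj : j ≤ 7) : s.get .k + j ≤ B := by change s.k + j ≤ B; omega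
  exact ((putUpOf_writes .k 1 hs (h _ (by omega))).seq <| (putPrim_writes _ _).seq <|
    (putPar_writes .k 4 hs (h _ (by omega))).seq <| (putPrim_writes _ _).seq <|
    (putUpOf_writes .k 4 hs (h _ (by omega))).seq <| (putPrim_writes _ _).seq <|
    (putPar_writes .k 7 hs (h _ (by omega))).seq <| (putPrim_writes _ _).seq <|
    (putReplicate_writes .k 5 _ hs (h _ (by omega))).seq <| (putPrim_writes _ _).seq <|
    (putDownOf_writes .k 4 hs (h _ (by omega))).seq <| (putPrim_writes _ _).seq <|
    (putPar_writes .k 4 hs (h _ (by omega))).seq <| (putPrim_writes _ _).seq <|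
    putDownOf_writes .k 1 hs (h _ (by omega))).runs

theorem putTests_runs {s : St d} (hs : Clean s) (hk : s.k = 0) (hm : s.m + 7 ≤ B) :
    Runs B (putTests chunk) s { s.write chunk (tests s.m) with m := 0 } := by
  have key : ∀ (n i : ℕ) (s : St d), Clean s → s.k = i → s.m = n → i + n + 7 ≤ B →
      LoopRuns B [.pop .m] Option.isSome
        (.seq (.blk [.clr]) (.seq (putTest chunk) (.blk [.inc .k]))) n s
        { s.write chunk ((List.range' i n).flatMap test) with reg := none, m := 0, k := i + n } := by
    intro n
    induction n with
    | zero =>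
      intro i s hs hk hn hB
      refine (wh_zero (c := .m) hn).cast ?_
      simp only [St.setReg]
      congr 1
    | succ n ih =>
      intro i s hs hk hn hB
      -- The loop test leaves a tick in the register, and `clr` removes it because the subroutines
      -- expect a clean state.
      refine wh_succ hn ((Runs.blk rfl).seq ((putTest_runs (by exact ⟨rfl, hs.2⟩) ?_).seq (.blk rfl)))
        ((ih (i + 1) _ ?_ ?_ ?_ ?_).cast ?_)
      · change s.k + 7 ≤ B; omega
      · exact ⟨rfl, hs.2⟩
      · change s.k + 1 = i + 1; omega
      · rfl
      · omega
      · simp only [execAll, List.foldl, Basic.exec, St.get, St.set, St.setReg, St.write,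
          List.range'_succ, List.flatMap_cons, emitString_append, hk]
        congr 1
        omega
  refine (((key _ 0 _ hs hk rfl (by omega)).runs (by omega)).seq (clear_runs ?_)).cast ?_
  · change 0 + s.m ≤ B; omega
  · simp only [St.write, St.setReg, St.set, tests, List.range_eq_range', hk, hs.1]

end

end Machine

end G31

/-! ### Subroutines that read the items of a circuit -/

namespace G31

open BoolCircuit

namespace Machine

variable {d : ℕ} {B : ℕ}

open Classical in
noncomputable def isSym (σ : Symbol) (o : Option Symbol) : Bool := decide (o = some σ)

theorem isSym_some {σ τ : Symbol} : isSym σ (some τ) = true ↔ τ = σ := by simp [isSym]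

theorem isSym_eq_false {σ : Symbol} {o : Option Symbol} : isSym σ o = false ↔ o ≠ some σ := by
  simp [isSym]

/-- Reads a port, and sets the counter `e` to its position. -/
noncomputable def readPort (e : Cn) : Code d :=
  .seq (.blk [.popInp, .pushAux]) <|
  .seq (.ite (isSym .fromInput) (.seq (.blk [.clr]) (copy .x e)) (.seq (.blk [.clr]) (copy .y e))) <|
  .seq (.loop [.peekInp] (isSym .tick) (.blk [.popInp, .pushAux, .inc e])) (.blk [.clr])

/-- Replaces the contents of the input stack and of the auxiliary stack. -/
def St.tape (s : St d) (inp aux : List Symbol) : St d := { s with inp := inp, aux := aux }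

/-- The loop looks at the next symbol before it removes it, so that the symbol which ends the unary
number stays on the input stack. -/
theorem readTicks_runs {e : Cn} (he : e = .a ∨ e = .b) {X : List Symbol}
    (hX : X.head? ≠ some .tick) (k : ℕ) {s : St d} (hs : s.inp = List.replicate k .tick ++ X) :
    LoopRuns B [.peekInp] (isSym .tick) (.blk [.popInp, .pushAux, .inc e]) k s
      (((s.set e (s.get e + k)).tape X (List.replicate k .tick ++ s.aux)).setReg X.head?) := by
  induction k generalizing s with
  | zero =>
    refine .zero ?_ (isSym_eq_false.2 hX)
    rcases he with rfl | rfl <;> cases s <;> cases hs <;> rfl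
  | succ k ih =>
    have h1 : execAll [.peekInp] s = s.setReg (some .tick) := by
      simp [execAll, Basic.exec, hs, List.replicate_succ, St.setReg]
    refine .succ h1 (isSym_some.2 rfl) (.blk rfl) ((ih ?_).cast ?_)
    · rcases he with rfl | rfl <;>
        simp [execAll, Basic.exec, St.setReg, hs, List.replicate_succ, St.set]
    · rcases he with rfl | rfl <;>
      · simp only [execAll, List.foldl, Basic.exec, St.setReg, hs, List.replicate_succ, St.set,
          St.get, St.tape, List.cons_append, List.head?_cons, Option.getD_some]
        congr 1
        · rw [← List.cons_append, ← List.replicate_succ, List.replicate_succ', List.append_assoc]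
          rfl
        · omega

theorem readPort_runs {e : Cn} (he : e = .a ∨ e = .b) {X : List Symbol}
    (hX : X.head? ≠ some .tick) (P : RawPort) {s : St d} (hs : Clean s) (h0 : s.get e = 0)
    (hi : s.inp = P.encode ++ X) (hP : P.pos s.x s.y ≤ B) :
    Runs B (readPort e) s
      ((s.set e (P.pos s.x s.y)).tape X (P.encode.reverse ++ s.aux)) := by
  have hu : e ≠ .u := by rcases he with rfl | rfl <;> decide
  have hx : Cn.x ≠ e := by rcases he with rfl | rfl <;> decide
  have hy : Cn.y ≠ e := by rcases he with rfl | rfl <;> decide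
  cases P with
  | input k =>
    change s.x + k ≤ B at hP
    refine ((Runs.blk rfl).seq ((Runs.ite (s' := (s.set e s.x).tape (List.replicate k .tick ++ X)
      (.fromInput :: s.aux)) (fun _ => (Runs.blk rfl).seq
        ((copy_runs (by exact ⟨rfl, hs.2⟩) ?_ hx (by decide) hu).cast ?_)) fun h => ?_).seq
      (((readTicks_runs he hX k rfl).runs (by omega)).seq (.blk rfl)))).cast ?_
    · change s.x ≤ B; omega
    · rcases he with rfl | rfl <;>
      · simp only [execAll, List.foldl, Basic.exec, St.set, St.get, St.tape, hi, hs.1] at h0 ⊢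
        rw [h0, Nat.zero_add]
        rfl
    · simp only [execAll, List.foldl, Basic.exec, hi] at h
      exact absurd rfl (isSym_eq_false.1 h)
    · rcases he with rfl | rfl <;>
        simp [execAll, Basic.exec, St.setReg, St.set, St.get, St.tape, hs.1, RawPort.pos,
          RawPort.encode]
  | gate k b =>
    change s.y + k ≤ B at hP
    refine ((Runs.blk rfl).seq ((Runs.ite (s' := (s.set e s.y).tape (List.replicate k .tick ++ X)
      (.fromGate b :: s.aux)) (fun h => ?_) fun _ => (Runs.blk rfl).seq
        ((copy_runs (by exact ⟨rfl, hs.2⟩) ?_ hy (by decide) hu).cast ?_)).seq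
      (((readTicks_runs he hX k rfl).runs (by omega)).seq (.blk rfl)))).cast ?_
    · simp only [execAll, List.foldl, Basic.exec, hi] at h
      exact absurd (isSym_some.1 h) (by simp)
    · change s.y ≤ B; omega
    · rcases he with rfl | rfl <;>
      · simp only [execAll, List.foldl, Basic.exec, St.set, St.get, St.tape, hi, hs.1] at h0 ⊢
        rw [h0, Nat.zero_add]
        rfl
    · rcases he with rfl | rfl <;>
        simp [execAll, Basic.exec, St.setReg, St.set, St.get, St.tape, hs.1, RawPort.pos,
          RawPort.encode]

def binary : Kind → Bool
  | .and => true
  | .or => true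
  | _ => false

/-- The kind alone tells the machine whether a second port has to be read. -/
theorem isSome_snd {it : Item} (h : it.WellFormed) : it.snd.isSome = binary it.kind := by
  obtain ⟨κ, p, q⟩ := it
  cases κ <;> simp_all [Item.WellFormed, binary]

section
variable (chunk : Prim → List (Gen d))

/-- Writes the program for an item whose sources are at the positions `a` and `b`. -/
def putItem (κ : Kind) : Code d :=
  .seq (putAccessOf chunk .a .load1) <| .seq (putAccessOf chunk .b .load2) <|
  .seq (putAccessOf chunk .t (.write κ.op)) <| .seq (putAccessOf chunk .b .load2) <|
  putAccessOf chunk .a .load1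

/-- Reads the ports of an item, and writes the program for it. -/
noncomputable def readItem (κ : Kind) : Code d :=
  .seq (readPort .a) <| .seq (cond (binary κ) (readPort .b) (.blk [])) <|
  .seq (putItem chunk κ) <| .seq (clear .a) <| .seq (clear .b) <| .blk [.inc .t]

variable {chunk}

theorem readItem_runs {it : Item} (hit : it.WellFormed) {X : List Symbol}
    (hX : X.head? ≠ some .tick) {s : St d} (hs : Clean s) (ha : s.a = 0) (hb : s.b = 0)
    (hi : s.inp = it.fst.encode ++ (it.snd.elim [] RawPort.encode ++ X))
    (h1 : it.posFst s.x s.y ≤ B) (h2 : it.posSnd s.x s.y ≤ B) (ht : s.t ≤ B) :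
    Runs B (readItem chunk it.kind) s
      { s.write chunk (itemProg s.x s.y s.t it) with
        inp := X
        aux := (it.fst.encode ++ it.snd.elim [] RawPort.encode).reverse ++ s.aux
        t := s.t + 1 } := by
  have hX' : (it.snd.elim [] RawPort.encode ++ X).head? ≠ some .tick := by
    cases it.snd with
    | none => exact hX
    | some q => exact q.head?_encode_ne X
  have e1 : Runs B (readPort .a) s { s with
      inp := it.snd.elim [] RawPort.encode ++ X
      aux := it.fst.encode.reverse ++ s.aux
      a := it.posFst s.x s.y } := readPort_runs (Or.inl rfl) hX' it.fst hs ha hi h1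
  have e2 : Runs B (cond (binary it.kind) (readPort .b) (.blk [])) { s with
      inp := it.snd.elim [] RawPort.encode ++ X
      aux := it.fst.encode.reverse ++ s.aux
      a := it.posFst s.x s.y } { s with
      inp := X
      aux := (it.fst.encode ++ it.snd.elim [] RawPort.encode).reverse ++ s.aux
      a := it.posFst s.x s.y
      b := it.posSnd s.x s.y } := by
    rw [← isSome_snd hit]
    rw [Item.posSnd] at h2 ⊢
    revert h2
    cases it.snd with
    | none =>
      intro _
      refine .blk ?_
      simp only [execAll, List.foldl]
      congr 1
      simp
    | some q =>
      intro h2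
      refine (readPort_runs (Or.inr rfl) hX q ?_ ?_ (by exact rfl) (by exact h2)).cast ?_
      · exact hs
      · exact hb
      · simp only [St.tape, St.set]
        congr 1
        simp
  have e3 : ∀ s : St d, Clean s → s.a ≤ B → s.b ≤ B → s.t ≤ B →
      Runs B (putItem chunk it.kind) s
        (s.write chunk (access .load1 s.a ++ (access .load2 s.b ++
          (access (.write it.kind.op) s.t ++ (access .load2 s.b ++ access .load1 s.a))))) := by
    intro s hs ha hb ht
    exact ((putAccessOf_writes .a _ hs ha).seq <| (putAccessOf_writes .b _ hs hb).seq <|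
      (putAccessOf_writes .t _ hs ht).seq <| (putAccessOf_writes .b _ hs hb).seq <|
      putAccessOf_writes .a _ hs ha).runs
  refine (e1.seq (e2.seq ((e3 _ ?_ ?_ ?_ ?_).seq ((clear_runs ?_).seq ((clear_runs ?_).seq
    (.blk rfl)))))).cast ?_
  · exact hs
  · exact h1
  · exact h2
  · exact ht
  · exact h1
  · exact h2
  · simp only [execAll, List.foldl, Basic.exec, St.setReg, St.set, St.get, St.write, itemProg, ha,
      hb, hs.1]

variable (chunk) in
/-- Treats an item of one of the given kinds, if its first symbol has been read. -/
noncomputable def dispatch : List Kind → Code d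
  | [] => .blk [.clr]
  | κ :: l => .ite (isSym κ.symbol) (.seq (.blk [.clr]) (readItem chunk κ)) (dispatch l)

theorem dispatch_runs_of_notMem {l : List Kind} {s : St d}
    (h : ∀ κ ∈ l, s.reg ≠ some κ.symbol) : Runs B (dispatch chunk l) s (s.setReg none) := by
  induction l with
  | nil => exact .blk rfl
  | cons κ l ih =>
    refine .ite (fun h' => ?_) fun _ => ih fun κ' h' => h κ' (by simp [h'])
    have := isSym_eq_false.2 (h κ (by simp))
    simp [this] at h'

theorem dispatch_runs_of_mem {l : List Kind} {κ : Kind} (hκ : κ ∈ l) {s s' : St d}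
    (h : s.reg = some κ.symbol) (hr : Runs B (readItem chunk κ) (s.setReg none) s') :
    Runs B (dispatch chunk l) s s' := by
  induction l with
  | nil => simp at hκ
  | cons κ' l ih =>
    refine .ite (fun h' => ?_) fun h' => ih ?_
    · rw [h] at h'
      obtain rfl := Kind.symbol_injective (isSym_some.1 h')
      exact (Runs.blk rfl).seq hr
    · rcases List.mem_cons.1 hκ with rfl | hκ
      · exact absurd h (isSym_eq_false.1 h')
      · exact hκ

variable (chunk) in
/-- Reads the items of the given kinds. -/
noncomputable def readItems (l : List Kind) : Code d :=
  .loop [.popInp] Option.isSome (.seq (.blk [.pushAux]) (dispatch chunk l))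

/-- Symbols that do not start an item of the selected kinds are moved to the auxiliary stack, one
per repetition. In this way a pass for gates ignores outputs, and conversely. -/
theorem readItems_skip {l : List Kind} {n : ℕ} {X A : List Symbol} {s s' : St d}
    (hA : ∀ σ ∈ A, ∀ κ ∈ l, σ ≠ κ.symbol) (hr : s.reg = none) (hi : s.inp = A ++ X)
    (h : LoopRuns B [.popInp] Option.isSome (.seq (.blk [.pushAux]) (dispatch chunk l)) n
      (s.tape X (A.reverse ++ s.aux)) s') :
    LoopRuns B [.popInp] Option.isSome (.seq (.blk [.pushAux]) (dispatch chunk l))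
      (n + A.length) s s' := by
  induction A generalizing s with
  | nil =>
    have e : s.tape X (List.reverse [] ++ s.aux) = s := by cases s; cases hi; rfl
    rwa [e] at h
  | cons σ A ih =>
    have h1 : execAll [.popInp] s = (s.tape (A ++ X) s.aux).setReg (some σ) := by
      simp only [execAll, List.foldl, Basic.exec, hi]; rfl
    refine .succ h1 rfl ((Runs.blk rfl).seq (dispatch_runs_of_notMem ?_))
      (ih (fun τ hτ => hA τ (by simp [hτ])) rfl rfl ?_)
    · intro κ hκ h
      exact hA σ (by simp) κ hκ (Option.some.inj h)
    · refine Eq.mp ?_ h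
      congr 1
      simp [execAll, St.tape, St.setReg, Basic.exec, hr]

/-- One repetition treats a whole item: the first symbol selects the subroutine, which itself
consumes the ports. -/
theorem readItems_items {l : List Kind} {n : ℕ} {X : List Symbol} (hX : X.head? ≠ some .tick)
    {its : List Item} (hits : ∀ it ∈ its, it.WellFormed ∧ it.kind ∈ l) {s s' : St d}
    (hs : Clean s) (ha : s.a = 0) (hb : s.b = 0) (hi : s.inp = its.flatMap Item.encode ++ X)
    (hpos : ∀ it ∈ its, it.posFst s.x s.y ≤ B ∧ it.posSnd s.x s.y ≤ B)
    (ht : s.t + its.length ≤ B)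
    (h : LoopRuns B [.popInp] Option.isSome (.seq (.blk [.pushAux]) (dispatch chunk l)) n
      { s.write chunk (pass s.x s.y s.t its) with
        inp := X
        aux := (its.flatMap Item.encode).reverse ++ s.aux
        t := s.t + its.length } s') :
    LoopRuns B [.popInp] Option.isSome (.seq (.blk [.pushAux]) (dispatch chunk l))
      (n + its.length) s s' := by
  induction its generalizing s with
  | nil =>
    refine Eq.mp ?_ h
    congr 1
    cases s
    cases hi
    rfl
  | cons it its ih =>
    rw [List.length_cons] at ht
    have hX' : (its.flatMap Item.encode ++ X).head? ≠ some .tick := by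
      cases its with
      | nil => exact hX
      | cons it' its => simpa [Item.encode] using it'.kind.symbol_ne.1
    have h1 : execAll [.popInp] s = (s.tape (it.fst.encode ++
        (it.snd.elim [] RawPort.encode ++ (its.flatMap Item.encode ++ X))) s.aux).setReg
          (some it.kind.symbol) := by
      simp [execAll, Basic.exec, hi, Item.encode, St.tape, St.setReg]
    refine .succ h1 rfl ((Runs.blk rfl).seq (dispatch_runs_of_mem (hits it (by simp)).2 rfl
      (readItem_runs (hits it (by simp)).1 hX' ?_ ?_ ?_ ?_ ?_ ?_ ?_)))
      (ih (fun it' h' => hits it' (by simp [h'])) ?_ ?_ ?_ ?_ ?_ ?_ ?_)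
    · exact ⟨rfl, hs.2⟩
    · exact ha
    · exact hb
    · rfl
    · exact (hpos it (by simp)).1
    · exact (hpos it (by simp)).2
    · change s.t ≤ B; omega
    · exact ⟨rfl, hs.2⟩
    · exact ha
    · exact hb
    · rfl
    · exact fun it' h' => hpos it' (by simp [h'])
    · change s.t + 1 + its.length ≤ B; omega
    · refine Eq.mp ?_ h
      congr 1
      simp only [execAll, St.tape, St.setReg, St.write, pass, emitString_append, List.foldl,
        Basic.exec, hs.1]
      congr 1
      · simp [Item.encode]
      · simp only [List.length_cons]; omega

/-- Moves the auxiliary stack back to the input stack. -/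
def rewind : Code d := .loop [.popAux] Option.isSome (.blk [.pushInp])

theorem rewind_runs {s : St d} (hr : s.reg = none) (h : s.aux.length ≤ B) :
    Runs B rewind s (s.tape (s.aux.reverse ++ s.inp) []) := by
  refine LoopRuns.runs (n := s.aux.length) ?_ h
  have key : ∀ (A : List Symbol) (s : St d), s.aux = A →
      LoopRuns B [.popAux] Option.isSome (.blk [.pushInp]) A.length s
        ((s.tape (A.reverse ++ s.inp) []).setReg none) := by
    intro A
    induction A with
    | nil =>
      intro s hA
      refine .zero ?_ rfl
      simp only [execAll, List.foldl, Basic.exec, hA]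
      rfl
    | cons σ A ih =>
      intro s hA
      have h1 : execAll [.popAux] s = (s.tape s.inp A).setReg (some σ) := by
        simp only [execAll, List.foldl, Basic.exec, hA]; rfl
      refine .succ h1 rfl (.blk rfl) ((ih _ rfl).cast ?_)
      simp [execAll, Basic.exec, St.tape, St.setReg]
  refine (key _ _ rfl).cast ?_
  simp only [St.setReg, St.tape, hr]

variable (chunk) in
/-- Writes the programs for all items of the given kinds. -/
noncomputable def putPass (l : List Kind) : Code d :=
  .seq (readItems chunk l) <| .seq rewind <| .seq (clear .t) (clear .y)

/-- The relevant items form one segment of the description, between parts A and Z that are skipped.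
After the pass the description is put back, since it has to be read again for every layer. -/
theorem putPass_runs {l : List Kind} {A Z : List Symbol} {its : List Item}
    (hA : ∀ σ ∈ A, ∀ κ ∈ l, σ ≠ κ.symbol) (hZ : ∀ σ ∈ Z, ∀ κ ∈ l, σ ≠ κ.symbol)
    (hZ' : Z.head? ≠ some .tick) (hits : ∀ it ∈ its, it.WellFormed ∧ it.kind ∈ l) {s : St d}
    (hs : Clean s) (ha : s.a = 0) (hb : s.b = 0) (haux : s.aux = [])
    (hi : s.inp = A ++ (its.flatMap Item.encode ++ Z))
    (hpos : ∀ it ∈ its, it.posFst s.x s.y ≤ B ∧ it.posSnd s.x s.y ≤ B)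
    (ht : s.t + its.length ≤ B) (hy : s.y ≤ B) (hB : s.inp.length ≤ B) :
    Runs B (putPass chunk l) s { s.write chunk (pass s.x s.y s.t its) with t := 0, y := 0 } := by
  -- Every item has at least one symbol, so the number of repetitions is at most the length of the
  -- description.
  have hlen : its.length ≤ (its.flatMap Item.encode).length := by
    rw [List.length_flatMap]
    have : ∀ n ∈ its.map (fun it => (Item.encode it).length), 1 ≤ n := by
      intro n hn
      obtain ⟨it, -, rfl⟩ := List.mem_map.1 hn
      simp [Item.encode]
    simpa using List.length_le_sum_of_one_le _ this
  have hlen' : A.length + ((its.flatMap Item.encode).length + Z.length) ≤ B := by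
    simpa [hi] using hB
  refine (LoopRuns.runs (readItems_skip hA hs.1 hi (readItems_items hZ' hits ?_ ?_ ?_ rfl ?_ ?_
    (readItems_skip hZ ?_ (List.append_nil Z).symm (.zero rfl ?_)))) ?_).seq
    ((rewind_runs ?_ ?_).seq ((clear_runs ?_).seq ((clear_runs ?_).cast ?_)))
  · exact hs
  · exact ha
  · exact hb
  · exact hpos
  · exact ht
  · exact hs.1
  · rfl
  · omega
  · rfl
  · change (Z.reverse ++ ((its.flatMap Item.encode).reverse ++ (A.reverse ++ s.aux))).length ≤ B
    simp only [List.length_append, List.length_reverse, haux, List.length_nil]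
    omega
  · exact ht
  · exact hy
  · simp only [execAll, St.tape, St.setReg, St.set, St.write, List.foldl, Basic.exec, hs.1, haux,
      hi]
    congr 1
    simp

end

end Machine

end G31

/-! ### The machine that computes the words -/

namespace G31

open BoolCircuit

namespace Machine

variable {d : ℕ} {B : ℕ}

section
variable (chunk : Prim → List (Gen d))

/-- Makes room for the output variables. -/
def putRoom : Code d :=
  .seq (copy .n .s) <|
    wh .s (.seq (putPrim chunk .ins) (.blk [.inc .x, .inc .x, .inc .x, .pop .s, .pop .s]))

/-- Makes room for one layer of gates. -/
def putLayer : Code d :=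
  .seq (copy .g .s) (wh .s (.seq (putPrim chunk .ins) (.blk [.inc .x, .inc .x, .inc .x])))

/-- Removes one layer of gates. -/
def removeLayer : Code d :=
  .seq (copy .g .s) (wh .s (.seq (putPrim chunk .del) (.blk [.pop .x, .pop .x, .pop .x])))

variable {chunk}

theorem putRoom_runs {s : St d} (hs : Clean s) (hn : s.n ≤ B) :
    Runs B (putRoom chunk) s { s.write chunk (List.replicate (roomFor s.n) (.prim .ins)) with
      x := s.x + 3 * roomFor s.n } := by
  have key : ∀ (j : ℕ) (s : St d), roomFor s.s = j →
      LoopRuns B [.pop .s] Option.isSome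
        (.seq (putPrim chunk .ins) (.blk [.inc .x, .inc .x, .inc .x, .pop .s, .pop .s])) j s
        { s.write chunk (List.replicate j (.prim .ins)) with
          reg := none, s := 0, x := s.x + 3 * j } := by
    intro j
    induction j with
    | zero =>
      intro s hj
      have hn : s.s = 0 := by unfold roomFor at hj; omega
      refine (wh_zero (c := .s) hn).cast ?_
      simp only [St.setReg]
      congr 1
    | succ j ih =>
      intro s hj
      obtain ⟨v, hv⟩ : ∃ v, s.s = v + 1 := ⟨s.s - 1, by unfold roomFor at hj; omega⟩
      refine wh_succ (c := .s) hv ((putPrim_runs _ _).seq (.blk rfl)) ((ih _ ?_).cast ?_)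
      -- Each repetition takes three units from the counter, one of them in the loop test. Truncated
      -- subtraction at the end produces the rounding up in `roomFor`.
      · change roomFor (v - 1 - 1) = j
        unfold roomFor at hj ⊢
        omega
      · simp only [execAll, List.foldl, Basic.exec, St.get, St.set, St.setReg, St.write,
          List.replicate_succ, emitString]
        congr 1
        omega
  refine ((copy_runs hs hn).seq ((key _ _ rfl).runs ?_)).cast ?_
  · change roomFor (s.s + s.n) ≤ B
    rw [hs.2.2.2.2.1]
    unfold roomFor
    omega
  · simp only [St.write, St.set, St.get, hs.1, hs.2.2.2.2.1, Nat.zero_add]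

theorem putLayer_runs {s : St d} (hs : Clean s) (hg : s.g ≤ B) :
    Runs B (putLayer chunk) s { s.write chunk (List.replicate s.g (.prim .ins)) with
      x := s.x + 3 * s.g } := by
  have key : ∀ (j : ℕ) (s : St d), s.s = j →
      LoopRuns B [.pop .s] Option.isSome
        (.seq (putPrim chunk .ins) (.blk [.inc .x, .inc .x, .inc .x])) j s
        { s.write chunk (List.replicate j (.prim .ins)) with
          reg := none, s := 0, x := s.x + 3 * j } := by
    intro j
    induction j with
    | zero =>
      intro s hj
      refine (wh_zero (c := .s) hj).cast ?_
      simp only [St.setReg]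
      congr 1
    | succ j ih =>
      intro s hj
      refine wh_succ hj ((putPrim_runs _ _).seq (.blk rfl)) ((ih _ rfl).cast ?_)
      simp only [execAll, List.foldl, Basic.exec, St.get, St.set, St.setReg, St.write,
        List.replicate_succ, emitString]
      congr 1
      omega
  refine ((copy_runs hs hg).seq ((key _ _ rfl).runs ?_)).cast ?_
  · change s.s + s.g ≤ B
    rw [hs.2.2.2.2.1]
    omega
  · simp only [St.write, St.set, St.get, hs.1, hs.2.2.2.2.1, Nat.zero_add]

theorem removeLayer_runs {s : St d} (hs : Clean s) (hg : s.g ≤ B) :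
    Runs B (removeLayer chunk) s { s.write chunk (List.replicate s.g (.prim .del)) with
      x := s.x - 3 * s.g } := by
  have key : ∀ (j : ℕ) (s : St d), s.s = j →
      LoopRuns B [.pop .s] Option.isSome
        (.seq (putPrim chunk .del) (.blk [.pop .x, .pop .x, .pop .x])) j s
        { s.write chunk (List.replicate j (.prim .del)) with
          reg := none, s := 0, x := s.x - 3 * j } := by
    intro j
    induction j with
    | zero =>
      intro s hj
      refine (wh_zero (c := .s) hj).cast ?_
      simp only [St.setReg]
      congr 1
    | succ j ih =>
      intro s hj
      refine wh_succ hj ((putPrim_runs _ _).seq (.blk rfl)) ((ih _ rfl).cast ?_)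
      simp only [execAll, List.foldl, Basic.exec, St.get, St.set, St.setReg, St.write,
        List.replicate_succ, emitString]
      congr 1
      omega
  refine ((copy_runs hs hg).seq ((key _ _ rfl).runs ?_)).cast ?_
  · change s.s + s.g ≤ B
    rw [hs.2.2.2.2.1]
    omega
  · simp only [St.write, St.set, St.get, hs.1, hs.2.2.2.2.1, Nat.zero_add]

end

/-! #### Passes through the description of a circuit -/

theorem RawPort.ne_of_mem_encode {p : RawPort} {σ : Symbol} (h : σ ∈ p.encode) (κ : Kind) :
    σ ≠ κ.symbol := by
  cases p <;> simp only [RawPort.encode, List.mem_cons, List.mem_replicate] at h <;>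
    rcases h with rfl | ⟨-, rfl⟩ <;> cases κ <;> simp [Kind.symbol]

/-- The symbols of kinds occur in an item only at its start; this justifies the skipping of items of
other kinds. -/
theorem kind_eq_of_mem_encode {it : Item} {σ : Symbol} {κ : Kind} (h : σ ∈ it.encode)
    (hκ : σ = κ.symbol) : κ = it.kind := by
  simp only [Item.encode, List.mem_cons, List.mem_append] at h
  rcases h with h | h | h
  · exact Kind.symbol_injective (hκ.symm.trans h)
  · exact absurd hκ (RawPort.ne_of_mem_encode h κ)
  · obtain ⟨κ', p, _ | q⟩ := it
    · simp at h
    · exact absurd hκ (RawPort.ne_of_mem_encode h κ)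

section
variable {m n : ℕ} (C : BoolCircuit m n)

/-- The states in which the description of `C` is ready to be read. -/
def Ready (s : St d) : Prop :=
  Clean s ∧ s.inp = C.encode ∧ s.aux = [] ∧ s.a = 0 ∧ s.b = 0 ∧ s.t = 0 ∧ s.y = 0 ∧
    s.g = C.gates ∧ s.n = n

/-- A bound for the length of the description of a circuit and for the positions on the tape. -/
structure Bounds (B : ℕ) : Prop where
  encode : C.encode.length ≤ B
  pos : 3 + inputPos C.gates n C.gates + m ≤ B

theorem Bounds.gates {B : ℕ} (h : Bounds C B) : 1 + 3 * roomFor n + 6 * C.gates ≤ B := by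
  have := h.pos
  unfold inputPos at this
  nlinarith [Nat.zero_le C.gates, Nat.le_mul_self C.gates]

theorem Bounds.outputs {B : ℕ} (h : Bounds C B) : n ≤ B := by
  have := h.gates
  unfold roomFor at this
  omega

variable (chunk : Prim → List (Gen d))

def gateKinds : List Kind := [.and, .or, .not, .fork]

/-- Writes one layer of gates. -/
noncomputable def putGates : Code d :=
  .seq (.blk [.inc .t, .inc .y]) <| .seq (copy .g .y) <| .seq (copy .g .y) <|
    .seq (copy .g .y) (putPass chunk gateKinds)

/-- Writes the output variables. -/
noncomputable def putOuts : Code d :=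
  .seq (copy .x .t) <| .seq (copy .n .s) <| .seq (wh .s (.blk [.pop .t])) <|
    .seq (.blk [.inc .y]) (putPass chunk [.out])

variable {chunk}

theorem mem_gateKinds {κ : Kind} : κ ∈ gateKinds ↔ κ ≠ .out := by
  cases κ <;> simp [gateKinds]

/-- The previous layer starts at 1 + 3g, so g is copied three times to y. The new layer starts at
position 1, which is the value given to t. -/
theorem putGates_runs (hB : Bounds C B) {s : St d} (hs : Ready C s) (hx : s.x + m ≤ B) :
    Runs B (putGates chunk) s (s.write chunk (pass s.x (1 + 3 * C.gates) 1 C.gateItems)) := by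
  obtain ⟨h0, hi, haux, ha, hb, ht, hy, hg, hn⟩ := hs
  have hg' := hB.gates
  have hgB : s.g ≤ B := by omega
  have e1 : Runs B (.blk [.inc .t, .inc .y]) s { s with t := 1, y := 1 } := .blk <| by
    simp only [execAll, List.foldl, Basic.exec, St.get, St.set, ht, hy, Nat.zero_add]
  have e2 (v : ℕ) : Runs B (copy .g .y) { s with t := 1, y := v }
      { s with t := 1, y := v + C.gates } :=
    (copy_runs (s := { s with t := 1, y := v }) h0 hgB).cast <| by
      simp only [St.get, St.set, hg]
  have e3 : Runs B (putPass chunk gateKinds) { s with t := 1, y := 1 + 3 * C.gates }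
      { St.write chunk { s with t := 1, y := 1 + 3 * C.gates }
          (pass s.x (1 + 3 * C.gates) 1 C.gateItems) with t := 0, y := 0 } := by
    refine putPass_runs (A := List.replicate m .input) (Z := C.outItems.flatMap Item.encode)
      (s := { s with t := 1, y := 1 + 3 * C.gates }) ?_ ?_ (head?_flatMap_encode_ne _).1 ?_ h0 ha
      hb haux (hi.trans C.encode_eq) ?_ ?_ ?_ ?_
    · intro σ hσ κ _
      rw [List.eq_of_mem_replicate hσ]
      exact κ.symbol_ne.2.symm
    · intro σ hσ κ hκ h
      obtain ⟨it, hit, hσ⟩ := List.mem_flatMap.1 hσ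
      exact mem_gateKinds.1 hκ ((kind_eq_of_mem_encode hσ h).trans (C.kind_eq_of_mem hit))
    · exact fun it hit => ⟨C.wellFormed_of_mem (List.mem_append_left _ hit),
        mem_gateKinds.2 (C.kind_ne_of_mem hit)⟩
    · intro it hit
      have key : ∀ P, P = it.posFst s.x (1 + 3 * C.gates) ∨
          P = it.posSnd s.x (1 + 3 * C.gates) → P ≤ B := by
        intro P hP
        rcases item_pos_cases C (Or.inl hit) hP with h | ⟨k, hk, h⟩ | ⟨k, hk, h⟩ <;> omega
      exact ⟨key _ (Or.inl rfl), key _ (Or.inr rfl)⟩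
    · rw [length_gateItems]
      change 1 + C.gates ≤ B
      omega
    · change 1 + 3 * C.gates ≤ B
      omega
    · exact hi ▸ hB.encode
  have e4 : Runs B (copy .g .y) { s with t := 1, y := 1 + C.gates + C.gates }
      { s with t := 1, y := 1 + 3 * C.gates } := (e2 _).cast <| by
    congr 1
    omega
  refine (e1.seq ((e2 _).seq ((e2 _).seq (e4.seq e3)))).cast ?_
  simp only [St.write, ht, hy]

theorem putOuts_runs (hB : Bounds C B) {s : St d} (hs : Ready C s) (hx : s.x + m ≤ B)
    (hxn : n ≤ s.x) :
    Runs B (putOuts chunk) s (s.write chunk (pass s.x 1 (s.x - n) C.outItems)) := by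
  obtain ⟨h0, hi, haux, ha, hb, ht, hy, hg, hn⟩ := hs
  have hg' := hB.gates
  have hn' := hB.outputs
  -- The outputs end where the input variables begin: t starts at x and is decreased n times.
  have key : ∀ (j : ℕ) (s : St d), s.s = j →
      LoopRuns B [.pop .s] Option.isSome (.blk [.pop .t]) j s
        { s with reg := none, s := 0, t := s.t - j } := by
    intro j
    induction j with
    | zero =>
      intro s hj
      refine (wh_zero (c := .s) hj).cast ?_
      simp only [St.setReg]
      congr 1
    | succ j ih =>
      intro s hj
      refine wh_succ hj (.blk rfl) ((ih _ rfl).cast ?_)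
      simp only [execAll, List.foldl, Basic.exec, St.get, St.set, St.setReg]
      congr 1
      omega
  have hs0 : s.s = 0 := h0.2.2.2.2.1
  have e1 : Runs B (copy .x .t) s { s with t := s.x } :=
    (copy_runs h0 (by exact (Nat.le_add_right _ _).trans hx)).cast <| by
      simp only [St.get, St.set, ht, Nat.zero_add]
  have e2 : Runs B (copy .n .s) { s with t := s.x } { s with t := s.x, s := n } :=
    (copy_runs (s := { s with t := s.x }) h0 (by exact hn.trans_le hn')).cast <| by
      simp only [St.get, St.set, hn, hs0, Nat.zero_add]
  have e3 : Runs B (.blk [.inc .y])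
      { s with reg := none, s := 0, t := s.x - n } { s with t := s.x - n, y := 1 } := .blk <| by
    simp only [execAll, List.foldl, Basic.exec, St.get, St.set, hy, hs0, h0.1, Nat.zero_add]
  have e4 : Runs B (putPass chunk [.out]) { s with t := s.x - n, y := 1 }
      { St.write chunk { s with t := s.x - n, y := 1 } (pass s.x 1 (s.x - n) C.outItems) with
        t := 0, y := 0 } := by
    refine putPass_runs (A := List.replicate m .input ++ C.gateItems.flatMap Item.encode) (Z := [])
      (s := { s with t := s.x - n, y := 1 }) ?_ (by simp) (by simp) ?_ h0 ha hb haux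
      (hi.trans (C.encode_eq.trans (by simp))) ?_ ?_ ?_ ?_
    · intro σ hσ κ hκ
      rw [List.mem_append] at hσ
      obtain rfl := List.mem_singleton.1 hκ
      rcases hσ with hσ | hσ
      · rw [List.eq_of_mem_replicate hσ]
        exact (Kind.symbol_ne _).2.symm
      · intro h
        obtain ⟨it, hit, hσ⟩ := List.mem_flatMap.1 hσ
        exact C.kind_ne_of_mem hit (kind_eq_of_mem_encode hσ h).symm
    · exact fun it hit => ⟨C.wellFormed_of_mem (List.mem_append_right _ hit),
        List.mem_singleton.2 (C.kind_eq_of_mem hit)⟩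
    · intro it hit
      have key : ∀ P, P = it.posFst s.x 1 ∨ P = it.posSnd s.x 1 → P ≤ B := by
        intro P hP
        rcases item_pos_cases C (Or.inr hit) hP with h | ⟨k, hk, h⟩ | ⟨k, hk, h⟩ <;> omega
      exact ⟨key _ (Or.inl rfl), key _ (Or.inr rfl)⟩
    · rw [length_outItems]
      change s.x - n + n ≤ B
      omega
    · change 1 ≤ B
      omega
    · exact hi ▸ hB.encode
  refine (e1.seq (e2.seq (((key n { s with t := s.x, s := n } rfl).runs hn').seq
    (e3.seq e4)))).cast ?_
  simp only [St.write, ht, hy]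

variable (chunk) in
/-- Writes the program that computes the circuit. -/
noncomputable def putCircuit : Code d :=
  .seq (putRoom chunk) <| .seq (putLayer chunk) <| .seq (copy .g .h) <|
  .seq (wh .h (.seq (.blk [.clr]) <| .seq (putLayer chunk) <| .seq (putGates chunk)
    (.blk [.inc .l]))) <|
  .seq (putOuts chunk) <|
  .seq (wh .l (.seq (.blk [.clr]) <| .seq (putGates chunk) (removeLayer chunk))) <|
  removeLayer chunk

/-- `ups` grows at its end, so the induction on the remaining rounds j carries the number i of the
finished ones. The counter l records them for the way down. -/
theorem putUps_runs (hB : Bounds C B) (x : ℕ) (j i : ℕ) (o : List (GenSymbol d)) {s : St d}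
    (hs : Ready C s) (hx : s.x = x + 3 * C.gates * i)
    (hxB : x + 3 * C.gates * (i + j) + m ≤ B) (hh : s.h = j) (hl : s.l = i)
    (ho : s.out = emitString chunk (ups C.gateItems x i) o) :
    LoopRuns B [.pop .h] Option.isSome (.seq (.blk [.clr]) <| .seq (putLayer chunk) <|
      .seq (putGates chunk) (.blk [.inc .l])) j s
      { s with
        reg := none, h := 0, l := i + j, x := x + 3 * C.gates * (i + j)
        out := emitString chunk (ups C.gateItems x (i + j)) o } := by
  induction j generalizing i s with
  | zero =>
    refine (wh_zero (c := .h) hh).cast ?_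
    simp only [St.setReg]
    congr 1
  | succ j ih =>
    have hg : s.g = C.gates := hs.2.2.2.2.2.2.2.1
    have hg' := hB.gates
    have e : s.x + 3 * s.g = x + 3 * C.gates * (i + 1) := by rw [hx, hg]; ring
    have hle : 3 * C.gates * (i + 1) ≤ 3 * C.gates * (i + (j + 1)) :=
      Nat.mul_le_mul_left _ (by omega)
    refine wh_succ hh ((Runs.blk rfl).seq ((putLayer_runs (by exact ⟨rfl, hs.1.2⟩) ?_).seq
      ((putGates_runs C hB (by exact ⟨⟨rfl, hs.1.2⟩, hs.2⟩) ?_).seq (.blk rfl))))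
      ((ih (i + 1) ?_ ?_ ?_ ?_ ?_ ?_).cast ?_)
    · change s.g ≤ B
      omega
    · change s.x + 3 * s.g + m ≤ B
      omega
    · exact ⟨⟨rfl, hs.1.2⟩, hs.2⟩
    · exact e
    · rw [show i + 1 + j = i + (j + 1) by omega]
      exact hxB
    · rfl
    · change s.l + 1 = i + 1
      rw [hl]
    · simp only [execAll, List.foldl, Basic.exec, St.get, St.set, St.setReg, St.write, ups,
        emitString_append, ho, length_gateItems]
      rw [e, hg]
    · simp only [execAll, List.foldl, Basic.exec, St.get, St.set, St.setReg, St.write,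
        show i + 1 + j = i + (j + 1) by omega]

/-- Here the program is unfolded from its beginning, the highest layer first, and x follows the
removal of layers. -/
theorem putDowns_runs (hB : Bounds C B) (x : ℕ) (j : ℕ) {s : St d}
    (hs : Ready C s) (hx : s.x = x + 3 * C.gates * j)
    (hxB : x + 3 * C.gates * j + m ≤ B) (hl : s.l = j) :
    LoopRuns B [.pop .l] Option.isSome (.seq (.blk [.clr]) <| .seq (putGates chunk)
      (removeLayer chunk)) j s
      { s.write chunk (downs C.gateItems x j) with reg := none, l := 0, x := x } := by
  induction j generalizing s with
  | zero =>
    refine (wh_zero (c := .l) hl).cast ?_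
    simp only [St.setReg]
    congr 1
  | succ j ih =>
    have hg : s.g = C.gates := hs.2.2.2.2.2.2.2.1
    have hg' := hB.gates
    have e : s.x - 3 * s.g = x + 3 * C.gates * j := by
      rw [hx, hg, Nat.mul_succ, ← Nat.add_assoc, Nat.add_sub_cancel]
    refine wh_succ hl ((Runs.blk rfl).seq ((putGates_runs C hB
      (by exact ⟨⟨rfl, hs.1.2⟩, hs.2⟩) ?_).seq (removeLayer_runs (by exact ⟨rfl, hs.1.2⟩) ?_)))
      ((ih ?_ ?_ ?_ ?_).cast ?_)
    · change s.x + m ≤ B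
      omega
    · change s.g ≤ B
      omega
    · exact ⟨⟨rfl, hs.1.2⟩, hs.2⟩
    · exact e
    · have : 3 * C.gates * j ≤ 3 * C.gates * (j + 1) := Nat.mul_le_mul_left _ (by omega)
      omega
    · rfl
    · simp only [execAll, List.foldl, Basic.exec, St.set, St.setReg, St.write, downs,
        emitString_append, hx, hg, length_gateItems]

theorem putCircuit_runs (hB : Bounds C B) {s : St d} (hs : Ready C s) (hx : s.x = 1)
    (hh : s.h = 0) (hl : s.l = 0) :
    Runs B (putCircuit chunk) s { s.write chunk (circuitProg C.gateItems C.outItems) with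
      x := 1 + 3 * roomFor n } := by
  have hg : s.g = C.gates := hs.2.2.2.2.2.2.2.1
  have hn : s.n = n := hs.2.2.2.2.2.2.2.2
  have hg' := hB.gates
  have hn' := hB.outputs
  have hp := hB.pos
  have hx0 : s.x + 3 * roomFor s.n + 3 * s.g = inputPos C.gates n 0 := by
    rw [hx, hg, hn]; unfold inputPos; ring
  have hxg : inputPos C.gates n 0 + 3 * C.gates * C.gates = inputPos C.gates n C.gates := by
    unfold inputPos; ring
  have hnx : n ≤ inputPos C.gates n C.gates := by unfold inputPos roomFor; omega
  have hrem : inputPos C.gates n 0 - 3 * C.gates = 1 + 3 * roomFor n := by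
    unfold inputPos; omega
  refine ((putRoom_runs hs.1 (by omega)).seq ((putLayer_runs (by exact hs.1) ?_).seq
    ((copy_runs (by exact hs.1) ?_).seq (((putUps_runs C hB (inputPos C.gates n 0) C.gates 0 _
      (by exact hs) (by exact hx0) ?_ ?_ ?_ (by exact rfl)).runs ?_).seq
    ((putOuts_runs C hB (by exact ⟨⟨rfl, hs.1.2⟩, hs.2⟩) ?_ ?_).seq
    (((putDowns_runs C hB (inputPos C.gates n 0) C.gates (by exact ⟨⟨rfl, hs.1.2⟩, hs.2⟩) ?_ ?_
      ?_).runs ?_).seq (removeLayer_runs (by exact ⟨rfl, hs.1.2⟩) ?_))))))).cast ?_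
  · change s.g ≤ B; omega
  · change s.g ≤ B; omega
  · rw [Nat.zero_add]; omega
  · change s.h + s.g = C.gates; omega
  · exact hl
  · omega
  · change inputPos C.gates n 0 + 3 * C.gates * (0 + C.gates) + m ≤ B
    rw [Nat.zero_add]; omega
  · change n ≤ inputPos C.gates n 0 + 3 * C.gates * (0 + C.gates)
    rw [Nat.zero_add]; omega
  · change inputPos C.gates n 0 + 3 * C.gates * (0 + C.gates) = _
    rw [Nat.zero_add]
  · omega
  · change 0 + C.gates = C.gates
    rw [Nat.zero_add]
  · omega
  · change s.g ≤ B; omega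
  · simp only [St.get, St.set, St.write, circuitProg, emitString_append, hg, hn, hh, hl,
      Nat.zero_add, hxg, hrem, length_gateItems, length_outItems, hs.1.1]

end

end Machine

end G31

/-! #### The whole machine -/

namespace G31

open BoolCircuit

namespace Machine

variable {d : ℕ} {B : ℕ}

/-- The functions that describe the block of the symbol in the register. -/
def blockSymbols (k : Fin d) : List (Option Symbol → GenSymbol d) :=
  [fun o => cond (symbolCode o).1 (.pos k) (.neg k),
    fun o => cond (symbolCode o).1 (.neg k) (.pos k),
    fun o => cond (symbolCode o).2.1 (.pos k) (.neg k),
    fun o => cond (symbolCode o).2.1 (.neg k) (.pos k),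
    fun o => cond (symbolCode o).2.2.1 (.pos k) (.neg k),
    fun o => cond (symbolCode o).2.2.1 (.neg k) (.pos k),
    fun o => cond (symbolCode o).2.2.2 (.pos k) (.neg k),
    fun o => cond (symbolCode o).2.2.2 (.neg k) (.pos k)]

theorem map_blockSymbols (k : Fin d) (o : Option Symbol) :
    (blockSymbols k).map (fun f => f o) = encodeWord (block k o) := by
  have e : ∀ b : Bool, encodeWord (bitLetters k b) =
      [cond b (.pos k) (.neg k), cond b (.neg k) (.pos k)] := by
    intro b; cases b <;> rfl
  simp only [block, encodeWord_append, e]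
  rfl

/-- Writes the code of the input, and moves the input to the auxiliary stack. -/
def putCode (k : Fin d) : Code d :=
  .seq (.loop [.popInp] Option.isSome (.blk (.pushAux :: puts (blockSymbols k))))
    (.blk (puts (blockSymbols k)))

theorem putCode_runs (k : Fin d) (w : List (Gen d)) {s : St d} (hs : s.reg = none)
    (ho : s.out = encodeWord w) (hB : s.inp.length ≤ B) :
    Runs B (putCode k) s { s with
      inp := []
      aux := s.inp.reverse ++ s.aux
      out := encodeWord (block k none ++ emitCode k s.inp w) } := by
  have key : ∀ (A : List Symbol) (w : List (Gen d)) (s : St d), s.inp = A →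
      s.out = encodeWord w →
      LoopRuns B [.popInp] Option.isSome (.blk (.pushAux :: puts (blockSymbols k))) A.length s
        { s with
          reg := none, inp := [], aux := A.reverse ++ s.aux
          out := encodeWord (emitCode k A w) } := by
    intro A
    induction A with
    | nil =>
      intro w s hi ho
      refine .zero ?_ rfl
      simp only [execAll, List.foldl, Basic.exec, hi, ho]
      rfl
    | cons σ A ih =>
      intro w s hi ho
      have h1 : execAll [.popInp] s = (s.tape A s.aux).setReg (some σ) := by
        simp only [execAll, List.foldl, Basic.exec, hi]; rfl
      have h2 : execAll (.pushAux :: puts (blockSymbols k)) ((s.tape A s.aux).setReg (some σ)) =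
          { s with
            reg := some σ, inp := A, aux := σ :: s.aux
            out := encodeWord (block k (some σ) ++ w) } := by
        change execAll (puts (blockSymbols k)) _ = _
        rw [execAll_puts, map_blockSymbols, encodeWord_append, ← ho]
        rfl
      refine .succ h1 rfl (.blk h2) ((ih _ _ rfl rfl).cast ?_)
      simp [emitCode]
  refine (((key _ w s rfl ho).runs hB).seq (.blk rfl)).cast ?_
  rw [execAll_puts, map_blockSymbols, encodeWord_append, hs]

def isOut : Symbol → Bool
  | .out => true
  | _ => false

def isInput : Symbol → Bool
  | .input => true
  | _ => false

def isGate : Symbol → Bool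
  | .and => true
  | .or => true
  | .not => true
  | .fork => true
  | _ => false

/-- Moves the auxiliary stack back to the input stack, and counts input variables, gates, and
output variables. -/
def countItems : Code d :=
  .loop [.popAux] Option.isSome <| .seq (.blk [.pushInp]) <|
    .seq (.ite (fun o => o.elim false isInput) (.blk [.inc .m]) (.blk [])) <|
    .seq (.ite (fun o => o.elim false isGate) (.blk [.inc .g]) (.blk [])) <|
    .ite (fun o => o.elim false isOut) (.blk [.inc .n]) (.blk [])

theorem ite_inc_runs {f : Symbol → Bool} {c : Cn} {σ : Symbol} {s : St d} (hσ : s.reg = some σ) :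
    Runs B (.ite (fun o => o.elim false f) (.blk [.inc c]) (.blk [])) s
      (s.set c (s.get c + [σ].countP f)) := by
  refine .ite (fun h => .blk ?_) fun h => .blk ?_ <;>
  · rw [hσ] at h
    change f σ = _ at h
    rw [List.countP_singleton, h]
    cases c <;> rfl

theorem countItems_runs {s : St d} (hs : s.reg = none) (hB : s.aux.length ≤ B) :
    Runs B countItems s { s with
      inp := s.aux.reverse ++ s.inp
      aux := []
      m := s.m + s.aux.countP isInput
      g := s.g + s.aux.countP isGate
      n := s.n + s.aux.countP isOut } := by
  refine LoopRuns.runs (n := s.aux.length) ?_ hB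
  have key : ∀ (A : List Symbol) (s : St d), s.aux = A →
      LoopRuns B [.popAux] Option.isSome (.seq (.blk [.pushInp]) <|
        .seq (.ite (fun o => o.elim false isInput) (.blk [.inc .m]) (.blk [])) <|
        .seq (.ite (fun o => o.elim false isGate) (.blk [.inc .g]) (.blk [])) <|
        .ite (fun o => o.elim false isOut) (.blk [.inc .n]) (.blk [])) A.length s
        { s with
          reg := none
          inp := A.reverse ++ s.inp
          aux := []
          m := s.m + A.countP isInput
          g := s.g + A.countP isGate
          n := s.n + A.countP isOut } := by
    intro A
    induction A with
    | nil =>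
      intro s hA
      refine .zero ?_ rfl
      simp only [execAll, List.foldl, Basic.exec, hA]
      rfl
    | cons σ A ih =>
      intro s hA
      have h1 : execAll [.popAux] s = (s.tape s.inp A).setReg (some σ) := by
        simp only [execAll, List.foldl, Basic.exec, hA]; rfl
      refine .succ h1 rfl ((Runs.blk rfl).seq ((ite_inc_runs (σ := σ) (by rfl)).seq
        ((ite_inc_runs (σ := σ) (by rfl)).seq (ite_inc_runs (σ := σ) (by rfl))))) ((ih _ rfl).cast ?_)
      simp only [execAll, St.tape, St.setReg, St.set, St.get, List.foldl, Basic.exec]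
      congr 1
      · simp
      all_goals
        rw [← List.singleton_append (l := A), List.countP_append, Nat.add_assoc]
  refine (key _ _ rfl).cast ?_
  rw [hs]

section
variable {m n : ℕ} (C : BoolCircuit m n)

theorem countP_encode_port {f : Symbol → Bool} (hf : ∀ σ, (∀ κ : Kind, σ ≠ κ.symbol) → σ ≠ .input →
    f σ = false) (P : RawPort) : P.encode.countP f = 0 := by
  refine List.countP_eq_zero.2 fun σ hσ => ?_
  rw [hf σ (RawPort.ne_of_mem_encode hσ) ?_]
  · simp
  · rintro rfl
    cases P <;> simp [RawPort.encode] at hσ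

theorem countP_flatMap_encode {f : Symbol → Bool} (hf : ∀ σ, (∀ κ : Kind, σ ≠ κ.symbol) →
    σ ≠ .input → f σ = false) (its : List Item) :
    (its.flatMap Item.encode).countP f = its.countP fun it => f it.kind.symbol := by
  induction its with
  | nil => rfl
  | cons it its ih =>
    have e : (it.snd.elim [] RawPort.encode).countP f = 0 := by
      cases it.snd with
      | none => rfl
      | some q => exact countP_encode_port hf q
    rw [List.flatMap_cons, List.countP_append, ih, Item.encode, List.countP_cons,
      List.countP_append, countP_encode_port hf, e, List.countP_cons]
    omega

/-- Ports contain no symbols of kinds or of input variables, so the three numbers can be found by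
counting symbols, without parsing. -/
theorem countP_encode {f : Symbol → Bool} (hf : ∀ σ, (∀ κ : Kind, σ ≠ κ.symbol) →
    σ ≠ .input → f σ = false) (hg : ∀ κ : Kind, κ ≠ .out → f κ.symbol = f .and) :
    C.encode.countP f = (if f .input then m else 0) + ((if f .and then C.gates else 0) +
      if f .out then n else 0) := by
  rw [C.encode_eq, List.countP_append, List.countP_append, countP_flatMap_encode hf,
    countP_flatMap_encode hf, List.countP_replicate]
  have e1 : C.gateItems.countP (fun it => f it.kind.symbol) = if f .and then C.gates else 0 := by
    rw [← length_gateItems C]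
    split_ifs with h
    · exact List.countP_eq_length.2 fun it hit => (hg _ (C.kind_ne_of_mem hit)).trans h
    · exact List.countP_eq_zero.2 fun it hit => by rwa [hg _ (C.kind_ne_of_mem hit)]
  have e2 : C.outItems.countP (fun it => f it.kind.symbol) = if f .out then n else 0 := by
    conv_rhs => rw [← length_outItems C]
    split_ifs with h
    · exact List.countP_eq_length.2 fun it hit => by rw [C.kind_eq_of_mem hit]; exact h
    · exact List.countP_eq_zero.2 fun it hit => by rw [C.kind_eq_of_mem hit]; exact h
  rw [e1, e2]

theorem countP_isInput : C.encode.countP isInput = m := by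
  rw [countP_encode C (fun σ _ h => by cases σ <;> simp_all [isInput])
    (fun κ _ => by cases κ <;> rfl)]
  simp [isInput]

theorem countP_isGate : C.encode.countP isGate = C.gates := by
  rw [countP_encode C (fun σ h _ => ?_) (fun κ h => by cases κ <;> simp_all [isGate, Kind.symbol])]
  · simp [isGate]
  · cases σ
    · rfl
    · exact absurd rfl (h .and)
    · exact absurd rfl (h .or)
    · exact absurd rfl (h .not)
    · exact absurd rfl (h .fork)
    all_goals rfl

theorem countP_isOut : C.encode.countP isOut = n := by
  rw [countP_encode C (fun σ h _ => ?_) (fun κ h => by cases κ <;> simp_all [isOut, Kind.symbol])]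
  · simp [isOut]
  · cases σ
    case out => exact absurd rfl (h .out)
    all_goals rfl

variable (chunk : Prim → List (Gen d)) (k : Fin d)

/-- Writes the word of a circuit. -/
noncomputable def putWord : Code d :=
  .seq (putCode k) <| .seq countItems <| .seq (putPrim chunk .ins) <| .seq (putTests chunk) <|
  .seq (.blk [.inc .x]) <| .seq (putCircuit chunk) <| .seq (putPrim chunk .del) <|
  .seq (putPrim chunk .twist) <| .seq (clear .g) <| .seq (clear .n) <| .seq (clear .x)
    (.loop [.popInp] Option.isSome (.blk []))

/-- The description is the last thing left besides the counters, and a valid halting configuration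
requires that it be removed. -/
theorem dropInput_runs {s : St d} (hs : s.reg = none) (hB : s.inp.length ≤ B) :
    Runs B (.loop [.popInp] Option.isSome (.blk [])) s { s with inp := [] } := by
  refine LoopRuns.runs (n := s.inp.length) ?_ hB
  have key : ∀ (A : List Symbol) (s : St d), s.inp = A →
      LoopRuns B [.popInp] Option.isSome (.blk []) A.length s { s with reg := none, inp := [] } := by
    intro A
    induction A with
    | nil =>
      intro s hA
      refine .zero ?_ rfl
      simp only [execAll, List.foldl, Basic.exec, hA]
      rfl
    | cons σ A ih =>
      intro s hA
      have h1 : execAll [.popInp] s = (s.tape A s.aux).setReg (some σ) := by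
        simp only [execAll, List.foldl, Basic.exec, hA]; rfl
      exact .succ h1 rfl (.blk rfl) ((ih _ rfl).cast rfl)
  refine (key _ _ rfl).cast ?_
  rw [hs]

/-- The word is produced from right to left: first the code of the circuit, on the first reading of
the input, and then the program with its first instruction rightmost. The order of `emit` is chosen
to match this. -/
theorem putWord_runs (hB : Bounds C B) (hm : m + 7 ≤ B) :
    Runs B (putWord chunk k) (St.init C.encode)
      (St.final none (encodeWord (circuitWord chunk k ⟨m, n, C⟩))) := by
  have hg := hB.gates
  have hn := hB.outputs
  set w := block k none ++ emitCode k C.encode [] with hw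
  have e1 : Runs B (putCode k) (St.init C.encode)
      { St.init (d := d) [] with aux := C.encode.reverse, out := encodeWord w } :=
    (putCode_runs k [] rfl rfl hB.encode).cast (by simp [St.init, hw])
  have e2 : Runs B (countItems (d := d))
      { St.init (d := d) [] with aux := C.encode.reverse, out := encodeWord w }
      { St.init (d := d) C.encode with out := encodeWord w, m := m, g := C.gates, n := n } := by
    refine (countItems_runs rfl ?_).cast ?_
    · change C.encode.reverse.length ≤ B
      rw [List.length_reverse]
      exact hB.encode
    · simp only [St.init, List.countP_reverse, countP_isInput, countP_isGate, countP_isOut,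
        List.reverse_reverse, List.append_nil, Nat.zero_add]
  refine (e1.seq (e2.seq ((putPrim_runs .ins _).seq ((putTests_runs ?_ ?_ ?_).seq
    ((Runs.blk rfl).seq ((putCircuit_runs C hB ?_ ?_ ?_ ?_).seq ((putPrim_runs .del _).seq
    ((putPrim_runs .twist _).seq ((clear_runs ?_).seq ((clear_runs ?_).seq ((clear_runs ?_).seq
    (dropInput_runs ?_ ?_)))))))))))).cast ?_
  · exact ⟨rfl, rfl, rfl, rfl, rfl, rfl⟩
  · rfl
  · exact hm
  · exact ⟨⟨rfl, rfl, rfl, rfl, rfl, rfl⟩, rfl, rfl, rfl, rfl, rfl, rfl, rfl, rfl⟩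
  · rfl
  · rfl
  · rfl
  · change C.gates ≤ B
    omega
  · exact hn
  · change 1 + 3 * roomFor n ≤ B
    omega
  · rfl
  · exact hB.encode
  · simp only [execAll, List.foldl, Basic.exec, St.init, St.final, St.write, St.set, St.setReg,
      St.get, circuitWord, prog, encodeWord_emit, emitString, emitString_append]
    rfl

end

theorem polyTimeInSize_circuitWord (chunk : Prim → List (Gen d)) (k : Fin d) :
    PolyTimeInSize (circuitWord chunk k) := by
  refine ⟨machine (putWord chunk k),
    -- One loop bound, 8(|C| + 1)^2, serves for the length of the description, the positions on the
    -- tape and m + 7. The summand 1 is the halting step.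
    (putWord chunk k).cost.comp (8 * (.X + 1) ^ 2) + 1, fun C => ?_⟩
  obtain ⟨m, n, C⟩ := C
  have hm := C.inputs_le_size
  have hp := C.inputPos_le
  refine machine_outputs (putWord_runs C chunk k ⟨C.length_encode_le, hp⟩ ?_) ?_
  · rcases Nat.eq_zero_or_pos C.size with h | h
    · rw [h] at hm ⊢
      omega
    · nlinarith
  · simp [AnyBoolCircuit.size]

end Machine

end G31

theorem mainTheorem4 {d : ℕ} (δ : Fin d → G31)
    (hδ : Subgroup.closure (Set.range δ) = ⊤) (ρ : G31.ShortRule) :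
    ∃ w : AnyBoolCircuit → List (G31.Gen d),
      Function.Injective w ∧
      (∀ (m n : ℕ) (C : BoolCircuit m n),
        G31.StronglySimulates (G31.evalWord δ ρ (w ⟨m, n, C⟩)) C.fn) ∧
      (∀ (m n : ℕ) (C C' : BoolCircuit m n), C.fn = C'.fn →
        ∀ k : ℕ, k < m → ∀ x : Fin k → Bool,
          (G31.evalWord δ ρ (w ⟨m, n, C⟩)).map (G31.bitsHash (false :: List.ofFn x)) =
            (G31.evalWord δ ρ (w ⟨m, n, C'⟩)).map (G31.bitsHash (false :: List.ofFn x))) ∧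
      (∃ c : ℕ, 0 < c ∧ ∀ C : AnyBoolCircuit,
        (w C).length < c * C.size ^ 4 + c ∧
        ∀ i : ℕ, G31.Gen.tau i ∈ w C → i + 1 ≤ c * C.size ^ 2 + c) ∧
      PolyTimeInSize w := by
  obtain ⟨chunk, h, h'⟩ := G31.exists_chunk δ ρ hδ
  -- Any generator can serve for the pairs of inverse letters that encode circuits.
  let k : Fin d := ⟨0, G31.pos_of_closure δ hδ⟩
  refine ⟨G31.circuitWord chunk k, G31.circuitWord_injective chunk k, ?_, ?_,
    G31.circuitWord_bounds h' k, G31.Machine.polyTimeInSize_circuitWord chunk k⟩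
  · intro m n C
    rw [G31.evalWord_circuitWord δ ρ h]
    exact G31.stronglySimulates_prog ρ C
  · intro m n C C' _ j hj x
    rw [G31.evalWord_circuitWord δ ρ h, G31.evalWord_circuitWord δ ρ h]
    exact G31.map_prog_short ρ C C' hj x
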